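/- Conventions. Manifolds and Lie groups are smooth, finite-dimensional, Hausdorff and second countable. A Pfaffian system on $M$ is a smooth constant-rank subbundle $V\subset T^*M$, or the differential system $\mathcal V$ generated by $V$, i.e. the ideal of $\Omega^*(M)$ generated by the sections $\theta$ of $V$ and their exterior derivatives $d\theta$. A subbundle $F$ is integrable if $d\theta\equiv 0 \bmod F$ for all sections $\theta$ of $F$, and $V^{(\infty)}$ denotes the largest (constant-rank) integrable subbundle of $V$. $\Omega^1(V)$ and $\Omega^2(V)$ denote the smooth sections of $V$ and of $\Lambda^2(V)$. Two Pfaffian systems $\hat V,\check V$ on $M$ form a *Darboux pair* if $\hat V^{(\infty)}$ and $\check V^{(\infty)}$ exist as (constant-rank) subbundles and (i) $\hat V+\check V^{(\infty)}=T^*M$ and $\check V+\hat V^{(\infty)}=T^*M$; (ii) $\hat V^{(\infty)}\cap\check V^{(\infty)}=\{0\}$; (iii) $d\omega\in\Omega^2(\hat V)+\Omega^2(\check V)$ for all $\omega\in\Omega^1(\hat V\cap\check V)$. Let a Lie group $G$ act smoothly on $M$. The action is *regular* if the orbit space $\overline M=M/G$ is a smooth manifold such that the projection $\mathbf q:M\to\overline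 M$ is a smooth submersion and has smooth local cross-sections on an open neighbourhood of each point of $\overline M$; $G$ is then a regular symmetry group of a Pfaffian system $W$ if it preserves $W$. The group $G$ is *transverse* to an invariant subbundle $I\subset T^*M$ if $\Gamma_x\cap\operatorname{ann} I_x=\{0\}$ for all $x\in M$, where $\Gamma_x\subset T_xM$ is the space of values at $x$ of the infinitesimal generators of the action. For a Pfaffian system $W$ with differential system $\mathcal W$, put $$\mathcal W/G=\{\omega\in\Omega^*(\overline M)\mid \mathbf q^*\omega\in\mathcal W\},\qquad W/G=\{\omega\in T^*\overline M\mid \mathbf q^*\omega\in W\}.$$ **Theorem 3.2.** Let $\{\hat W,\check W\}$ be a Darboux pair on $M$. Suppose that $G$ is a regular symmetry group of $\hat W$ and of $\check W$ and that $G$ is transverse to $\hat W\cap\check W^{(\infty)}$ and to $\hat W^{(\infty)}\cap\check W$. Then $\hat W/G$ and $\check W/G$ are smooth constant-rank subbundles of $T^*\overline M$, the quotient differential systems $\hat{\mathcal W}/G$ and $\check{\mathcal W}/G$ are the Pfaffian systems generated by $\hat W/G$ and $\check W/G$ respectively, and $\{\hat W/G,\check W/G\}$ is a Darboux pair on $\overline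 M$. -/

import Mathlib

open scoped Manifold ContDiff Topology

namespace DarbouxReduction

noncomputable section

/-! ### Wedge product of alternating forms on a vector space -/

/-- The wedge product `α ∧ β` of two alternating forms, normalised as the sum over shuffles, so
that `(α ∧ β)(u, v) = α u * β v - α v * β u` for 1-forms. -/
def wedge {T : Type*} [AddCommGroup T] [Module ℝ T] [TopologicalSpace T] {k l : ℕ}
    (α : T [⋀^Fin k]→L[ℝ] ℝ) (β : T [⋀^Fin l]→L[ℝ] ℝ) : T [⋀^Fin (k + l)]→L[ℝ] ℝ :=
  { ((LinearMap.mul' ℝ ℝ).compAlternatingMap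
      (AlternatingMap.domCoprod α.toAlternatingMap β.toAlternatingMap)).domDomCongr
        finSumFinEquiv with
    cont := by
      have h : ∀ σ : Equiv.Perm.ModSumCongr (Fin k) (Fin l), Continuous fun v : Fin (k + l) → T =>
          LinearMap.mul' ℝ ℝ (AlternatingMap.domCoprod.summand α.toAlternatingMap
            β.toAlternatingMap σ (fun i => v (finSumFinEquiv i))) := by
        intro σ
        induction σ using Quotient.inductionOn' with
        | h σ =>
          simp only [AlternatingMap.domCoprod.summand_mk'', smul_apply,
            MultilinearMap.domDomCongr_apply, MultilinearMap.domCoprod_apply, map_zsmul_unit,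
            LinearMap.mul'_apply]
          refine Continuous.const_smul (Continuous.mul ?_ ?_) _
          · exact α.cont.comp (by fun_prop)
          · exact β.cont.comp (by fun_prop)
      have h2 := continuous_finsetSum Finset.univ (fun σ _ => h σ)
      refine h2.congr fun v => ?_
      simp [AlternatingMap.domCoprod_apply, map_sum, Function.comp_def] }

/-- `Λ²(V)`: the span, in the space of alternating 2-forms, of the products of two elements
of `V`. -/
def exteriorSquare {T : Type*} [AddCommGroup T] [Module ℝ T] [TopologicalSpace T]
    (V : Submodule ℝ (T [⋀^Fin 1]→L[ℝ] ℝ)) : Submodule ℝ (T [⋀^Fin 2]→L[ℝ] ℝ) :=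
  Submodule.span ℝ {η | ∃ α ∈ V, ∃ β ∈ V, η = wedge α β}

/-- The annihilator in `T` of a space of 1-forms on `T`. -/
def annihilator {T : Type*} [AddCommGroup T] [Module ℝ T] [TopologicalSpace T]
    (V : Submodule ℝ (T [⋀^Fin 1]→L[ℝ] ℝ)) : Submodule ℝ T where
  carrier := {v | ∀ w ∈ V, w ![v] = 0}
  zero_mem' := by
    intro w _
    exact w.map_coord_zero 0 rfl
  add_mem' := by
    intro a b ha hb w hw
    have := w.vecCons_add ![] a b
    simp_all
  smul_mem' := by
    intro c a ha w hw
    have := w.vecCons_smul ![] c a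
    simp_all

/-! ### Differential forms on manifolds -/

/-- A (not necessarily smooth) differential `k`-form on a manifold `M` modelled on `E`. -/
abbrev DForm (E : Type*) [NormedAddCommGroup E] [NormedSpace ℝ E]
    (M : Type*) [TopologicalSpace M] [ChartedSpace E M] (k : ℕ) :=
  ∀ x : M, TangentSpace 𝓘(ℝ, E) x [⋀^Fin k]→L[ℝ] ℝ

/-- A field of subspaces of the cotangent spaces; covectors are alternating 1-forms. -/
abbrev CotField (E : Type*) [NormedAddCommGroup E] [NormedSpace ℝ E]
    (M : Type*) [TopologicalSpace M] [ChartedSpace E M] :=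
  ∀ x : M, Submodule ℝ (TangentSpace 𝓘(ℝ, E) x [⋀^Fin 1]→L[ℝ] ℝ)

variable {E : Type*} [NormedAddCommGroup E] [NormedSpace ℝ E]
  {M : Type*} [TopologicalSpace M] [ChartedSpace E M]
  {E' : Type*} [NormedAddCommGroup E'] [NormedSpace ℝ E']
  {N : Type*} [TopologicalSpace N] [ChartedSpace E' N]

/-- The pullback `f^* ω` of a form by a map. -/
def pullback {k : ℕ} (f : M → N) (w : DForm E' N k) : DForm E M k := fun x =>
  (w (f x)).compContinuousLinearMap (mfderiv 𝓘(ℝ, E) 𝓘(ℝ, E') f x)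

/-- The coordinate expression of a form in the preferred chart at `c`: its pullback by the
inverse of the chart (meaningful on the target of the chart). -/
def inChart {k : ℕ} (c : M) (w : DForm E M k) : E → E [⋀^Fin k]→L[ℝ] ℝ :=
  pullback (E := E) (M := E) (chartAt E c).symm w

/-- Smoothness of a form on an open set. -/
def SmoothOn {k : ℕ} (w : DForm E M k) (U : Set M) : Prop :=
  ∀ c : M, ContDiffOn ℝ ∞ (inChart c w)
    ((chartAt E c).target ∩ (chartAt E c).symm ⁻¹' U)

/-- `ω ∈ Ω^k(M)`: smoothness of a form. -/
def Smooth {k : ℕ} (w : DForm E M k) : Prop := SmoothOn w Set.univ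

/-- The exterior derivative, computed at `x` in the preferred chart at `x`. -/
def extD {k : ℕ} (w : DForm E M k) : DForm E M (k + 1) := fun x =>
  (extDeriv (inChart x w) (chartAt E x x)).compContinuousLinearMap
    (mfderiv 𝓘(ℝ, E) 𝓘(ℝ, E) (chartAt E x) x)

/-- The pointwise wedge product of differential forms. -/
def wedgeForm {k l : ℕ} (α : DForm E M k) (β : DForm E M l) : DForm E M (k + l) := fun x =>
  wedge (α x) (β x)

/-! ### Pfaffian systems -/

/-- `W` is a Pfaffian system in the sense of bundles: a smooth subbundle of the cotangent bundle,
of constant rank. -/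
def IsSubbundle (W : CotField E M) : Prop :=
  ∃ r : ℕ, ∀ x₀ : M, ∃ U : Set M, IsOpen U ∧ x₀ ∈ U ∧ ∃ θ : Fin r → DForm E M 1,
    (∀ i, SmoothOn (θ i) U) ∧
    ∀ x ∈ U, LinearIndependent ℝ (fun i => θ i x) ∧
      Submodule.span ℝ (Set.range fun i => θ i x) = W x

/-- `θ ∈ Ω¹(W)`: a smooth 1-form with values in `W`. -/
def IsSection (W : CotField E M) (θ : DForm E M 1) : Prop :=
  Smooth θ ∧ ∀ x, θ x ∈ W x

/-- `α ∈ Ω²(W)`: a smooth 2-form with values in `Λ²(W)`. -/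
def IsSection₂ (W : CotField E M) (α : DForm E M 2) : Prop :=
  Smooth α ∧ ∀ x, α x ∈ exteriorSquare (W x)

/-- An integrable subbundle (Frobenius condition `dθ ≡ 0 mod F` for all sections `θ` of `F`). -/
def IsIntegrable (F : CotField E M) : Prop :=
  IsSubbundle F ∧ ∀ θ : DForm E M 1, IsSection F θ →
    ∀ x, ∀ u ∈ annihilator (F x), ∀ v ∈ annihilator (F x), extD θ x ![u, v] = 0

/-- `W^(∞)`, the largest integrable subbundle of `W`. It is written as the pointwise supremum of
all integrable subbundles of `W`; that this supremum is again an integrable subbundle (so that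
it is the largest one) is part of `IsDarbouxPair`. -/
def infDerived (W : CotField E M) : CotField E M := fun x =>
  ⨆ F ∈ {F : CotField E M | IsIntegrable F ∧ ∀ y, F y ≤ W y}, F x

/-- Darboux pairs. -/
structure IsDarbouxPair (V₁ V₂ : CotField E M) : Prop where
  subbundle₁ : IsSubbundle V₁
  subbundle₂ : IsSubbundle V₂
  /-- `V₁^(∞)` exists as an integrable subbundle of constant rank -/
  integrable₁ : IsIntegrable (infDerived V₁)
  /-- `V₂^(∞)` exists as an integrable subbundle of constant rank -/
  integrable₂ : IsIntegrable (infDerived V₂)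
  sum₁ : ∀ x, V₁ x ⊔ infDerived V₂ x = ⊤
  sum₂ : ∀ x, V₂ x ⊔ infDerived V₁ x = ⊤
  inter : ∀ x, infDerived V₁ x ⊓ infDerived V₂ x = ⊥
  structureEq : ∀ w : DForm E M 1, IsSection (fun x => V₁ x ⊓ V₂ x) w →
    ∃ α β : DForm E M 2, IsSection₂ V₁ α ∧ IsSection₂ V₂ β ∧ extD w = α + β

/-- The differential system generated by the sections of `W`: the smallest graded
ideal of the algebra of smooth forms which contains all sections `θ` of `W` and their exterior
derivatives `dθ`; `PfaffianEDS W k` is its part in degree `k`. By graded commutativity,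
closure under multiplication on the right suffices. -/
inductive PfaffianEDS (W : CotField E M) : ∀ k : ℕ, DForm E M k → Prop
  | gen (θ : DForm E M 1) : IsSection W θ → PfaffianEDS W 1 θ
  | extD (θ : DForm E M 1) : IsSection W θ → PfaffianEDS W 2 (extD θ)
  | zero (k : ℕ) : PfaffianEDS W k 0
  | add (k : ℕ) (w η : DForm E M k) :
      PfaffianEDS W k w → PfaffianEDS W k η → PfaffianEDS W k (w + η)
  | wedge (k l : ℕ) (w : DForm E M k) (α : DForm E M l) :
      PfaffianEDS W k w → Smooth α → PfaffianEDS W (k + l) (wedgeForm w α)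

/-! ### Group actions and quotients -/

/-- `q : M → N` exhibits the manifold `N` as the orbit space `M/G` of a regular action: the fibres
of `q` are the orbits, `q` is a smooth surjective submersion, and it has smooth local
cross-sections. -/
structure IsRegularQuotient (G : Type*) [Group G] [MulAction G M] (q : M → N) : Prop where
  surjective : Function.Surjective q
  fibre_eq_orbit : ∀ x x' : M, q x = q x' ↔ ∃ g : G, g • x = x'
  smooth : ContMDiff 𝓘(ℝ, E) 𝓘(ℝ, E') ∞ q
  submersion : ∀ x, Function.Surjective (mfderiv 𝓘(ℝ, E) 𝓘(ℝ, E') q x)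
  section_exists : ∀ y : N, ∃ U : Set N, IsOpen U ∧ y ∈ U ∧ ∃ ξ : N → M,
    ContMDiffOn 𝓘(ℝ, E') 𝓘(ℝ, E) ∞ ξ U ∧ ∀ z ∈ U, q (ξ z) = z

/-- `G` preserves `W`: `g^*` maps `W` at `g • x` into `W` at `x`. -/
def IsInvariant (G : Type*) [Group G] [MulAction G M] (W : CotField E M) : Prop :=
  ∀ (g : G) (x : M), ∀ w ∈ W (g • x),
    w.compContinuousLinearMap (mfderiv 𝓘(ℝ, E) 𝓘(ℝ, E) (fun z : M => g • z) x) ∈ W x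

/-- `Γ_x`, the values at `x` of the infinitesimal generators of the action: the range
of the differential at `1` of the orbit map `g ↦ g • x`. (Here `1 • x = x`.) -/
def infGenerators (EG : Type*) [NormedAddCommGroup EG] [NormedSpace ℝ EG]
    (G : Type*) [TopologicalSpace G] [ChartedSpace EG G] [Group G] [MulAction G M] (x : M) :
    Submodule ℝ (TangentSpace 𝓘(ℝ, E) x) :=
  LinearMap.range
    (mfderiv 𝓘(ℝ, EG) 𝓘(ℝ, E) (fun g : G => g • x) (1 : G) :
      TangentSpace 𝓘(ℝ, EG) (1 : G) →L[ℝ] TangentSpace 𝓘(ℝ, E) x).toLinearMap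

/-- `G` is transverse to `W`: `Γ_x ∩ ann W_x = 0` for all `x`. -/
def IsTransverse (EG : Type*) [NormedAddCommGroup EG] [NormedSpace ℝ EG]
    (G : Type*) [TopologicalSpace G] [ChartedSpace EG G] [Group G] [MulAction G M]
    (W : CotField E M) : Prop :=
  ∀ x : M, infGenerators (E := E) EG G x ⊓ annihilator (W x) = ⊥

/-- The bundle reduction `W/G = {ω ∈ T^*(M/G) | q^* ω ∈ W}`. -/
def quotientBundle (q : M → N) (W : CotField E M) : CotField E' N := fun y =>
  ⨅ x : {x : M // q x = y}, (W x.1).comap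
    (ContinuousAlternatingMap.compContinuousLinearMapₗ
      (mfderiv 𝓘(ℝ, E) 𝓘(ℝ, E') q x.1 :
        TangentSpace 𝓘(ℝ, E) x.1 →L[ℝ] TangentSpace 𝓘(ℝ, E') y))

/-- The reduction `I/G = {ω ∈ Ω^*(M/G) | q^* ω ∈ I}` of a differential system, degree by degree. -/
def QuotientEDS (q : M → N) (I : ∀ k : ℕ, DForm E M k → Prop) (k : ℕ) (w : DForm E' N k) : Prop :=
  Smooth w ∧ I k (pullback q w)

end

end DarbouxReduction

/-! Everything rests on a splitting of cotangent spaces along local cross-sections. Take S = W₁ ⊓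
W₂^(∞) or S = W₁^(∞) ⊓ W₂. The Darboux conditions say that the two bundles defining S span the
cotangent bundle, so every covector in S extends to a smooth local section of S
(`exists_local_section_inf`). Transversality says that S separates vertical vectors, so d local
sections σ of S can be chosen that restrict to a coframe of the fibres, d being the fibre dimension.
Over a local section ξ of q, tangent vectors of the quotient then lift to the common kernel of the
σ, by a smooth map R. This is an `AdaptedLift`: every covector w at ξ(y) is q^*(R^*w) plus a
combination of the σ.

For an invariant W containing S this gives W = q^*(W/G) ⊕ span σ along ξ. Hence W/G = R^*W, which is
smooth, and its rank is that of W minus d (`isSubbundle_quotientBundle`). Since R^*q^* is the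
identity, conditions (i) and the structure equation (iii) descend by applying R^*; (ii) descends
because q^* is injective. Pullback by the submersion q preserves integrability, and so does
reduction; therefore (W/G)^(∞) = W^(∞)/G (`infDerived_quotientBundle`).

For differential systems the delicate point is that R is not the differential of a map, so R^* does
not commute with d. If S lies in W^(∞), then dσ vanishes on the annihilator of W, and a section θ =
Σ aᵢ q^*νᵢ + Σ bⱼ σⱼ of W satisfies R^*dθ ≡ Σ aᵢ dνᵢ modulo W/G. So R^* carries the system of W into
that of W/G locally (`AdaptedLift.exists_pfaffianEDS`), and w = R^*q^*w belongs locally to the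
latter whenever q^*w belongs to the former. Globally this suffices because the system of a subbundle
has finitely many generators, whose coefficients can be averaged by a partition of unity
(`pfaffianEDS_of_local`).

Transversality is stated for the infinitesimal generators, whereas the splitting needs it for ker
dq. That the two agree is not built into the quotient, which only has orbits as fibres;
`ker_mfderiv_le_infGenerators` proves it by comparing Hausdorff dimensions, G being second
countable. -/

namespace DarbouxReduction

noncomputable section

set_option linter.unusedSectionVars false

/-! ### Smoothness of families of alternating forms -/

section SmoothFamilies

variable {X : Type*} [NormedAddCommGroup X] [NormedSpace ℝ X]
  {E : Type*} [NormedAddCommGroup E] [NormedSpace ℝ E] [FiniteDimensional ℝ E]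
  {E' : Type*} [NormedAddCommGroup E'] [NormedSpace ℝ E'] {k : ℕ} {n : WithTop ℕ∞}

/-- The values of an alternating form on the vectors of a basis. -/
def basisEval (E : Type*) [NormedAddCommGroup E] [NormedSpace ℝ E] [FiniteDimensional ℝ E]
    (k : ℕ) : (E [⋀^Fin k]→L[ℝ] ℝ) →ₗ[ℝ]
      ((Fin k → Fin (Module.finrank ℝ E)) → ℝ) where
  toFun w s := w fun i => Module.finBasis ℝ E (s i)
  map_add' _ _ := rfl
  map_smul' _ _ := rfl

theorem basisEval_injective : Function.Injective (basisEval E k) := by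
  intro w w' h
  have : w.toAlternatingMap = w'.toAlternatingMap := by
    refine Module.Basis.ext_alternating (Module.finBasis ℝ E) fun s _ => ?_
    exact congrFun h s
  ext v
  exact congrArg (fun a => a v) this

instance alternating_finiteDimensional : FiniteDimensional ℝ (E [⋀^Fin k]→L[ℝ] ℝ) :=
  Module.Finite.of_injective _ (basisEval_injective (E := E) (k := k))

/-- Evaluation of alternating forms at a fixed tuple of vectors. -/
def evalCLM (v : Fin k → E) : (E [⋀^Fin k]→L[ℝ] ℝ) →L[ℝ] ℝ :=
  LinearMap.toContinuousLinearMap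
    { toFun := fun w => w v, map_add' := fun _ _ => rfl, map_smul' := fun _ _ => rfl }

/-- Evaluation on tuples of basis vectors is an injective linear map into a finite product of copies
of ℝ, and it has a linear left inverse. Smoothness of forms thereby becomes smoothness of scalar
functions. -/
theorem contDiffAt_alternating_iff {f : X → E [⋀^Fin k]→L[ℝ] ℝ} {x : X} :
    ContDiffAt ℝ n f x ↔ ∀ v, ContDiffAt ℝ n (fun z => f z v) x := by
  constructor
  · intro h v
    exact (evalCLM v).contDiff.contDiffAt.comp x h
  · intro h
    obtain ⟨g, hg⟩ := (basisEval E k).exists_leftInverse_of_injective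
      (LinearMap.ker_eq_bot.2 basisEval_injective)
    have h1 : ContDiffAt ℝ n (fun z => basisEval E k (f z)) x :=
      contDiffAt_pi.2 fun s => h _
    have h2 := (LinearMap.toContinuousLinearMap g).contDiff.contDiffAt.comp x h1
    refine h2.congr_of_eventuallyEq (Filter.Eventually.of_forall fun z => ?_)
    exact (LinearMap.congr_fun hg (f z)).symm

/-- Expanding each argument in a basis gives a finite sum of products of smooth scalars. -/
theorem _root_.ContDiffAt.alternating_apply {f : X → E [⋀^Fin k]→L[ℝ] ℝ} {v : Fin k → X → E} {x : X}
    (hf : ContDiffAt ℝ n f x) (hv : ∀ i, ContDiffAt ℝ n (v i) x) :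
    ContDiffAt ℝ n (fun z => f z fun i => v i z) x := by
  classical
  set b := Module.finBasis ℝ E
  have h : ∀ z, (f z fun i => v i z) =
      ∑ s : Fin k → Fin (Module.finrank ℝ E),
        (∏ i, b.coord (s i) (v i z)) * f z fun i => b (s i) := by
    intro z
    have h1 : (fun i => v i z) = fun i => ∑ j, b.coord j (v i z) • b j := by
      funext i
      exact (b.sum_repr (v i z)).symm
    rw [h1]
    have := (f z).toMultilinearMap.map_sum (fun i j => b.coord j (v i z) • b j)
    refine this.trans (Finset.sum_congr rfl fun s _ => ?_)
    exact (f z).toMultilinearMap.map_smul_univ (fun i => b.coord (s i) (v i z)) fun i => b (s i)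
  simp_rw [h]
  refine ContDiffAt.sum fun s _ => ContDiffAt.mul (contDiffAt_prod fun i _ => ?_) ?_
  · exact (LinearMap.toContinuousLinearMap (b.coord (s i))).contDiff.contDiffAt.comp x (hv i)
  · exact contDiffAt_alternating_iff.1 hf _

theorem _root_.ContDiffAt.alternating_comp [FiniteDimensional ℝ E'] {f : X → E [⋀^Fin k]→L[ℝ] ℝ}
    {A : X → E' →L[ℝ] E} {x : X}
    (hf : ContDiffAt ℝ n f x) (hA : ContDiffAt ℝ n A x) :
    ContDiffAt ℝ n (fun z => (f z).compContinuousLinearMap (A z)) x := by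
  refine contDiffAt_alternating_iff.2 fun v => ?_
  exact hf.alternating_apply fun i => hA.clm_apply contDiffAt_const

end SmoothFamilies

/-! ### Algebra of the wedge product -/

section Wedge

variable {T : Type*} [AddCommGroup T] [Module ℝ T] [TopologicalSpace T]
  {T' : Type*} [AddCommGroup T'] [Module ℝ T'] [TopologicalSpace T'] {k l m : ℕ}

/-- Summing over all permutations counts each shuffle k! l! times. Clearing this factor avoids the
quotient of the permutation group, and wedge identities become reindexings of finite sums. -/
theorem wedge_apply (α : T [⋀^Fin k]→L[ℝ] ℝ) (β : T [⋀^Fin l]→L[ℝ] ℝ) (v : Fin (k + l) → T) :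
    ((k.factorial * l.factorial : ℕ) : ℝ) * wedge α β v =
      ∑ σ : Equiv.Perm (Fin k ⊕ Fin l), ((Equiv.Perm.sign σ : ℤ) : ℝ) *
        (α (fun i => v (finSumFinEquiv (σ (Sum.inl i)))) *
          β (fun i => v (finSumFinEquiv (σ (Sum.inr i))))) := by
  have h := MultilinearMap.domCoprod_alternization_eq α.toAlternatingMap β.toAlternatingMap
  have h2 := congrArg (fun w => LinearMap.mul' ℝ ℝ (w fun i => v (finSumFinEquiv i))) h
  simp only [MultilinearMap.alternatization_apply, map_sum] at h2
  simp only [Fintype.card_fin, AlternatingMap.smul_apply, map_nsmul] at h2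
  rw [← nsmul_eq_mul]
  refine Eq.trans h2.symm ?_
  refine Finset.sum_congr rfl fun σ _ => ?_
  rw [MultilinearMap.domDomCongr_apply, MultilinearMap.domCoprod_apply]
  rw [map_zsmul_unit, LinearMap.mul'_apply, Units.smul_def, zsmul_eq_mul]
  rfl

end Wedge

section Wedge

variable {T : Type*} [AddCommGroup T] [Module ℝ T] [TopologicalSpace T]
  {T' : Type*} [AddCommGroup T'] [Module ℝ T'] [TopologicalSpace T'] {k l m : ℕ}

theorem wedge_apply_perm (α : T [⋀^Fin k]→L[ℝ] ℝ) (β : T [⋀^Fin l]→L[ℝ] ℝ)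
    (v : Fin (k + l) → T) :
    ((k.factorial * l.factorial : ℕ) : ℝ) * wedge α β v =
      ∑ σ : Equiv.Perm (Fin (k + l)), ((Equiv.Perm.sign σ : ℤ) : ℝ) *
        (α (fun i => v (σ (Fin.castAdd l i))) * β (fun i => v (σ (Fin.natAdd k i)))) := by
  rw [wedge_apply, ← Equiv.sum_comp (Equiv.permCongr finSumFinEquiv)]
  refine Finset.sum_congr rfl fun σ _ => ?_
  rw [Equiv.Perm.sign_permCongr]
  congr 3 <;> (funext i; simp [Equiv.permCongr_apply])

theorem factorial_mul_ne_zero (k l : ℕ) : ((k.factorial * l.factorial : ℕ) : ℝ) ≠ 0 := by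
  positivity

theorem wedge_add_left (α α' : T [⋀^Fin k]→L[ℝ] ℝ) (β : T [⋀^Fin l]→L[ℝ] ℝ) :
    wedge (α + α') β = wedge α β + wedge α' β := by
  ext v
  refine mul_left_cancel₀ (factorial_mul_ne_zero k l) ?_
  rw [ContinuousAlternatingMap.add_apply, mul_add, wedge_apply, wedge_apply, wedge_apply,
    ← Finset.sum_add_distrib]
  refine Finset.sum_congr rfl fun σ _ => ?_
  rw [ContinuousAlternatingMap.add_apply]
  ring

theorem wedge_add_right (α : T [⋀^Fin k]→L[ℝ] ℝ) (β β' : T [⋀^Fin l]→L[ℝ] ℝ) :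
    wedge α (β + β') = wedge α β + wedge α β' := by
  ext v
  refine mul_left_cancel₀ (factorial_mul_ne_zero k l) ?_
  rw [ContinuousAlternatingMap.add_apply, mul_add, wedge_apply, wedge_apply, wedge_apply,
    ← Finset.sum_add_distrib]
  refine Finset.sum_congr rfl fun σ _ => ?_
  rw [ContinuousAlternatingMap.add_apply]
  ring

theorem wedge_smul_left (c : ℝ) (α : T [⋀^Fin k]→L[ℝ] ℝ) (β : T [⋀^Fin l]→L[ℝ] ℝ) :
    wedge (c • α) β = c • wedge α β := by
  ext v
  refine mul_left_cancel₀ (factorial_mul_ne_zero k l) ?_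
  rw [ContinuousAlternatingMap.smul_apply, smul_eq_mul, mul_left_comm, wedge_apply, wedge_apply,
    Finset.mul_sum]
  refine Finset.sum_congr rfl fun σ _ => ?_
  rw [ContinuousAlternatingMap.smul_apply, smul_eq_mul]
  ring

theorem wedge_smul_right (c : ℝ) (α : T [⋀^Fin k]→L[ℝ] ℝ) (β : T [⋀^Fin l]→L[ℝ] ℝ) :
    wedge α (c • β) = c • wedge α β := by
  ext v
  refine mul_left_cancel₀ (factorial_mul_ne_zero k l) ?_
  rw [ContinuousAlternatingMap.smul_apply, smul_eq_mul, mul_left_comm, wedge_apply, wedge_apply,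
    Finset.mul_sum]
  refine Finset.sum_congr rfl fun σ _ => ?_
  rw [ContinuousAlternatingMap.smul_apply, smul_eq_mul]
  ring

/-- The wedge product as a bilinear map. -/
def wedgeBilin (T : Type*) [AddCommGroup T] [Module ℝ T] [TopologicalSpace T] (k l : ℕ) :
    (T [⋀^Fin k]→L[ℝ] ℝ) →ₗ[ℝ] (T [⋀^Fin l]→L[ℝ] ℝ) →ₗ[ℝ] (T [⋀^Fin (k + l)]→L[ℝ] ℝ) :=
  LinearMap.mk₂ ℝ wedge wedge_add_left wedge_smul_left wedge_add_right wedge_smul_right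

theorem wedge_comp (α : T [⋀^Fin k]→L[ℝ] ℝ) (β : T [⋀^Fin l]→L[ℝ] ℝ) (A : T' →L[ℝ] T) :
    (wedge α β).compContinuousLinearMap A =
      wedge (α.compContinuousLinearMap A) (β.compContinuousLinearMap A) := by
  ext v
  refine mul_left_cancel₀ (factorial_mul_ne_zero k l) ?_
  rw [ContinuousAlternatingMap.compContinuousLinearMap_apply, wedge_apply, wedge_apply]
  rfl

theorem wedge_one_one (α β : T [⋀^Fin 1]→L[ℝ] ℝ) (u v : T) :
    wedge α β ![u, v] = α ![u] * β ![v] - α ![v] * β ![u] := by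
  have h := wedge_apply_perm α β ![u, v]
  have huniv : (Finset.univ : Finset (Equiv.Perm (Fin (1 + 1)))) = {1, Equiv.swap 0 1} := by
    decide
  have e1 : (fun _ : Fin 1 => u) = ![u] := by funext i; fin_cases i; rfl
  have e2 : (fun _ : Fin 1 => v) = ![v] := by funext i; fin_cases i; rfl
  rw [huniv, Finset.sum_insert (by decide), Finset.sum_singleton] at h
  have h1 : (fun i : Fin 1 => ![u, v] ((1 : Equiv.Perm (Fin (1 + 1))) (Fin.castAdd 1 i))) = ![u] := by
    funext i; fin_cases i; rfl
  have h2 : (fun i : Fin 1 => ![u, v] ((1 : Equiv.Perm (Fin (1 + 1))) (Fin.natAdd 1 i))) = ![v] := by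
    funext i; fin_cases i; rfl
  have h3 : (fun i : Fin 1 => ![u, v] ((Equiv.swap 0 1 : Equiv.Perm (Fin (1 + 1)))
      (Fin.castAdd 1 i))) = ![v] := by
    funext i; fin_cases i; rfl
  have h4 : (fun i : Fin 1 => ![u, v] ((Equiv.swap 0 1 : Equiv.Perm (Fin (1 + 1)))
      (Fin.natAdd 1 i))) = ![u] := by
    funext i; fin_cases i; rfl
  rw [h1, h2, h3, h4, Equiv.Perm.sign_swap (by decide)] at h
  simp at h
  rw [h]
  ring

theorem alternating_two_ext {w w' : T [⋀^Fin 2]→L[ℝ] ℝ} (h : ∀ u v, w ![u, v] = w' ![u, v]) :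
    w = w' := by
  ext v
  have : v = ![v 0, v 1] := by funext i; fin_cases i <;> rfl
  rw [this]
  exact h _ _

theorem alternating_one_ext {w w' : T [⋀^Fin 1]→L[ℝ] ℝ} (h : ∀ u, w ![u] = w' ![u]) :
    w = w' := by
  ext v
  have : v = ![v 0] := by funext i; fin_cases i; rfl
  rw [this]
  exact h _

theorem wedge_one_one_comm (α β : T [⋀^Fin 1]→L[ℝ] ℝ) : wedge α β = -wedge β α := by
  refine alternating_two_ext fun u v => ?_
  rw [ContinuousAlternatingMap.neg_apply, wedge_one_one, wedge_one_one]
  ring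

/-- The generated ideal is closed only under wedge products, so multiplication by a function has to
be read as a wedge product with a form of degree zero. -/
theorem wedge_zero_form (α : T [⋀^Fin k]→L[ℝ] ℝ) (β : T [⋀^Fin 0]→L[ℝ] ℝ) :
    wedge α β = β ![] • α := by
  ext v
  refine mul_left_cancel₀ (factorial_mul_ne_zero k 0) ?_
  rw [wedge_apply_perm]
  have h : ∀ σ : Equiv.Perm (Fin (k + 0)), ((Equiv.Perm.sign σ : ℤ) : ℝ) *
        (α (fun i => v (σ (Fin.castAdd 0 i))) * β (fun i => v (σ (Fin.natAdd k i)))) =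
      α v * β ![] := by
    intro σ
    have h1 : α (fun i => v (σ (Fin.castAdd 0 i))) = ((Equiv.Perm.sign σ : ℤ) : ℝ) * α v := by
      have := α.toAlternatingMap.map_perm v σ
      rw [Units.smul_def, zsmul_eq_mul] at this
      exact this
    have h2 : (fun i => v (σ (Fin.natAdd k i))) = ![] := funext fun i => i.elim0
    rw [h1, h2, ← mul_assoc, ← mul_assoc, ← Int.cast_mul, ← Units.val_mul, Int.units_mul_self]
    simp
  rw [Finset.sum_congr rfl fun σ _ => h σ]
  rw [Finset.sum_const, Finset.card_univ, Fintype.card_perm, Fintype.card_fin, nsmul_eq_mul]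
  simp only [Nat.add_zero, Nat.factorial_zero, mul_one, ContinuousAlternatingMap.smul_apply,
    smul_eq_mul]
  rw [mul_comm (α v)]

/-- The wedge product of three forms, antisymmetrised over all permutations. -/
theorem wedge_wedge_left (α : T [⋀^Fin k]→L[ℝ] ℝ) (β : T [⋀^Fin l]→L[ℝ] ℝ)
    (γ : T [⋀^Fin m]→L[ℝ] ℝ) (v : Fin (k + l + m) → T) :
    ((k.factorial * l.factorial * m.factorial : ℕ) : ℝ) * wedge (wedge α β) γ v =
      ∑ σ : Equiv.Perm (Fin (k + l + m)), ((Equiv.Perm.sign σ : ℤ) : ℝ) *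
        (α (fun i => v (σ (Fin.castAdd m (Fin.castAdd l i)))) *
          β (fun i => v (σ (Fin.castAdd m (Fin.natAdd k i)))) *
          γ (fun i => v (σ (Fin.natAdd (k + l) i)))) := by
  set F : Equiv.Perm (Fin (k + l + m)) → ℝ := fun σ => ((Equiv.Perm.sign σ : ℤ) : ℝ) *
        (α (fun i => v (σ (Fin.castAdd m (Fin.castAdd l i)))) *
          β (fun i => v (σ (Fin.castAdd m (Fin.natAdd k i)))) *
          γ (fun i => v (σ (Fin.natAdd (k + l) i)))) with hF
  -- A permutation τ of the first k + l slots is absorbed into σ. Each of the (k + l)! choices of τ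
  -- then contributes the same total, which cancels the factor from the outer product.
  have key : ∀ σ : Equiv.Perm (Fin (k + l + m)),
      ((k.factorial * l.factorial : ℕ) : ℝ) * (((Equiv.Perm.sign σ : ℤ) : ℝ) *
        (wedge α β (fun i => v (σ (Fin.castAdd m i))) * γ (fun i => v (σ (Fin.natAdd (k + l) i))))) =
      ∑ τ : Equiv.Perm (Fin (k + l)),
        F (σ * Equiv.permCongr finSumFinEquiv (Equiv.sumCongr τ 1)) := by
    intro σ
    have := wedge_apply_perm α β (fun i => v (σ (Fin.castAdd m i)))
    calc _ = ((Equiv.Perm.sign σ : ℤ) : ℝ) * (((k.factorial * l.factorial : ℕ) : ℝ) *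
          wedge α β (fun i => v (σ (Fin.castAdd m i)))) *
            γ (fun i => v (σ (Fin.natAdd (k + l) i))) := by ring
      _ = _ := by
        rw [this, Finset.mul_sum, Finset.sum_mul]
        refine Finset.sum_congr rfl fun τ _ => ?_
        simp only [hF, Equiv.Perm.sign_mul, Equiv.Perm.sign_permCongr, Equiv.Perm.sign_sumCongr]
        have e1 : ∀ i, (Equiv.permCongr finSumFinEquiv (Equiv.sumCongr τ (1 : Equiv.Perm (Fin m))))
            (Fin.castAdd m i) = Fin.castAdd m (τ i) := by
          intro i; simp [Equiv.permCongr_apply]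
        have e2 : ∀ i, (Equiv.permCongr finSumFinEquiv (Equiv.sumCongr τ (1 : Equiv.Perm (Fin m))))
            (Fin.natAdd (k + l) i) = Fin.natAdd (k + l) i := by
          intro i; simp [Equiv.permCongr_apply]
        simp only [Equiv.Perm.coe_mul, Function.comp_apply, e1, e2]
        simp
        ring
  have hsum : ∀ τ : Equiv.Perm (Fin (k + l)), ∑ σ : Equiv.Perm (Fin (k + l + m)),
      F (σ * Equiv.permCongr finSumFinEquiv (Equiv.sumCongr τ 1)) = ∑ σ, F σ := fun τ =>
    Equiv.sum_comp (Equiv.mulRight _) F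
  refine mul_left_cancel₀ (a := ((k + l).factorial : ℝ)) (by positivity) ?_
  have h := wedge_apply_perm (wedge α β) γ v
  have h' := congrArg (fun r => ((k.factorial * l.factorial : ℕ) : ℝ) * r) h
  simp only [Finset.mul_sum] at h'
  rw [Finset.sum_congr rfl fun σ _ => key σ, Finset.sum_comm,
    Finset.sum_congr rfl fun τ _ => hsum τ, Finset.sum_const, Finset.card_univ,
    Fintype.card_perm, Fintype.card_fin, nsmul_eq_mul] at h'
  rw [← h']
  push_cast
  ring

/-- The inner permutation now acts on the last l + m slots. The normalising factor is the one found
for the other bracketing, which is what makes the two comparable. -/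
theorem wedge_wedge_right (α : T [⋀^Fin k]→L[ℝ] ℝ) (β : T [⋀^Fin l]→L[ℝ] ℝ)
    (γ : T [⋀^Fin m]→L[ℝ] ℝ) (v : Fin (k + (l + m)) → T) :
    ((k.factorial * l.factorial * m.factorial : ℕ) : ℝ) * wedge α (wedge β γ) v =
      ∑ σ : Equiv.Perm (Fin (k + (l + m))), ((Equiv.Perm.sign σ : ℤ) : ℝ) *
        (α (fun i => v (σ (Fin.castAdd (l + m) i))) *
          β (fun i => v (σ (Fin.natAdd k (Fin.castAdd m i)))) *
          γ (fun i => v (σ (Fin.natAdd k (Fin.natAdd l i))))) := by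
  set F : Equiv.Perm (Fin (k + (l + m))) → ℝ := fun σ => ((Equiv.Perm.sign σ : ℤ) : ℝ) *
        (α (fun i => v (σ (Fin.castAdd (l + m) i))) *
          β (fun i => v (σ (Fin.natAdd k (Fin.castAdd m i)))) *
          γ (fun i => v (σ (Fin.natAdd k (Fin.natAdd l i))))) with hF
  have key : ∀ σ : Equiv.Perm (Fin (k + (l + m))),
      ((l.factorial * m.factorial : ℕ) : ℝ) * (((Equiv.Perm.sign σ : ℤ) : ℝ) *
        (α (fun i => v (σ (Fin.castAdd (l + m) i))) *
          wedge β γ (fun i => v (σ (Fin.natAdd k i))))) =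
      ∑ τ : Equiv.Perm (Fin (l + m)),
        F (σ * Equiv.permCongr finSumFinEquiv (Equiv.sumCongr 1 τ)) := by
    intro σ
    have := wedge_apply_perm β γ (fun i => v (σ (Fin.natAdd k i)))
    calc _ = ((Equiv.Perm.sign σ : ℤ) : ℝ) * α (fun i => v (σ (Fin.castAdd (l + m) i))) *
          (((l.factorial * m.factorial : ℕ) : ℝ) *
          wedge β γ (fun i => v (σ (Fin.natAdd k i)))) := by ring
      _ = _ := by
        rw [this, Finset.mul_sum]
        refine Finset.sum_congr rfl fun τ _ => ?_
        simp only [hF, Equiv.Perm.sign_mul, Equiv.Perm.sign_permCongr, Equiv.Perm.sign_sumCongr]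
        have e1 : ∀ i, (Equiv.permCongr finSumFinEquiv (Equiv.sumCongr (1 : Equiv.Perm (Fin k)) τ))
            (Fin.castAdd (l + m) i) = Fin.castAdd (l + m) i := by
          intro i; simp [Equiv.permCongr_apply]
        have e2 : ∀ i, (Equiv.permCongr finSumFinEquiv (Equiv.sumCongr (1 : Equiv.Perm (Fin k)) τ))
            (Fin.natAdd k i) = Fin.natAdd k (τ i) := by
          intro i; simp [Equiv.permCongr_apply]
        simp only [Equiv.Perm.coe_mul, Function.comp_apply, e1, e2]
        simp
        ring
  have hsum : ∀ τ : Equiv.Perm (Fin (l + m)), ∑ σ : Equiv.Perm (Fin (k + (l + m))),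
      F (σ * Equiv.permCongr finSumFinEquiv (Equiv.sumCongr 1 τ)) = ∑ σ, F σ := fun τ =>
    Equiv.sum_comp (Equiv.mulRight _) F
  refine mul_left_cancel₀ (a := ((l + m).factorial : ℝ)) (by positivity) ?_
  have h := wedge_apply_perm α (wedge β γ) v
  have h' := congrArg (fun r => ((l.factorial * m.factorial : ℕ) : ℝ) * r) h
  simp only [Finset.mul_sum] at h'
  rw [Finset.sum_congr rfl fun σ _ => key σ, Finset.sum_comm,
    Finset.sum_congr rfl fun τ _ => hsum τ, Finset.sum_const, Finset.card_univ,
    Fintype.card_perm, Fintype.card_fin, nsmul_eq_mul] at h'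
  rw [← h']
  push_cast
  ring

theorem wedge_assoc (α : T [⋀^Fin k]→L[ℝ] ℝ) (β : T [⋀^Fin l]→L[ℝ] ℝ)
    (γ : T [⋀^Fin m]→L[ℝ] ℝ) (v : Fin (k + (l + m)) → T) :
    wedge (wedge α β) γ (v ∘ Fin.cast (Nat.add_assoc k l m)) = wedge α (wedge β γ) v := by
  refine mul_left_cancel₀
    (a := ((k.factorial * l.factorial * m.factorial : ℕ) : ℝ)) (by positivity) ?_
  rw [wedge_wedge_left, wedge_wedge_right,
    ← Equiv.sum_comp (Equiv.permCongr (finCongr (Nat.add_assoc k l m)))]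
  refine Finset.sum_congr rfl fun σ _ => ?_
  rw [Equiv.Perm.sign_permCongr]
  have e1 : ∀ i, Fin.cast (Nat.add_assoc k l m).symm (Fin.castAdd (l + m) i) =
      Fin.castAdd m (Fin.castAdd l i) := fun i => Fin.ext rfl
  have e2 : ∀ i, Fin.cast (Nat.add_assoc k l m).symm (Fin.natAdd k (Fin.castAdd m i)) =
      Fin.castAdd m (Fin.natAdd k i) := fun i => Fin.ext rfl
  have e3 : ∀ i, Fin.cast (Nat.add_assoc k l m).symm (Fin.natAdd k (Fin.natAdd l i)) =
      Fin.natAdd (k + l) i := fun i => Fin.ext (Nat.add_assoc k l i).symm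
  simp only [Equiv.permCongr_apply, Function.comp_apply, finCongr_apply, finCongr_symm, e1, e2, e3]

end Wedge

/-! ### Forms in charts -/

section Charts

variable {E : Type*} [NormedAddCommGroup E] [NormedSpace ℝ E]
  {M : Type*} [TopologicalSpace M] [ChartedSpace E M] [IsManifold 𝓘(ℝ, E) ∞ M]
  {E' : Type*} [NormedAddCommGroup E'] [NormedSpace ℝ E']
  {N : Type*} [TopologicalSpace N] [ChartedSpace E' N] [IsManifold 𝓘(ℝ, E') ∞ N] {k l : ℕ}

/-- The pullback of a form along a map `f` covered by a family `A` of linear maps between tangent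
spaces. -/
def bundlePullback (f : N → M)
    (A : ∀ y, TangentSpace 𝓘(ℝ, E') y →L[ℝ] TangentSpace 𝓘(ℝ, E) (f y)) (w : DForm E M k) :
    DForm E' N k :=
  fun y => (w (f y)).compContinuousLinearMap (A y)

/-- The coordinate expression of a family of linear maps between tangent spaces. -/
def bundleRep (c : N) (c' : M) (f : N → M)
    (A : ∀ y, TangentSpace 𝓘(ℝ, E') y →L[ℝ] TangentSpace 𝓘(ℝ, E) (f y)) : E' → E' →L[ℝ] E :=
  fun e => (mfderiv 𝓘(ℝ, E) 𝓘(ℝ, E) (chartAt E c') (f ((chartAt E' c).symm e))).comp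
    ((A ((chartAt E' c).symm e)).comp
      (mfderiv 𝓘(ℝ, E') 𝓘(ℝ, E') (chartAt E' c).symm e))

theorem inChart_apply (c : M) (w : DForm E M k) (e : E) (v : Fin k → E) :
    inChart c w e v = w ((chartAt E c).symm e)
      (fun i => mfderiv 𝓘(ℝ, E) 𝓘(ℝ, E) (chartAt E c).symm e (v i)) := rfl

theorem form_congr_point (w : DForm E M k) {x x' : M} (h : x' = x) (v : Fin k → E) :
    (show E [⋀^Fin k]→L[ℝ] ℝ from w x') v = (show E [⋀^Fin k]→L[ℝ] ℝ from w x) v := by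
  subst h; rfl

theorem mfderiv_symm_chart {c x : M} (hx : x ∈ (chartAt E c).source) (v : TangentSpace 𝓘(ℝ, E) x) :
    mfderiv 𝓘(ℝ, E) 𝓘(ℝ, E) (chartAt E c).symm (chartAt E c x)
      (mfderiv 𝓘(ℝ, E) 𝓘(ℝ, E) (chartAt E c) x v) = v :=
  congrArg (fun L => L v) ((mdifferentiable_chart (I := 𝓘(ℝ, E)) c).symm_comp_deriv hx)

theorem mfderiv_chart_symm {c : M} {e : E} (he : e ∈ (chartAt E c).target) (v : E) :
    mfderiv 𝓘(ℝ, E) 𝓘(ℝ, E) (chartAt E c) ((chartAt E c).symm e)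
      (mfderiv 𝓘(ℝ, E) 𝓘(ℝ, E) (chartAt E c).symm e v) = v :=
  congrArg (fun L => L v) ((mdifferentiable_chart (I := 𝓘(ℝ, E)) c).comp_symm_deriv he)

theorem inChart_comp_chart {c x : M} (hx : x ∈ (chartAt E c).source) (w : DForm E M k) :
    (inChart c w (chartAt E c x)).compContinuousLinearMap
      (mfderiv 𝓘(ℝ, E) 𝓘(ℝ, E) (chartAt E c) x) = w x := by
  ext v
  refine (form_congr_point w ((chartAt E c).left_inv hx) _).trans ?_
  refine congrArg (w x) (funext fun i => ?_)
  exact mfderiv_symm_chart hx (v i)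

theorem inChart_bundlePullback (c : N) (c' : M) (f : N → M)
    (A : ∀ y, TangentSpace 𝓘(ℝ, E') y →L[ℝ] TangentSpace 𝓘(ℝ, E) (f y)) (w : DForm E M k) {e : E'}
    (he : f ((chartAt E' c).symm e) ∈ (chartAt E c').source) :
    inChart c (bundlePullback f A w) e =
      (inChart c' w (chartAt E c' (f ((chartAt E' c).symm e)))).compContinuousLinearMap
        (bundleRep c c' f A e) := by
  ext v
  have h := congrArg (fun η => η fun i => A ((chartAt E' c).symm e)
    (mfderiv 𝓘(ℝ, E') 𝓘(ℝ, E') (chartAt E' c).symm e (v i))) (inChart_comp_chart he w)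
  exact h.symm

theorem bundleRep_mfderiv (c : N) (c' : M) (f : N → M) {e : E'} (he : e ∈ (chartAt E' c).target)
    (hf : MDifferentiableAt 𝓘(ℝ, E') 𝓘(ℝ, E) f ((chartAt E' c).symm e))
    (he' : f ((chartAt E' c).symm e) ∈ (chartAt E c').source) :
    bundleRep c c' f (mfderiv 𝓘(ℝ, E') 𝓘(ℝ, E) f) e =
      fderiv ℝ (chartAt E c' ∘ f ∘ (chartAt E' c).symm) e := by
  have h1 : MDifferentiableAt 𝓘(ℝ, E') 𝓘(ℝ, E') (chartAt E' c).symm e :=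
    (mdifferentiable_chart (I := 𝓘(ℝ, E')) c).mdifferentiableAt_symm he
  have h2 : MDifferentiableAt 𝓘(ℝ, E) 𝓘(ℝ, E) (chartAt E c') (f ((chartAt E' c).symm e)) :=
    (mdifferentiable_chart (I := 𝓘(ℝ, E)) c').mdifferentiableAt he'
  rw [← mfderiv_eq_fderiv, mfderiv_comp e h2 (hf.comp e h1), mfderiv_comp e hf h1]
  rfl

/-- Smoothness of a form at a point. -/
def SmoothAt (w : DForm E M k) (x : M) : Prop :=
  ContDiffAt ℝ ∞ (inChart x w) (chartAt E x x)

theorem contDiffAt_coord {c : N} {c' : M} {f : N → M} {y : N} (hy : y ∈ (chartAt E' c).source)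
    (hf : ContMDiffAt 𝓘(ℝ, E') 𝓘(ℝ, E) ∞ f y) (hy' : f y ∈ (chartAt E c').source) :
    ContDiffAt ℝ ∞ (chartAt E c' ∘ f ∘ (chartAt E' c).symm) (chartAt E' c y) := by
  have h := ((contMDiffAt_iff_of_mem_source hy hy').1 hf).2
  rw [← contDiffWithinAt_univ]
  simpa using h

theorem eventually_chart_target {c x : M} (hx : x ∈ (chartAt E c).source) :
    ∀ᶠ e in 𝓝 (chartAt E c x), e ∈ (chartAt E c).target :=
  (chartAt E c).open_target.eventually_mem ((chartAt E c).map_source hx)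

theorem eventually_coord {c x : M} (hx : x ∈ (chartAt E c).source) {p : M → Prop}
    (hp : ∀ᶠ z in 𝓝 x, p z) :
    ∀ᶠ e in 𝓝 (chartAt E c x), p ((chartAt E c).symm e) := by
  have h := (chartAt E c).continuousAt_symm ((chartAt E c).map_source hx)
  rw [ContinuousAt, (chartAt E c).left_inv hx] at h
  exact h.eventually hp

theorem eventually_of_coord {c x : M} (hx : x ∈ (chartAt E c).source) {p : E → Prop}
    (hp : ∀ᶠ e in 𝓝 (chartAt E c x), p e) : ∀ᶠ z in 𝓝 x, p (chartAt E c z) :=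
  ((chartAt E c).continuousAt hx).eventually hp

theorem eventually_chart_source {c x : M} (hx : x ∈ (chartAt E c).source) :
    ∀ᶠ z in 𝓝 x, z ∈ (chartAt E c).source :=
  (chartAt E c).open_source.eventually_mem hx

/-! ### Smoothness of forms at a point, and its independence of the chart -/

section FD
variable [FiniteDimensional ℝ E] [FiniteDimensional ℝ E']

theorem contDiffAt_inChart_bundlePullback {c : N} {c' : M} {f : N → M}
    {A : ∀ y, TangentSpace 𝓘(ℝ, E') y →L[ℝ] TangentSpace 𝓘(ℝ, E) (f y)} {w : DForm E M k} {y : N}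
    (hy : y ∈ (chartAt E' c).source) (hf : ContMDiffAt 𝓘(ℝ, E') 𝓘(ℝ, E) ∞ f y)
    (hy' : f y ∈ (chartAt E c').source)
    (hA : ContDiffAt ℝ ∞ (bundleRep c c' f A) (chartAt E' c y))
    (hw : ContDiffAt ℝ ∞ (inChart c' w) (chartAt E c' (f y))) :
    ContDiffAt ℝ ∞ (inChart c (bundlePullback f A w)) (chartAt E' c y) := by
  have hF := contDiffAt_coord hy hf hy'
  have hw' : ContDiffAt ℝ ∞ (inChart c' w)
      ((chartAt E c' ∘ f ∘ (chartAt E' c).symm) (chartAt E' c y)) := by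
    simpa [(chartAt E' c).left_inv hy] using hw
  refine ((hw'.comp (chartAt E' c y) hF).alternating_comp hA).congr_of_eventuallyEq ?_
  have hev : ∀ᶠ z in 𝓝 y, f z ∈ (chartAt E c').source :=
    hf.continuousAt.eventually (eventually_chart_source hy')
  filter_upwards [eventually_coord hy hev] with e he
  exact inChart_bundlePullback c c' f A w he

theorem contDiffAt_bundleRep_mfderiv {c : N} {c' : M} {f : N → M} {y : N}
    (hy : y ∈ (chartAt E' c).source) (hf : ContMDiffAt 𝓘(ℝ, E') 𝓘(ℝ, E) ∞ f y)
    (hy' : f y ∈ (chartAt E c').source) :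
    ContDiffAt ℝ ∞ (bundleRep c c' f (mfderiv 𝓘(ℝ, E') 𝓘(ℝ, E) f)) (chartAt E' c y) := by
  have hF := contDiffAt_coord hy hf hy'
  refine (hF.fderiv_right (m := ∞) (by simp)).congr_of_eventuallyEq ?_
  have hev : ∀ᶠ z in 𝓝 y, f z ∈ (chartAt E c').source :=
    hf.continuousAt.eventually (eventually_chart_source hy')
  have hd : ∀ᶠ z in 𝓝 y, MDifferentiableAt 𝓘(ℝ, E') 𝓘(ℝ, E) f z := by
    have : ContMDiffAt 𝓘(ℝ, E') 𝓘(ℝ, E) 1 f y := hf.of_le (by norm_num)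
    filter_upwards [(contMDiffAt_iff_contMDiffAt_nhds (by simp)).1 this] with z hz
    exact ContMDiffAt.mdifferentiableAt hz one_ne_zero
  filter_upwards [eventually_coord hy hev, eventually_coord hy hd, eventually_chart_target hy]
    with e h1 h2 h3
  exact bundleRep_mfderiv c c' f h3 h2 h1

theorem contDiffAt_inChart_pullback {c : N} {c' : M} {f : N → M} {w : DForm E M k} {y : N}
    (hy : y ∈ (chartAt E' c).source) (hf : ContMDiffAt 𝓘(ℝ, E') 𝓘(ℝ, E) ∞ f y)
    (hy' : f y ∈ (chartAt E c').source)
    (hw : ContDiffAt ℝ ∞ (inChart c' w) (chartAt E c' (f y))) :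
    ContDiffAt ℝ ∞ (inChart c (pullback f w)) (chartAt E' c y) :=
  contDiffAt_inChart_bundlePullback hy hf hy' (contDiffAt_bundleRep_mfderiv hy hf hy') hw

theorem pullback_id (w : DForm E M k) : pullback (id : M → M) w = w := by
  funext x
  ext v
  simp only [pullback, ContinuousAlternatingMap.compContinuousLinearMap_apply, mfderiv_id]
  rfl

/-- Changing the chart is pulling back by the identity map read in two charts. -/
theorem smoothAt_iff {c x : M} (hx : x ∈ (chartAt E c).source) {w : DForm E M k} :
    SmoothAt w x ↔ ContDiffAt ℝ ∞ (inChart c w) (chartAt E c x) := by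
  have key : ∀ {c c' : M}, x ∈ (chartAt E c).source → x ∈ (chartAt E c').source →
      ContDiffAt ℝ ∞ (inChart c w) (chartAt E c x) →
      ContDiffAt ℝ ∞ (inChart c' w) (chartAt E c' x) := by
    intro c c' h h' hw
    have := contDiffAt_inChart_pullback (N := M) (f := (id : M → M)) h' contMDiffAt_id h hw
    rwa [pullback_id] at this
  exact ⟨key (mem_chart_source E x) hx, key hx (mem_chart_source E x)⟩

theorem SmoothAt.pullback {f : N → M} {w : DForm E M k} {y : N}
    (hw : SmoothAt w (f y)) (hf : ContMDiffAt 𝓘(ℝ, E') 𝓘(ℝ, E) ∞ f y) :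
    SmoothAt (E := E') (M := N) (DarbouxReduction.pullback f w) y :=
  contDiffAt_inChart_pullback (mem_chart_source E' y) hf (mem_chart_source E (f y)) hw

theorem smoothOn_iff {U : Set M} (hU : IsOpen U) {w : DForm E M k} :
    SmoothOn w U ↔ ∀ x ∈ U, SmoothAt w x := by
  constructor
  · intro h x hx
    refine (h x).contDiffAt ?_
    refine Filter.inter_mem ((chartAt E x).open_target.mem_nhds (mem_chart_target E x)) ?_
    exact eventually_coord (mem_chart_source E x) (hU.mem_nhds hx)
  · intro h c e he
    have hs := (chartAt E c).map_target he.1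
    have := (smoothAt_iff hs).1 (h _ he.2)
    rw [(chartAt E c).right_inv he.1] at this
    exact this.contDiffWithinAt

theorem smooth_iff {w : DForm E M k} : Smooth w ↔ ∀ x, SmoothAt w x := by
  rw [Smooth, smoothOn_iff isOpen_univ]
  simp

theorem inChart_congr {c x : M} (hx : x ∈ (chartAt E c).source) {w w' : DForm E M k}
    (h : ∀ᶠ z in 𝓝 x, w z = w' z) :
    inChart c w =ᶠ[𝓝 (chartAt E c x)] inChart c w' := by
  filter_upwards [eventually_coord hx h] with e he
  simp only [inChart, DarbouxReduction.pullback, he]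
  rfl

theorem SmoothAt.congr {w w' : DForm E M k} {x : M} (hw : SmoothAt w x)
    (h : ∀ᶠ z in 𝓝 x, w' z = w z) : SmoothAt w' x :=
  ContDiffAt.congr_of_eventuallyEq hw (inChart_congr (mem_chart_source E x) h)

theorem smoothAt_iff_apply {w : DForm E M k} {x : M} :
    SmoothAt w x ↔ ∀ v, ContDiffAt ℝ ∞ (fun e => inChart x w e v) (chartAt E x x) :=
  contDiffAt_alternating_iff

theorem SmoothAt.add {w w' : DForm E M k} {x : M} (hw : SmoothAt w x) (hw' : SmoothAt w' x) :
    SmoothAt (w + w') x :=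
  ContDiffAt.add hw hw'

theorem smoothAt_zero (x : M) : SmoothAt (0 : DForm E M k) x :=
  contDiffAt_const (c := (0 : E [⋀^Fin k]→L[ℝ] ℝ))

theorem SmoothAt.smul {w : DForm E M k} {x : M} {f : M → ℝ}
    (hf : ContMDiffAt 𝓘(ℝ, E) 𝓘(ℝ, ℝ) ∞ f x) (hw : SmoothAt w x) :
    SmoothAt (fun z => f z • w z) x := by
  have h1 : ContDiffAt ℝ ∞ (f ∘ (chartAt E x).symm) (chartAt E x x) :=
    contDiffAt_coord (c' := f x) (mem_chart_source E x) hf (mem_chart_source ℝ (f x))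
  exact ContDiffAt.smul h1 hw

theorem SmoothAt.sum {ι : Type*} {s : Finset ι} {w : ι → DForm E M k} {x : M}
    (hw : ∀ i ∈ s, SmoothAt (w i) x) : SmoothAt (fun z => ∑ i ∈ s, w i z) x := by
  classical
  induction s using Finset.induction_on with
  | empty => exact smoothAt_zero x
  | insert a s ha ih =>
    have := (hw a (Finset.mem_insert_self a s)).add
      (ih fun i hi => hw i (Finset.mem_insert_of_mem hi))
    refine this.congr (Filter.Eventually.of_forall fun z => ?_)
    rw [Finset.sum_insert ha]
    rfl

theorem SmoothAt.wedge {α : DForm E M k} {β : DForm E M l} {x : M} (hα : SmoothAt α x)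
    (hβ : SmoothAt β x) : SmoothAt (wedgeForm α β) x := by
  refine smoothAt_iff_apply.2 fun v => ?_
  have h : ∀ e, inChart x (wedgeForm α β) e v = ((k.factorial * l.factorial : ℕ) : ℝ)⁻¹ *
      ∑ σ : Equiv.Perm (Fin k ⊕ Fin l), ((Equiv.Perm.sign σ : ℤ) : ℝ) *
        (inChart x α e (fun i => v (finSumFinEquiv (σ (Sum.inl i)))) *
          inChart x β e (fun i => v (finSumFinEquiv (σ (Sum.inr i))))) := by
    intro e
    rw [eq_inv_mul_iff_mul_eq₀ (factorial_mul_ne_zero k l)]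
    exact wedge_apply _ _ _
  simp_rw [h]
  refine contDiffAt_const.mul (ContDiffAt.sum fun σ _ => contDiffAt_const.mul (ContDiffAt.mul ?_ ?_))
  · exact contDiffAt_alternating_iff.1 hα _
  · exact contDiffAt_alternating_iff.1 hβ _

end FD
end Charts

/-! ### The exterior derivative on manifolds -/

section ExtD

variable {E : Type*} [NormedAddCommGroup E] [NormedSpace ℝ E]
  {M : Type*} [TopologicalSpace M] [ChartedSpace E M] [IsManifold 𝓘(ℝ, E) ∞ M]
  {E' : Type*} [NormedAddCommGroup E'] [NormedSpace ℝ E']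
  {N : Type*} [TopologicalSpace N] [ChartedSpace E' N] [IsManifold 𝓘(ℝ, E') ∞ N] {k l : ℕ}
  [FiniteDimensional ℝ E] [FiniteDimensional ℝ E']

theorem eventually_mdifferentiableAt {f : N → M} {y : N}
    (hf : ContMDiffAt 𝓘(ℝ, E') 𝓘(ℝ, E) ∞ f y) :
    ∀ᶠ z in 𝓝 y, MDifferentiableAt 𝓘(ℝ, E') 𝓘(ℝ, E) f z := by
  have : ContMDiffAt 𝓘(ℝ, E') 𝓘(ℝ, E) 1 f y := hf.of_le (by norm_num)
  filter_upwards [(contMDiffAt_iff_contMDiffAt_nhds (by simp)).1 this] with z hz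
  exact ContMDiffAt.mdifferentiableAt hz one_ne_zero

/-- Near the point the coordinate expression of the pullback is the pullback of the coordinate
expression, and on normed spaces d commutes with pullback. Applied to the identity, this makes
`extD` independent of the chart. -/
theorem extDeriv_inChart_pullback {c : N} {c' : M} {f : N → M} {w : DForm E M k} {y : N}
    (hy : y ∈ (chartAt E' c).source) (hf : ContMDiffAt 𝓘(ℝ, E') 𝓘(ℝ, E) ∞ f y)
    (hy' : f y ∈ (chartAt E c').source) (hw : SmoothAt w (f y)) :
    extDeriv (inChart c (pullback f w)) (chartAt E' c y) =
      (extDeriv (inChart c' w) (chartAt E c' (f y))).compContinuousLinearMap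
        (fderiv ℝ (chartAt E c' ∘ f ∘ (chartAt E' c).symm) (chartAt E' c y)) := by
  have hF := contDiffAt_coord hy hf hy'
  have hFy : (chartAt E c' ∘ f ∘ (chartAt E' c).symm) (chartAt E' c y) = chartAt E c' (f y) := by
    simp [(chartAt E' c).left_inv hy]
  have hev : ∀ᶠ z in 𝓝 y, f z ∈ (chartAt E c').source :=
    hf.continuousAt.eventually (eventually_chart_source hy')
  have heq : inChart c (pullback f w) =ᶠ[𝓝 (chartAt E' c y)] fun e =>
      (inChart c' w ((chartAt E c' ∘ f ∘ (chartAt E' c).symm) e)).compContinuousLinearMap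
        (fderiv ℝ (chartAt E c' ∘ f ∘ (chartAt E' c).symm) e) := by
    filter_upwards [eventually_coord hy hev, eventually_coord hy (eventually_mdifferentiableAt hf),
      eventually_chart_target hy] with e h1 h2 h3
    rw [← bundleRep_mfderiv c c' f h3 h2 h1]
    exact inChart_bundlePullback c c' f _ w h1
  rw [heq.extDeriv_eq, extDeriv_pullback (r := ∞) _ hF (by simpa using WithTop.coe_le_coe.2 (le_top : (2 : ℕ∞) ≤ ⊤)), hFy]
  rw [hFy]
  exact ((smoothAt_iff hy').1 hw).differentiableAt (by simp)

theorem fderiv_coord_comp_mfderiv {c : N} {c' : M} {f : N → M} {y : N}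
    (hy : y ∈ (chartAt E' c).source) (hf : ContMDiffAt 𝓘(ℝ, E') 𝓘(ℝ, E) ∞ f y)
    (hy' : f y ∈ (chartAt E c').source) (v : TangentSpace 𝓘(ℝ, E') y) :
    fderiv ℝ (chartAt E c' ∘ f ∘ (chartAt E' c).symm) (chartAt E' c y)
      (mfderiv 𝓘(ℝ, E') 𝓘(ℝ, E') (chartAt E' c) y v) =
    mfderiv 𝓘(ℝ, E) 𝓘(ℝ, E) (chartAt E c') (f y) (mfderiv 𝓘(ℝ, E') 𝓘(ℝ, E) f y v) := by
  have hF := contDiffAt_coord hy hf hy'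
  have h1 : MDifferentiableAt 𝓘(ℝ, E') 𝓘(ℝ, E) (chartAt E c' ∘ f ∘ (chartAt E' c).symm)
      (chartAt E' c y) := (hF.differentiableAt (by simp)).mdifferentiableAt
  have h2 : MDifferentiableAt 𝓘(ℝ, E') 𝓘(ℝ, E') (chartAt E' c) y :=
    (mdifferentiable_chart (I := 𝓘(ℝ, E')) c).mdifferentiableAt hy
  have h3 : MDifferentiableAt 𝓘(ℝ, E) 𝓘(ℝ, E) (chartAt E c') (f y) :=
    (mdifferentiable_chart (I := 𝓘(ℝ, E)) c').mdifferentiableAt hy'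
  have hfd : MDifferentiableAt 𝓘(ℝ, E') 𝓘(ℝ, E) f y := hf.mdifferentiableAt (by simp)
  have e1 := mfderiv_comp y h1 h2
  have e2 := mfderiv_comp y h3 hfd
  have heq : (chartAt E c' ∘ f ∘ (chartAt E' c).symm) ∘ chartAt E' c =ᶠ[𝓝 y] chartAt E c' ∘ f := by
    filter_upwards [eventually_chart_source hy] with z hz
    simp [(chartAt E' c).left_inv hz]
  rw [heq.mfderiv_eq, e2, mfderiv_eq_fderiv] at e1
  exact (congrArg (fun L => L v) e1).symm

theorem extD_eq_chart {c x : M} (hx : x ∈ (chartAt E c).source) {w : DForm E M k}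
    (hw : SmoothAt w x) :
    extD w x = (extDeriv (inChart c w) (chartAt E c x)).compContinuousLinearMap
      (mfderiv 𝓘(ℝ, E) 𝓘(ℝ, E) (chartAt E c) x) := by
  have h := extDeriv_inChart_pullback (N := M) (f := (id : M → M)) (mem_chart_source E x)
    contMDiffAt_id hx hw
  rw [pullback_id] at h
  ext v
  simp only [extD, h]
  refine congrArg (extDeriv (inChart c w) (chartAt E c x)) (funext fun i => ?_)
  have := fderiv_coord_comp_mfderiv (N := M) (f := (id : M → M)) (mem_chart_source E x)
    contMDiffAt_id hx (v i)
  rw [mfderiv_id] at this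
  exact this

theorem extD_pullback {f : N → M} {w : DForm E M k} {y : N}
    (hw : SmoothAt w (f y)) (hf : ContMDiffAt 𝓘(ℝ, E') 𝓘(ℝ, E) ∞ f y) :
    extD (E := E') (M := N) (pullback f w) y = pullback f (extD w) y := by
  ext v
  simp only [extD, extDeriv_inChart_pullback (mem_chart_source E' y) hf
    (mem_chart_source E (f y)) hw]
  refine congrArg (extDeriv (inChart (f y) w) (chartAt E (f y) (f y))) (funext fun i => ?_)
  exact fderiv_coord_comp_mfderiv (mem_chart_source E' y) hf (mem_chart_source E (f y)) (v i)

theorem inChart_extD {c : M} {e : E} (he : e ∈ (chartAt E c).target) {w : DForm E M k}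
    (hw : SmoothAt w ((chartAt E c).symm e)) :
    inChart c (extD w) e = extDeriv (inChart c w) e := by
  have hs := (chartAt E c).map_target he
  have h := extD_eq_chart hs hw
  ext v
  simp only [inChart_apply, h]
  rw [(chartAt E c).right_inv he]
  refine congrArg (extDeriv (inChart c w) e) (funext fun i => ?_)
  exact mfderiv_chart_symm he (v i)

theorem contDiffAt_extDeriv {w : E → E [⋀^Fin k]→L[ℝ] ℝ} {e : E} (hw : ContDiffAt ℝ ∞ w e) :
    ContDiffAt ℝ ∞ (extDeriv w) e := by
  have h : ContDiffAt ℝ ∞ (fderiv ℝ w) e := hw.fderiv_right (m := ∞) (by simp)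
  exact (ContinuousAlternatingMap.alternatizeUncurryFinCLM ℝ E ℝ (n := k)).contDiff.contDiffAt.comp
    e h

theorem SmoothAt.extD {w : DForm E M k} {x : M} (hw : ∀ᶠ z in 𝓝 x, SmoothAt w z) :
    SmoothAt (extD w) x := by
  have hx := mem_chart_source E x
  refine (contDiffAt_extDeriv ((smoothAt_iff hx).1 hw.self_of_nhds)).congr_of_eventuallyEq ?_
  filter_upwards [eventually_chart_target hx, eventually_coord hx hw] with e h1 h2
  exact inChart_extD h1 h2

theorem Smooth.extD {w : DForm E M k} (hw : Smooth w) : Smooth (extD w) :=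
  smooth_iff.2 fun _ => SmoothAt.extD (Filter.Eventually.of_forall (smooth_iff.1 hw))

theorem extD_congr {w w' : DForm E M k} {x : M} (h : ∀ᶠ z in 𝓝 x, w z = w' z) :
    extD w x = extD w' x := by
  simp only [extD, (inChart_congr (mem_chart_source E x) h).extDeriv_eq]

theorem extD_congr_eventually {w w' : DForm E M k} {x : M} (h : ∀ᶠ z in 𝓝 x, w z = w' z) :
    ∀ᶠ z in 𝓝 x, extD w z = extD w' z := by
  filter_upwards [eventually_eventually_nhds.2 h] with z hz using extD_congr hz

theorem extD_zero (x : M) : extD (0 : DForm E M k) x = 0 := by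
  have h : extDeriv (inChart x (0 : DForm E M k)) (chartAt E x x) = 0 := by
    have : inChart x (0 : DForm E M k) = fun _ => (0 : E [⋀^Fin k]→L[ℝ] ℝ) := rfl
    rw [this, extDeriv, fderiv_const_apply]
    exact map_zero (ContinuousAlternatingMap.alternatizeUncurryFinCLM ℝ E ℝ)
  simp only [extD, h]
  rfl

theorem extD_add {w w' : DForm E M k} {x : M} (hw : SmoothAt w x) (hw' : SmoothAt w' x) :
    extD (w + w') x = extD w x + extD w' x := by
  have : inChart x (w + w') = inChart x w + inChart x w' := rfl
  simp only [extD, this]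
  rw [extDeriv_add (ContDiffAt.differentiableAt hw (by simp))
    (ContDiffAt.differentiableAt hw' (by simp))]
  rfl

theorem extD_sum {ι : Type*} {s : Finset ι} {w : ι → DForm E M k} {x : M}
    (hw : ∀ i ∈ s, SmoothAt (w i) x) :
    extD (fun z => ∑ i ∈ s, w i z) x = ∑ i ∈ s, extD (w i) x := by
  classical
  induction s using Finset.induction_on with
  | empty => exact extD_zero x
  | insert a s ha ih =>
    have hs : ∀ i ∈ s, SmoothAt (w i) x := fun i hi => hw i (Finset.mem_insert_of_mem hi)
    have h1 := extD_add (hw a (Finset.mem_insert_self a s)) (SmoothAt.sum hs)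
    rw [Finset.sum_insert ha, ← ih hs, ← h1]
    congr 1
    funext z
    rw [Finset.sum_insert ha]
    rfl

/-- The differential of a function, as a form. -/
def dFun (f : M → ℝ) : DForm E M 1 := fun x =>
  ContinuousAlternatingMap.ofSubsingleton ℝ (TangentSpace 𝓘(ℝ, E) x) ℝ (0 : Fin 1)
    (mfderiv 𝓘(ℝ, E) 𝓘(ℝ, ℝ) f x)

theorem inChart_dFun {c : M} {e : E} (he : e ∈ (chartAt E c).target) {f : M → ℝ}
    (hf : MDifferentiableAt 𝓘(ℝ, E) 𝓘(ℝ, ℝ) f ((chartAt E c).symm e)) (v : Fin 1 → E) :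
    inChart c (dFun f) e v = fderiv ℝ (f ∘ (chartAt E c).symm) e (v 0) := by
  have h1 : MDifferentiableAt 𝓘(ℝ, E) 𝓘(ℝ, E) (chartAt E c).symm e :=
    (mdifferentiable_chart (I := 𝓘(ℝ, E)) c).mdifferentiableAt_symm he
  rw [← mfderiv_eq_fderiv, mfderiv_comp e hf h1]
  rfl

theorem contDiffAt_coord_fun {c x : M} (hx : x ∈ (chartAt E c).source) {f : M → ℝ}
    (hf : ContMDiffAt 𝓘(ℝ, E) 𝓘(ℝ, ℝ) ∞ f x) :
    ContDiffAt ℝ ∞ (f ∘ (chartAt E c).symm) (chartAt E c x) :=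
  contDiffAt_coord (c' := f x) hx hf (mem_chart_source ℝ (f x))

theorem contMDiffAt_of_coord_fun {c x : M} (hx : x ∈ (chartAt E c).source) {g : E → ℝ}
    (hg : ContDiffAt ℝ ∞ g (chartAt E c x)) :
    ContMDiffAt 𝓘(ℝ, E) 𝓘(ℝ, ℝ) ∞ (fun z => g (chartAt E c z)) x :=
  ContMDiffAt.comp x hg.contMDiffAt
    (contMDiffOn_chart.contMDiffAt ((chartAt E c).open_source.mem_nhds hx))

theorem SmoothAt.dFun {f : M → ℝ} {x : M} (hf : ContMDiffAt 𝓘(ℝ, E) 𝓘(ℝ, ℝ) ∞ f x) :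
    SmoothAt (dFun f : DForm E M 1) x := by
  have hx := mem_chart_source E x
  refine smoothAt_iff_apply.2 fun v => ?_
  have h1 := ((contDiffAt_coord_fun hx hf).fderiv_right (m := ∞) (by simp)).clm_apply
    (contDiffAt_const (c := v 0))
  refine h1.congr_of_eventuallyEq ?_
  filter_upwards [eventually_chart_target hx, eventually_coord hx (eventually_mdifferentiableAt hf)]
    with e he hd
  exact inChart_dFun he hd v

theorem extDeriv_one_apply {w : E → E [⋀^Fin 1]→L[ℝ] ℝ} {e : E} (hw : DifferentiableAt ℝ w e)
    (u v : E) :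
    extDeriv w e ![u, v] = fderiv ℝ (fun z => w z ![v]) e u - fderiv ℝ (fun z => w z ![u]) e v := by
  rw [extDeriv_apply hw, Fin.sum_univ_two]
  have h1 : (0 : Fin 2).removeNth ![u, v] = ![v] := by funext i; fin_cases i; rfl
  have h2 : (1 : Fin 2).removeNth ![u, v] = ![u] := by funext i; fin_cases i; rfl
  rw [h1, h2]
  simp [sub_eq_add_neg]

theorem extD_smul {f : M → ℝ} {θ : DForm E M 1} {x : M}
    (hf : ContMDiffAt 𝓘(ℝ, E) 𝓘(ℝ, ℝ) ∞ f x) (hθ : SmoothAt θ x) :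
    extD (fun z => f z • θ z) x = wedge (dFun f x) (θ x) + f x • extD θ x := by
  have hx := mem_chart_source E x
  set φ := chartAt E x
  set g : E → ℝ := f ∘ φ.symm with hg
  have hgd : DifferentiableAt ℝ g (φ x) := (contDiffAt_coord_fun hx hf).differentiableAt (by simp)
  have hθd : DifferentiableAt ℝ (inChart x θ) (φ x) := ContDiffAt.differentiableAt hθ (by simp)
  have hgx : g (φ x) = f x := by simp [hg, φ]
  have hin : inChart x (fun z => f z • θ z) = fun e => g e • inChart x θ e := rfl
  have hθv : ∀ v : E, DifferentiableAt ℝ (fun e => inChart x θ e ![v]) (φ x) := fun v =>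
    (evalCLM (E := E) ![v]).differentiableAt.comp (φ x) hθd
  have hsm : ∀ u v : E, fderiv ℝ (fun e => (g e • inChart x θ e) ![v]) (φ x) u =
      g (φ x) * fderiv ℝ (fun e => inChart x θ e ![v]) (φ x) u +
        fderiv ℝ g (φ x) u * inChart x θ (φ x) ![v] := by
    intro u v
    have := (hgd.hasFDerivAt.mul (hθv v).hasFDerivAt).fderiv
    have h2 : (fun e => (g e • inChart x θ e) ![v]) = fun e => g e * inChart x θ e ![v] := rfl
    rw [h2]
    erw [this]
    simp [mul_comm]
  refine alternating_two_ext fun u v => ?_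
  rw [ContinuousAlternatingMap.add_apply, ContinuousAlternatingMap.smul_apply, wedge_one_one]
  set L : TangentSpace 𝓘(ℝ, E) x → E := fun u => mfderiv 𝓘(ℝ, E) 𝓘(ℝ, E) φ x u
  have hθx : ∀ u : TangentSpace 𝓘(ℝ, E) x, θ x ![u] = inChart x θ (φ x) ![L u] := by
    intro u
    rw [← inChart_comp_chart hx θ]
    refine congrArg (inChart x θ (φ x)) ?_
    funext i; fin_cases i; rfl
  have hdf : ∀ u : TangentSpace 𝓘(ℝ, E) x, dFun f x ![u] = fderiv ℝ g (φ x) (L u) := by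
    intro u
    have h1 := inChart_comp_chart hx (dFun f : DForm E M 1)
    have h2 := congrArg (fun w => w ![u]) h1
    refine h2.symm.trans ?_
    have h3 : MDifferentiableAt 𝓘(ℝ, E) 𝓘(ℝ, ℝ) f (φ.symm (φ x)) := by
      rw [φ.left_inv hx]
      exact hf.mdifferentiableAt (by simp)
    refine Eq.trans ?_ (inChart_dFun (φ.map_source hx) h3 fun _ => L u)
    have h4 : (fun i => L (![u] i)) = fun _ : Fin 1 => L u := by funext i; fin_cases i; rfl
    rw [← h4]
    rfl
  have hext : ∀ w : DForm E M 1, extD w x ![u, v] = extDeriv (inChart x w) (φ x) ![L u, L v] := by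
    intro w
    refine congrArg (extDeriv (inChart x w) (φ x)) ?_
    funext i; fin_cases i <;> rfl
  have h1 : extDeriv (fun e => g e • inChart x θ e) (φ x) ![L u, L v] =
      fderiv ℝ (fun e => (g e • inChart x θ e) ![L v]) (φ x) (L u) -
        fderiv ℝ (fun e => (g e • inChart x θ e) ![L u]) (φ x) (L v) :=
    extDeriv_one_apply (hgd.smul hθd) (L u) (L v)
  rw [hext, hext, hin, extDeriv_one_apply hθd, h1, hsm, hsm, hdf, hdf, hθx, hθx, hgx, smul_eq_mul]
  ring

end ExtD

/-! ### Smooth families of linear maps -/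

section LinearFamilies

variable {X : Type*} [NormedAddCommGroup X] [NormedSpace ℝ X]
  {V : Type*} [NormedAddCommGroup V] [NormedSpace ℝ V] [FiniteDimensional ℝ V]
  {W : Type*} [NormedAddCommGroup W] [NormedSpace ℝ W]

theorem contDiffAt_clm_of_apply {C : X → V →L[ℝ] W} {x : X} {n : WithTop ℕ∞}
    (h : ∀ v, ContDiffAt ℝ n (fun z => C z v) x) : ContDiffAt ℝ n C x := by
  set b := Module.finBasis ℝ V
  have hC : C = fun z => ∑ i, ContinuousLinearMap.smulRightL ℝ V W
      (LinearMap.toContinuousLinearMap (b.coord i)) (C z (b i)) := by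
    funext z
    ext v
    rw [sum_apply]
    conv_lhs => rw [← b.sum_repr v, map_sum]
    refine Finset.sum_congr rfl fun i _ => ?_
    simp
  rw [hC]
  exact ContDiffAt.sum fun i _ =>
    (ContinuousLinearMap.smulRightL ℝ V W (LinearMap.toContinuousLinearMap (b.coord i))).contDiff
      |>.contDiffAt.comp x (h (b i))

theorem eventually_isInvertible {C : X → V →L[ℝ] W} {x : X} (hC : ContinuousAt C x)
    (h : (C x).IsInvertible) : ∀ᶠ z in 𝓝 x, (C z).IsInvertible := by
  obtain ⟨e, he⟩ := h
  have := hC.eventually (he ▸ e.nhds)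
  exact this

/-- A fixed left inverse L of C(x) makes L ∘ C(z) invertible for z near x, and (L ∘ C(z))⁻¹ ∘ L
depends smoothly on z. -/
theorem exists_smooth_leftInverse [FiniteDimensional ℝ W] {C : X → V →L[ℝ] W} {x : X}
    (hC : ∀ᶠ z in 𝓝 x, ContDiffAt ℝ ∞ C z) (hinj : Function.Injective (C x)) :
    ∃ S : X → W →L[ℝ] V, ∀ᶠ z in 𝓝 x, ContDiffAt ℝ ∞ S z ∧ ∀ v, S z (C z v) = v := by
  have := FiniteDimensional.complete ℝ V
  have := FiniteDimensional.complete ℝ W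
  obtain ⟨g, hg⟩ := (C x).toLinearMap.exists_leftInverse_of_injective (LinearMap.ker_eq_bot.2 hinj)
  set L : W →L[ℝ] V := LinearMap.toContinuousLinearMap g
  have hL : ∀ᶠ z in 𝓝 x, ContDiffAt ℝ ∞ (fun z => L ∘L C z) z := by
    filter_upwards [hC] with z hz
    exact contDiffAt_const.clm_comp hz
  have hinv : ∀ᶠ z in 𝓝 x, (L ∘L C z).IsInvertible := by
    refine eventually_isInvertible hL.self_of_nhds.continuousAt ?_
    have : L ∘L C x = ContinuousLinearMap.id ℝ V := by
      ext v
      exact LinearMap.congr_fun hg v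
    rw [this]
    exact ⟨ContinuousLinearEquiv.refl ℝ V, rfl⟩
  refine ⟨fun z => (L ∘L C z).inverse ∘L L, ?_⟩
  filter_upwards [hL, hinv] with z h1 h2
  have h3 : ContDiffAt ℝ ∞ (fun z => (L ∘L C z).inverse) z :=
    ContDiffAt.comp z (g := ContinuousLinearMap.inverse) h2.contDiffAt_map_inverse h1
  refine ⟨h3.clm_comp contDiffAt_const, fun v => ?_⟩
  exact h2.inverse_apply_self v

theorem exists_smooth_rightInverse [FiniteDimensional ℝ W] {C : X → V →L[ℝ] W} {x : X}
    (hC : ∀ᶠ z in 𝓝 x, ContDiffAt ℝ ∞ C z) (hsurj : Function.Surjective (C x)) :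
    ∃ S : X → W →L[ℝ] V, ∀ᶠ z in 𝓝 x, ContDiffAt ℝ ∞ S z ∧ ∀ w, C z (S z w) = w := by
  have := FiniteDimensional.complete ℝ V
  have := FiniteDimensional.complete ℝ W
  obtain ⟨g, hg⟩ := (C x).toLinearMap.exists_rightInverse_of_surjective
    (LinearMap.range_eq_top.2 hsurj)
  set L : W →L[ℝ] V := LinearMap.toContinuousLinearMap g
  have hL : ∀ᶠ z in 𝓝 x, ContDiffAt ℝ ∞ (fun z => C z ∘L L) z := by
    filter_upwards [hC] with z hz
    exact hz.clm_comp contDiffAt_const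
  have hinv : ∀ᶠ z in 𝓝 x, (C z ∘L L).IsInvertible := by
    refine eventually_isInvertible hL.self_of_nhds.continuousAt ?_
    have : C x ∘L L = ContinuousLinearMap.id ℝ W := by
      ext v
      exact LinearMap.congr_fun hg v
    rw [this]
    exact ⟨ContinuousLinearEquiv.refl ℝ W, rfl⟩
  refine ⟨fun z => L ∘L (C z ∘L L).inverse, ?_⟩
  filter_upwards [hL, hinv] with z h1 h2
  have h3 : ContDiffAt ℝ ∞ (fun z => (C z ∘L L).inverse) z :=
    ContDiffAt.comp z (g := ContinuousLinearMap.inverse) h2.contDiffAt_map_inverse h1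
  refine ⟨contDiffAt_const.clm_comp h3, fun v => ?_⟩
  exact h2.self_apply_inverse v

end LinearFamilies

section Local

variable {E : Type*} [NormedAddCommGroup E] [NormedSpace ℝ E]
  {M : Type*} [TopologicalSpace M] [ChartedSpace E M] [IsManifold 𝓘(ℝ, E) ∞ M]
  {E' : Type*} [NormedAddCommGroup E'] [NormedSpace ℝ E']
  {N : Type*} [TopologicalSpace N] [ChartedSpace E' N] [IsManifold 𝓘(ℝ, E') ∞ N] {k l : ℕ}
  [FiniteDimensional ℝ E] [FiniteDimensional ℝ E']

/-! ### Local forms and their extension -/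

/-- The form on the domain of a chart with a given coordinate expression. -/
def ofChart (c : M) (b : E → E [⋀^Fin k]→L[ℝ] ℝ) : DForm E M k := fun z =>
  (b (chartAt E c z)).compContinuousLinearMap (mfderiv 𝓘(ℝ, E) 𝓘(ℝ, E) (chartAt E c) z)

theorem inChart_ofChart {c : M} {e : E} (he : e ∈ (chartAt E c).target)
    (b : E → E [⋀^Fin k]→L[ℝ] ℝ) : inChart c (ofChart c b) e = b e := by
  ext v
  simp only [inChart_apply, ofChart]
  rw [(chartAt E c).right_inv he]
  refine congrArg (b e) (funext fun i => ?_)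
  exact mfderiv_chart_symm he (v i)

theorem smoothAt_ofChart {c x : M} (hx : x ∈ (chartAt E c).source) {b : E → E [⋀^Fin k]→L[ℝ] ℝ}
    (hb : ContDiffAt ℝ ∞ b (chartAt E c x)) : SmoothAt (ofChart c b) x := by
  refine (smoothAt_iff hx).2 (hb.congr_of_eventuallyEq ?_)
  filter_upwards [eventually_chart_target hx] with e he using inChart_ofChart he b

/-- Multiply by a bump function. The last clause records that values are only rescaled, so that
membership in subspaces survives. -/
theorem exists_smooth_extension [T2Space M] {w : DForm E M k} {x : M}
    (hw : ∀ᶠ z in 𝓝 x, SmoothAt w z) :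
    ∃ w' : DForm E M k, Smooth w' ∧ (∀ᶠ z in 𝓝 x, w' z = w z) ∧ ∀ z, ∃ c : ℝ, w' z = c • w z := by
  obtain ⟨f, -, hf⟩ := (SmoothBumpFunction.nhds_basis_tsupport (I := 𝓘(ℝ, E)) x).mem_iff.1 hw
  refine ⟨fun z => f z • w z, smooth_iff.2 fun z => ?_, ?_, fun z => ⟨f z, rfl⟩⟩
  · by_cases hz : z ∈ tsupport f
    · exact SmoothAt.smul f.contMDiff.contMDiffAt (hf hz)
    · refine (smoothAt_zero z).congr ?_
      filter_upwards [(isClosed_tsupport f).isOpen_compl.eventually_mem hz] with z' hz'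
      rw [image_eq_zero_of_notMem_tsupport hz', zero_smul]
      rfl
  · filter_upwards [f.eventuallyEq_one] with z hz
    rw [hz]
    exact one_smul _ _

/-- Local solutions of a pointwise convex condition are averaged by a partition of unity. A whole
family of forms, of varying degrees, is glued at once because the condition couples its members. -/
theorem exists_smooth_glue [T2Space M] [SigmaCompactSpace M] {ι : Type*} (d : ι → ℕ)
    (P : ∀ z : M, Set (∀ i, TangentSpace 𝓘(ℝ, E) z [⋀^Fin (d i)]→L[ℝ] ℝ))
    (hP : ∀ z, Convex ℝ (P z))
    (h : ∀ y : M, ∃ a : ∀ i, DForm E M (d i), ∀ᶠ z in 𝓝 y,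
      (∀ i, SmoothAt (a i) z) ∧ (fun i => a i z) ∈ P z) :
    ∃ a : ∀ i, DForm E M (d i), (∀ i, Smooth (a i)) ∧ ∀ z, (fun i => a i z) ∈ P z := by
  choose a ha using h
  set U : M → Set M := fun y =>
    interior {z | (∀ i, SmoothAt (a y i) z) ∧ (fun i => a y i z) ∈ P z}
  have hU : ∀ y, y ∈ U y := fun y => mem_interior_iff_mem_nhds.2 (ha y)
  obtain ⟨ρ, hρ⟩ := SmoothPartitionOfUnity.exists_isSubordinate 𝓘(ℝ, E) (isClosed_univ (X := M)) U
    (fun y => isOpen_interior) fun y _ => Set.mem_iUnion.2 ⟨y, hU y⟩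
  refine ⟨fun i z => ∑ y ∈ ρ.finsupport z, ρ y z • a y i z, fun i => smooth_iff.2 fun x => ?_,
    fun z => ?_⟩
  · have h1 : SmoothAt (fun z => ∑ y ∈ ρ.fintsupport x, ρ y z • a y i z) x := by
      refine SmoothAt.sum fun y hy => SmoothAt.smul (ρ y).contMDiff.contMDiffAt ?_
      have := hρ y ((ρ.mem_fintsupport_iff x y).1 hy)
      exact (interior_subset this).1 i
    refine h1.congr ?_
    filter_upwards [ρ.eventually_finsupport_subset x] with z hz
    refine Finset.sum_subset hz fun y _ hy => ?_
    have : ρ y z = 0 := by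
      by_contra h0
      exact hy ((ρ.mem_finsupport z).2 h0)
    rw [this, zero_smul]
  · have h1 : (fun i => ∑ y ∈ ρ.finsupport z, ρ y z • a y i z) =
        ∑ y ∈ ρ.finsupport z, ρ y z • (fun i => a y i z) := by
      funext i
      rw [Finset.sum_apply]
      rfl
    rw [h1]
    refine (hP z).sum_mem (fun y _ => ρ.nonneg y z) (ρ.sum_finsupport z (Set.mem_univ z))
      fun y hy => ?_
    have h2 : z ∈ tsupport (ρ y) := subset_closure ((ρ.mem_finsupport z).1 hy)
    exact (interior_subset (hρ y h2)).2

/-! ### Coefficients with respect to smooth frames -/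

theorem inChart_chart_apply {c x : M} (hx : x ∈ (chartAt E c).source) (w : DForm E M k)
    (v : Fin k → TangentSpace 𝓘(ℝ, E) x) :
    w x v = inChart c w (chartAt E c x)
      (fun i => mfderiv 𝓘(ℝ, E) 𝓘(ℝ, E) (chartAt E c) x (v i)) :=
  congrArg (fun η => η v) (inChart_comp_chart hx w).symm

/-- The linear combinations of finitely many one-forms, in a chart. -/
def coordComb {ι : Type*} [Fintype ι] (c : M) (θ : ι → DForm E M k) (e : E) :
    (ι → ℝ) →L[ℝ] (E [⋀^Fin k]→L[ℝ] ℝ) :=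
  LinearMap.toContinuousLinearMap (Fintype.linearCombination ℝ fun i => inChart c (θ i) e)

theorem coordComb_apply {ι : Type*} [Fintype ι] (c : M) (θ : ι → DForm E M k) (e : E) (a : ι → ℝ) :
    coordComb c θ e a = ∑ i, a i • inChart c (θ i) e :=
  Fintype.linearCombination_apply ℝ _ a

theorem coordComb_eq_inChart {ι : Type*} [Fintype ι] (c : M) (θ : ι → DForm E M k) (e : E)
    (a : ι → ℝ) : coordComb c θ e a = inChart c (fun z => ∑ i, a i • θ i z) e := by
  rw [coordComb_apply]
  ext v
  rw [inChart_apply, ContinuousAlternatingMap.sum_apply, ContinuousAlternatingMap.sum_apply]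
  rfl

theorem contDiffAt_coordComb {ι : Type*} [Fintype ι] {c x : M} {θ : ι → DForm E M k}
    (hx : x ∈ (chartAt E c).source) (hθ : ∀ᶠ z in 𝓝 x, ∀ i, SmoothAt (θ i) z) :
    ∀ᶠ e in 𝓝 (chartAt E c x), ContDiffAt ℝ ∞ (coordComb c θ) e := by
  filter_upwards [eventually_coord hx hθ, eventually_chart_target hx] with e he het
  refine contDiffAt_clm_of_apply fun a => ?_
  simp_rw [coordComb_apply]
  refine ContDiffAt.sum fun i _ => ContDiffAt.const_smul (a i) ?_
  have := (smoothAt_iff ((chartAt E c).map_target het)).1 (he i)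
  rwa [(chartAt E c).right_inv het] at this

theorem inChart_injective {c x : M} (hx : x ∈ (chartAt E c).source) {w w' : DForm E M k}
    (h : inChart c w (chartAt E c x) = inChart c w' (chartAt E c x)) : w x = w' x := by
  rw [← inChart_comp_chart hx w, ← inChart_comp_chart hx w', h]

theorem inChart_congr_point {c x : M} (hx : x ∈ (chartAt E c).source) {w w' : DForm E M k}
    (h : w x = w' x) : inChart c w (chartAt E c x) = inChart c w' (chartAt E c x) := by
  ext v
  rw [inChart_apply, inChart_apply]
  have e := (chartAt E c).left_inv hx
  have h1 := form_congr_point w e fun i =>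
    mfderiv 𝓘(ℝ, E) 𝓘(ℝ, E) (chartAt E c).symm (chartAt E c x) (v i)
  have h2 := form_congr_point w' e fun i =>
    mfderiv 𝓘(ℝ, E) 𝓘(ℝ, E) (chartAt E c).symm (chartAt E c x) (v i)
  refine h1.trans (Eq.trans ?_ h2.symm)
  rw [h]

theorem coordComb_injective {ι : Type*} [Fintype ι] {c x : M} {θ : ι → DForm E M k}
    (hx : x ∈ (chartAt E c).source) :
    Function.Injective (coordComb c θ (chartAt E c x)) ↔
      LinearIndependent ℝ (fun i => θ i x) := by
  rw [Fintype.linearIndependent_iff, injective_iff_map_eq_zero]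
  refine forall_congr' fun a => ?_
  rw [coordComb_eq_inChart, funext_iff]
  refine imp_congr ⟨fun h => ?_, fun h => ?_⟩ Iff.rfl
  · exact inChart_injective hx (w := fun z => ∑ i, a i • θ i z) (w' := 0) h
  · exact inChart_congr_point hx (w := fun z => ∑ i, a i • θ i z) (w' := 0) h

/-- The coefficients are read off with a smooth left inverse of the map that forms linear
combinations. -/
theorem exists_coeff_of_linearIndependent {ι : Type*} [Fintype ι] {x : M} {θ : ι → DForm E M k}
    (hθ : ∀ᶠ z in 𝓝 x, ∀ i, SmoothAt (θ i) z) (hli : LinearIndependent ℝ (fun i => θ i x))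
    {η : DForm E M k} (hη : ∀ᶠ z in 𝓝 x, SmoothAt η z ∧
      η z ∈ Submodule.span ℝ (Set.range fun i => θ i z)) :
    ∃ a : ι → M → ℝ, ∀ᶠ z in 𝓝 x, (∀ i, ContMDiffAt 𝓘(ℝ, E) 𝓘(ℝ, ℝ) ∞ (a i) z) ∧
      η z = ∑ i, a i z • θ i z := by
  have hx := mem_chart_source E x
  obtain ⟨S, hS⟩ := exists_smooth_leftInverse (contDiffAt_coordComb hx hθ)
    ((coordComb_injective hx).2 hli)
  refine ⟨fun i z => S (chartAt E x z) (inChart x η (chartAt E x z)) i, ?_⟩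
  filter_upwards [eventually_of_coord hx hS, hη, eventually_chart_source hx] with z hz1 hz2 hz3
  refine ⟨fun i => ?_, ?_⟩
  · have h1 : ContDiffAt ℝ ∞ (fun e => S e (inChart x η e)) (chartAt E x z) :=
      hz1.1.clm_apply ((smoothAt_iff hz3).1 hz2.1)
    exact contMDiffAt_of_coord_fun hz3 (contDiffAt_pi.1 h1 i)
  · obtain ⟨a, ha⟩ := (Submodule.mem_span_range_iff_exists_fun ℝ).1 hz2.2
    have h1 : inChart x η (chartAt E x z) = coordComb x θ (chartAt E x z) a := by
      rw [coordComb_eq_inChart]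
      exact inChart_congr_point hz3 ha.symm
    simp only [h1, hz1.2]
    exact ha.symm

/-- The family may be redundant, so the coefficients come from a smooth right inverse. That inverse
is linear in the form, hence the coefficients vanish where the form does. -/
theorem exists_coeff_of_span_eq_top {ι : Type*} [Fintype ι] {x : M} {θ : ι → DForm E M k}
    (hθ : ∀ᶠ z in 𝓝 x, ∀ i, SmoothAt (θ i) z)
    (hsp : Submodule.span ℝ (Set.range fun i => θ i x) = ⊤)
    {η : DForm E M k} (hη : ∀ᶠ z in 𝓝 x, SmoothAt η z) :
    ∃ a : ι → M → ℝ, (∀ᶠ z in 𝓝 x, (∀ i, ContMDiffAt 𝓘(ℝ, E) 𝓘(ℝ, ℝ) ∞ (a i) z) ∧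
      η z = ∑ i, a i z • θ i z) ∧ (η x = 0 → ∀ i, a i x = 0) := by
  have hx := mem_chart_source E x
  have hsurj : Function.Surjective (coordComb x θ (chartAt E x x)) := by
    intro w
    obtain ⟨a, ha⟩ := (Submodule.mem_span_range_iff_exists_fun ℝ).1
      (hsp.symm ▸ Submodule.mem_top : ofChart x (fun _ => w) x ∈
        Submodule.span ℝ (Set.range fun i => θ i x))
    refine ⟨a, ?_⟩
    rw [coordComb_eq_inChart, ← inChart_ofChart (mem_chart_target E x) (fun _ => w)]
    exact inChart_congr_point hx ha
  obtain ⟨S, hS⟩ := exists_smooth_rightInverse (contDiffAt_coordComb hx hθ) hsurj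
  refine ⟨fun i z => S (chartAt E x z) (inChart x η (chartAt E x z)) i, ?_, fun h i => ?_⟩
  · filter_upwards [eventually_of_coord hx hS, hη, eventually_chart_source hx] with z hz1 hz2 hz3
    refine ⟨fun i => ?_, ?_⟩
    · have h1 : ContDiffAt ℝ ∞ (fun e => S e (inChart x η e)) (chartAt E x z) :=
        hz1.1.clm_apply ((smoothAt_iff hz3).1 hz2)
      exact contMDiffAt_of_coord_fun hz3 (contDiffAt_pi.1 h1 i)
    · have h1 := hz1.2 (inChart x η (chartAt E x z))
      rw [coordComb_eq_inChart] at h1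
      exact (inChart_injective hz3 h1).symm
  · have : inChart x η (chartAt E x x) = 0 := inChart_congr_point (w' := 0) hx h
    simp only [this, map_zero]
    rfl

end Local

section Subbundles

variable {E : Type*} [NormedAddCommGroup E] [NormedSpace ℝ E]
  {M : Type*} [TopologicalSpace M] [ChartedSpace E M] [IsManifold 𝓘(ℝ, E) ∞ M]
  {E' : Type*} [NormedAddCommGroup E'] [NormedSpace ℝ E']
  {N : Type*} [TopologicalSpace N] [ChartedSpace E' N] [IsManifold 𝓘(ℝ, E') ∞ N] {k l : ℕ}
  [FiniteDimensional ℝ E] [FiniteDimensional ℝ E']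

instance cotangent_finiteDimensional (x : M) :
    FiniteDimensional ℝ (TangentSpace 𝓘(ℝ, E) x [⋀^Fin k]→L[ℝ] ℝ) :=
  inferInstanceAs (FiniteDimensional ℝ (E [⋀^Fin k]→L[ℝ] ℝ))

instance tangent_finiteDimensional (x : M) : FiniteDimensional ℝ (TangentSpace 𝓘(ℝ, E) x) :=
  inferInstanceAs (FiniteDimensional ℝ E)

/-! ### Criteria for subbundles -/

theorem eventually_linearIndependent {ι : Type*} [Fintype ι] {x : M} {θ : ι → DForm E M k}
    (hθ : ∀ᶠ z in 𝓝 x, ∀ i, SmoothAt (θ i) z) (hli : LinearIndependent ℝ (fun i => θ i x)) :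
    ∀ᶠ z in 𝓝 x, LinearIndependent ℝ (fun i => θ i z) := by
  have hx := mem_chart_source E x
  obtain ⟨S, hS⟩ := exists_smooth_leftInverse (contDiffAt_coordComb hx hθ)
    ((coordComb_injective hx).2 hli)
  filter_upwards [eventually_of_coord hx hS, eventually_chart_source hx] with z h1 h2
  exact (coordComb_injective h2).1 (Function.LeftInverse.injective h1.2)

theorem isSubbundle_iff {W : CotField E M} :
    IsSubbundle W ↔ ∃ r : ℕ, ∀ x₀ : M, ∃ θ : Fin r → DForm E M 1, ∀ᶠ z in 𝓝 x₀,
      (∀ i, SmoothAt (θ i) z) ∧ LinearIndependent ℝ (fun i => θ i z) ∧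
        Submodule.span ℝ (Set.range fun i => θ i z) = W z := by
  refine exists_congr fun r => forall_congr' fun x₀ => ?_
  constructor
  · rintro ⟨U, hU, hx, θ, hθ, h⟩
    refine ⟨θ, ?_⟩
    filter_upwards [hU.eventually_mem hx] with z hz
    exact ⟨fun i => (smoothOn_iff hU).1 (hθ i) z hz, h z hz⟩
  · rintro ⟨θ, hθ⟩
    obtain ⟨U, hUs, hU, hx⟩ := mem_nhds_iff.1 hθ
    exact ⟨U, hU, hx, θ, fun i => (smoothOn_iff hU).2 fun z hz => (hUs hz).1 i,
      fun z hz => (hUs hz).2⟩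

/-- A finite family of one-forms spanning a field of subspaces of constant dimension contains a
local frame. -/
theorem exists_local_subframe {W : CotField E M} {r m : ℕ}
    (hr : ∀ x, Module.finrank ℝ (W x) = r) {θ : Fin m → DForm E M 1} {x : M}
    (hθ : ∀ᶠ z in 𝓝 x,
      (∀ i, SmoothAt (θ i) z) ∧ Submodule.span ℝ (Set.range fun i => θ i z) = W z) :
    ∃ a : Fin r → Fin m, ∀ᶠ z in 𝓝 x,
      (∀ i, SmoothAt (θ (a i)) z) ∧ LinearIndependent ℝ (fun i => θ (a i) z) ∧
        Submodule.span ℝ (Set.range fun i => θ (a i) z) = W z := by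
  obtain ⟨κ, a, ha, hsp, hli⟩ := exists_linearIndependent' ℝ fun i => θ i x
  have : Finite κ := Finite.of_injective a ha
  have := Fintype.ofFinite κ
  have hcard : Fintype.card κ = r := by
    rw [← hr x, ← hθ.self_of_nhds.2, ← hsp, finrank_span_eq_card hli]
  obtain e := Fintype.equivFinOfCardEq hcard
  have hs : ∀ᶠ z in 𝓝 x, ∀ i, SmoothAt (θ (a (e.symm i))) z := by
    filter_upwards [hθ] with z hz i using hz.1 _
  refine ⟨fun i => a (e.symm i), ?_⟩
  have hli' : LinearIndependent ℝ (fun i => θ (a (e.symm i)) x) :=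
    hli.comp e.symm e.symm.injective
  filter_upwards [hθ, hs, eventually_linearIndependent hs hli'] with z h1 h2 h3
  refine ⟨h2, h3, ?_⟩
  refine Submodule.eq_of_le_of_finrank_eq ?_ ?_
  · rw [← h1.2]
    refine Submodule.span_mono ?_
    rintro _ ⟨i, rfl⟩
    exact ⟨_, rfl⟩
  · rw [finrank_span_eq_card h3, hr z, Fintype.card_fin]

theorem isSubbundle_of_span {W : CotField E M} (r : ℕ) (hr : ∀ x, Module.finrank ℝ (W x) = r)
    (h : ∀ x₀ : M, ∃ m : ℕ, ∃ θ : Fin m → DForm E M 1, ∀ᶠ z in 𝓝 x₀,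
      (∀ i, SmoothAt (θ i) z) ∧ Submodule.span ℝ (Set.range fun i => θ i z) = W z) :
    IsSubbundle W := by
  refine isSubbundle_iff.2 ⟨r, fun x₀ => ?_⟩
  obtain ⟨m, θ, hθ⟩ := h x₀
  obtain ⟨a, ha⟩ := exists_local_subframe hr hθ
  exact ⟨_, ha⟩

theorem IsSubbundle.finrank_eq {W : CotField E M} (h : IsSubbundle W) :
    ∃ r : ℕ, ∀ x, Module.finrank ℝ (W x) = r := by
  obtain ⟨r, hr⟩ := isSubbundle_iff.1 h
  refine ⟨r, fun x => ?_⟩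
  obtain ⟨θ, hθ⟩ := hr x
  have := hθ.self_of_nhds
  rw [← this.2.2, finrank_span_eq_card this.2.1, Fintype.card_fin]

theorem sum_sub_smul_eq {V ι κ : Type*} [AddCommGroup V] [Module ℝ V] [Fintype ι] [Fintype κ]
    {α : ι → V} {β : κ → V} {c a : ι → ℝ} {d b : κ → ℝ}
    (h : ∑ i, c i • α i + ∑ i, (-d i) • β i = ∑ i, a i • α i + ∑ i, b i • β i) :
    ∑ i, (c i - a i) • α i = ∑ i, (d i + b i) • β i := by
  simp only [sub_smul, add_smul, Finset.sum_sub_distrib, Finset.sum_add_distrib, neg_smul,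
    Finset.sum_neg_distrib] at h ⊢
  rw [← sub_eq_zero] at h ⊢
  rw [← h]
  abel

theorem sum_add_sum_neg_smul {V ι κ : Type*} [AddCommGroup V] [Module ℝ V] [Fintype ι] [Fintype κ]
    {α : ι → V} {β : κ → V} {c : ι → ℝ} {d : κ → ℝ} {s : V} (h : ∑ i, c i • α i = s)
    (h' : ∑ i, d i • β i = s) : ∑ i, c i • α i + ∑ i, (-d i) • β i = 0 := by
  simp [h, h']

/-- Write s as Σ cᵢαᵢ and as Σ dⱼβⱼ in local frames, and extend both with constant coefficients.
Their difference δ vanishes at x; since A and B span everything there, δ = Σ aᵢαᵢ + Σ bⱼβⱼ with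
smooth coefficients vanishing at x. Then Σ (cᵢ − aᵢ)αᵢ = Σ (dⱼ + bⱼ)βⱼ lies in both bundles and has
the value s at x. -/
theorem exists_local_section_inf {A B : CotField E M} (hA : IsSubbundle A) (hB : IsSubbundle B)
    {x : M} (hAB : A x ⊔ B x = ⊤) {s : TangentSpace 𝓘(ℝ, E) x [⋀^Fin 1]→L[ℝ] ℝ}
    (hs : s ∈ A x ⊓ B x) :
    ∃ σ : DForm E M 1, (∀ᶠ z in 𝓝 x, SmoothAt σ z ∧ σ z ∈ A z ⊓ B z) ∧ σ x = s := by
  obtain ⟨p, hp⟩ := isSubbundle_iff.1 hA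
  obtain ⟨q, hq⟩ := isSubbundle_iff.1 hB
  obtain ⟨α, hα⟩ := hp x
  obtain ⟨β, hβ⟩ := hq x
  obtain ⟨c, hc⟩ := (Submodule.mem_span_range_iff_exists_fun ℝ).1
    (hα.self_of_nhds.2.2.symm ▸ hs.1)
  obtain ⟨d, hd⟩ := (Submodule.mem_span_range_iff_exists_fun ℝ).1
    (hβ.self_of_nhds.2.2.symm ▸ hs.2)
  set θ : Fin p ⊕ Fin q → DForm E M 1 := Sum.elim α β
  have hθ : ∀ᶠ z in 𝓝 x, ∀ i, SmoothAt (θ i) z := by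
    filter_upwards [hα, hβ] with z h1 h2 i
    rcases i with i | i
    · exact h1.1 i
    · exact h2.1 i
  have hsp : Submodule.span ℝ (Set.range fun i => θ i x) = ⊤ := by
    rw [← hAB, ← hα.self_of_nhds.2.2, ← hβ.self_of_nhds.2.2, ← Submodule.span_union]
    congr 1
    ext w
    simp [θ]
  have hcs : ∀ (c : Fin p → ℝ) {z}, (∀ i, SmoothAt (α i) z) →
      SmoothAt (fun z => ∑ i, c i • α i z) z := fun c z h =>
    SmoothAt.sum fun i _ => SmoothAt.smul (f := fun _ => c i) contMDiffAt_const (h i)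
  have hds : ∀ (d : Fin q → ℝ) {z}, (∀ i, SmoothAt (β i) z) →
      SmoothAt (fun z => ∑ i, d i • β i z) z := fun d z h =>
    SmoothAt.sum fun i _ => SmoothAt.smul (f := fun _ => d i) contMDiffAt_const (h i)
  set δ : DForm E M 1 := (fun z => ∑ i, c i • α i z) + fun z => ∑ i, (-d i) • β i z
  have hδs : ∀ᶠ z in 𝓝 x, SmoothAt δ z := by
    filter_upwards [hα, hβ] with z h1 h2
    exact (hcs c h1.1).add (hds _ h2.1)
  have hδx : δ x = 0 :=
    sum_add_sum_neg_smul hc hd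
  obtain ⟨a, ha, ha0⟩ := exists_coeff_of_span_eq_top hθ hsp hδs
  refine ⟨fun z => ∑ i, (c i - a (Sum.inl i) z) • α i z, ?_, ?_⟩
  · filter_upwards [hα, hβ, ha] with z h1 h2 h3
    refine ⟨SmoothAt.sum fun i _ => SmoothAt.smul (contMDiffAt_const.sub (h3.1 _)) (h1.1 i), ?_, ?_⟩
    · rw [← h1.2.2]
      exact Submodule.sum_mem _ fun i _ => Submodule.smul_mem _ _ (Submodule.subset_span ⟨i, rfl⟩)
    · have h5 : δ z = _ := h3.2
      rw [Fintype.sum_sum_type] at h5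
      have h6 := sum_sub_smul_eq h5
      change (∑ i, (c i - a (Sum.inl i) z) • α i z) ∈ B z
      rw [h6, ← h2.2.2]
      exact Submodule.sum_mem _ fun i _ => Submodule.smul_mem _ _ (Submodule.subset_span ⟨i, rfl⟩)
  · simp only [ha0 hδx, sub_zero]
    exact hc

/-! ### Two-forms vanishing on the annihilator of a subbundle -/

/-- A nonzero functional vanishing on the range of the joint evaluation would be a linear relation
between the covectors. -/
theorem evalPi_surjective {T : Type*} [AddCommGroup T] [Module ℝ T] [TopologicalSpace T]
    {ι : Type*} [Fintype ι] {τ : ι → T [⋀^Fin 1]→L[ℝ] ℝ}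
    (hω : LinearIndependent ℝ τ) (c : ι → ℝ) : ∃ v, ∀ i, τ i ![v] = c i := by
  classical
  let L : T →ₗ[ℝ] (ι → ℝ) := LinearMap.pi fun i =>
    ((ContinuousAlternatingMap.ofSubsingleton ℝ T ℝ (0 : Fin 1)).symm (τ i)).toLinearMap
  have hL : ∀ v i, L v i = τ i ![v] := by
    intro v i
    refine congrArg (τ i) ?_
    funext j; fin_cases j; rfl
  suffices h : LinearMap.range L = ⊤ by
    obtain ⟨v, hv⟩ := LinearMap.range_eq_top.1 h c
    exact ⟨v, fun i => by rw [← hL, hv]⟩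
  by_contra h
  obtain ⟨f, hf0, hf⟩ := Submodule.exists_le_ker_of_lt_top _ (lt_top_iff_ne_top.2 h)
  apply hf0
  have hfe : ∀ w, f w = ∑ i, w i * f (Pi.single i 1) := by
    intro w
    conv_lhs => rw [← Finset.univ_sum_single w, map_sum]
    refine Finset.sum_congr rfl fun i _ => ?_
    have : (Pi.single i (w i) : ι → ℝ) = w i • Pi.single i 1 := by
      rw [← Pi.single_smul]; simp
    rw [this, map_smul, smul_eq_mul]
  have h0 : ∑ i, f (Pi.single i 1) • τ i = 0 := by
    refine alternating_one_ext fun u => ?_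
    have h1 : f (L u) = 0 := hf ⟨u, rfl⟩
    rw [hfe] at h1
    rw [ContinuousAlternatingMap.sum_apply]
    refine Eq.trans (Finset.sum_congr rfl fun i _ => ?_) h1
    rw [hL, mul_comm]
    rfl
  have h2 := Fintype.linearIndependent_iff.1 hω _ h0
  refine LinearMap.ext fun w => ?_
  rw [hfe]
  simp [h2]

theorem inChart_linearIndependent {ι : Type*} [Fintype ι] {c x : M} {θ : ι → DForm E M k}
    (hx : x ∈ (chartAt E c).source) (h : LinearIndependent ℝ (fun i => θ i x)) :
    LinearIndependent ℝ (fun i => inChart c (θ i) (chartAt E c x)) := by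
  rw [← coordComb_injective (c := c) hx, injective_iff_map_eq_zero] at h
  rw [Fintype.linearIndependent_iff]
  intro a ha i
  rw [h a (by rw [coordComb_apply]; exact ha)]
  rfl

/-- The contraction of a two-form with a vector. -/
def contract {T : Type*} [NormedAddCommGroup T] [NormedSpace ℝ T] (η : T [⋀^Fin 2]→L[ℝ] ℝ) (v : T) :
    T [⋀^Fin 1]→L[ℝ] ℝ :=
  η.curryLeft v

theorem contract_apply {T : Type*} [NormedAddCommGroup T] [NormedSpace ℝ T]
    (η : T [⋀^Fin 2]→L[ℝ] ℝ) (u v : T) : contract η u ![v] = η ![u, v] := rfl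

theorem two_form_swap {T : Type*} [NormedAddCommGroup T] [NormedSpace ℝ T]
    (η : T [⋀^Fin 2]→L[ℝ] ℝ) (u v : T) : η ![u, v] = -η ![v, u] := by
  have h := η.toAlternatingMap.map_swap ![v, u] (i := 0) (j := 1) (by decide)
  have h1 : ![v, u] ∘ Equiv.swap (0 : Fin 2) 1 = ![u, v] := by
    funext i; fin_cases i <;> rfl
  rw [h1] at h
  exact h

theorem two_form_add_left {T : Type*} [NormedAddCommGroup T] [NormedSpace ℝ T]
    (η : T [⋀^Fin 2]→L[ℝ] ℝ) (u u' v : T) : η ![u + u', v] = η ![u, v] + η ![u', v] := by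
  rw [← contract_apply, ← contract_apply, ← contract_apply, contract, map_add]
  rfl

theorem two_form_sum_left {T : Type*} [NormedAddCommGroup T] [NormedSpace ℝ T] {ι : Type*}
    [Fintype ι] (η : T [⋀^Fin 2]→L[ℝ] ℝ) (a : ι → ℝ) (e : ι → T) (v : T) :
    η ![∑ i, a i • e i, v] = ∑ i, a i * η ![e i, v] := by
  rw [← contract_apply, contract, map_sum, ContinuousAlternatingMap.sum_apply]
  refine Finset.sum_congr rfl fun i _ => ?_
  rw [map_smul]
  rfl

theorem one_form_sum {T : Type*} [NormedAddCommGroup T] [NormedSpace ℝ T] {ι : Type*}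
    [Fintype ι] (w : T [⋀^Fin 1]→L[ℝ] ℝ) (a : ι → ℝ) (e : ι → T) :
    w ![∑ i, a i • e i] = ∑ i, a i * w ![e i] := by
  have h : ∀ v, w ![v] = (ContinuousAlternatingMap.ofSubsingleton ℝ T ℝ (0 : Fin 1)).symm w v := by
    intro v
    refine congrArg w ?_
    funext j; fin_cases j; rfl
  rw [h, map_sum]
  refine Finset.sum_congr rfl fun i _ => ?_
  rw [h, map_smul, smul_eq_mul]

theorem one_form_add {T : Type*} [AddCommGroup T] [Module ℝ T] [TopologicalSpace T]
    (w : T [⋀^Fin 1]→L[ℝ] ℝ) (u v : T) : w ![u + v] = w ![u] + w ![v] := by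
  have := w.vecCons_add ![] u v
  simpa using this

theorem one_form_smul {T : Type*} [AddCommGroup T] [Module ℝ T] [TopologicalSpace T]
    (w : T [⋀^Fin 1]→L[ℝ] ℝ) (c : ℝ) (u : T) : w ![c • u] = c * w ![u] := by
  have := w.vecCons_smul ![] c u
  simpa using this

theorem one_form_sub {T : Type*} [AddCommGroup T] [Module ℝ T] [TopologicalSpace T]
    (w : T [⋀^Fin 1]→L[ℝ] ℝ) (u v : T) : w ![u - v] = w ![u] - w ![v] := by
  have h := one_form_add w (u - v) v
  rw [sub_add_cancel] at h
  linarith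

/-- Split each vector into its τ-components and its projection P to the common kernel, where η
vanishes. The sum of the τᵢ ∧ η(eᵢ, ·) counts each component along τᵢ ∧ τₗ twice; the term with 2⁻¹
corrects this. -/
theorem two_form_expansion {T : Type*} [NormedAddCommGroup T] [NormedSpace ℝ T] {ι : Type*}
    [Fintype ι] [DecidableEq ι] (τ : ι → T [⋀^Fin 1]→L[ℝ] ℝ) (e : ι → T)
    (he : ∀ i j, τ i ![e j] = if i = j then 1 else 0) (η : T [⋀^Fin 2]→L[ℝ] ℝ)
    (hη : ∀ u v, (∀ i, τ i ![u] = 0) → (∀ i, τ i ![v] = 0) → η ![u, v] = 0) :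
    η = ∑ i, wedge (τ i) (contract η (e i) - ∑ l, (2⁻¹ * η ![e i, e l]) • τ l) := by
  refine alternating_two_ext fun u v => ?_
  set P : T → T := fun u => u - ∑ i, τ i ![u] • e i with hP
  have hPτ : ∀ u i, τ i ![P u] = 0 := by
    intro u i
    simp only [hP]
    rw [one_form_sub, one_form_sum]
    simp [he]
  have hu : ∀ u, u = P u + ∑ i, τ i ![u] • e i := fun u => by simp [hP]
  have h1 : η ![u, v] = η ![P u, v] + ∑ i, τ i ![u] * η ![e i, v] := by
    conv_lhs => rw [hu u]
    rw [two_form_add_left, two_form_sum_left]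
  have h2 : η ![P u, v] = ∑ l, τ l ![v] * η ![P u, e l] := by
    rw [two_form_swap]
    conv_lhs => rw [hu v]
    rw [two_form_add_left, two_form_sum_left, hη _ _ (hPτ v) (hPτ u), zero_add,
      ← Finset.sum_neg_distrib]
    refine Finset.sum_congr rfl fun l _ => ?_
    rw [two_form_swap η (P u)]
    ring
  have h3 : ∀ l, η ![P u, e l] = η ![u, e l] - ∑ i, τ i ![u] * η ![e i, e l] := by
    intro l
    have : η ![u, e l] = η ![P u, e l] + ∑ i, τ i ![u] * η ![e i, e l] := by
      conv_lhs => rw [hu u]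
      rw [two_form_add_left, two_form_sum_left]
    rw [this]
    ring
  rw [h1, h2, ContinuousAlternatingMap.sum_apply]
  have h4 : ∀ i, wedge (τ i) (contract η (e i) - ∑ l, (2⁻¹ * η ![e i, e l]) • τ l) ![u, v] =
      τ i ![u] * η ![e i, v] - τ i ![v] * η ![e i, u]
        - 2⁻¹ * ∑ l, (τ i ![u] * τ l ![v] * η ![e i, e l] -
            τ i ![v] * τ l ![u] * η ![e i, e l]) := by
    intro i
    rw [wedge_one_one, ContinuousAlternatingMap.sub_apply, ContinuousAlternatingMap.sub_apply,
      contract_apply, contract_apply, ContinuousAlternatingMap.sum_apply,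
      ContinuousAlternatingMap.sum_apply]
    simp only [ContinuousAlternatingMap.smul_apply, smul_eq_mul]
    have e1 : ∑ l, 2⁻¹ * η ![e i, e l] * τ l ![v] = 2⁻¹ * ∑ l, η ![e i, e l] * τ l ![v] := by
      rw [Finset.mul_sum]; exact Finset.sum_congr rfl fun l _ => by ring
    have e2 : ∑ l, 2⁻¹ * η ![e i, e l] * τ l ![u] = 2⁻¹ * ∑ l, η ![e i, e l] * τ l ![u] := by
      rw [Finset.mul_sum]; exact Finset.sum_congr rfl fun l _ => by ring
    have e3 : ∑ l, (τ i ![u] * τ l ![v] * η ![e i, e l] - τ i ![v] * τ l ![u] * η ![e i, e l]) =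
        τ i ![u] * ∑ l, η ![e i, e l] * τ l ![v] - τ i ![v] * ∑ l, η ![e i, e l] * τ l ![u] := by
      rw [Finset.sum_sub_distrib, Finset.mul_sum, Finset.mul_sum]
      congr 1 <;> exact Finset.sum_congr rfl fun l _ => by ring
    rw [e1, e2, e3]
    ring
  simp only [h4, h3]
  have h5 : ∑ i, ∑ l, τ i ![v] * τ l ![u] * η ![e i, e l] =
      -∑ i, ∑ l, τ i ![u] * τ l ![v] * η ![e i, e l] := by
    rw [Finset.sum_comm, ← Finset.sum_neg_distrib]
    refine Finset.sum_congr rfl fun i _ => ?_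
    rw [← Finset.sum_neg_distrib]
    refine Finset.sum_congr rfl fun l _ => ?_
    rw [two_form_swap η (e l)]
    ring
  have h6 : ∑ l, τ l ![v] * (η ![u, e l] - ∑ i, τ i ![u] * η ![e i, e l]) =
      -∑ i, τ i ![v] * η ![e i, u] - ∑ i, ∑ l, τ i ![u] * τ l ![v] * η ![e i, e l] := by
    rw [Finset.sum_comm, ← Finset.sum_neg_distrib, ← Finset.sum_sub_distrib]
    refine Finset.sum_congr rfl fun l _ => ?_
    rw [mul_sub, two_form_swap η u, Finset.mul_sum]
    congr 1
    · ring
    · exact Finset.sum_congr rfl fun i _ => by ring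
  rw [h6, Finset.sum_sub_distrib, Finset.sum_sub_distrib, ← Finset.mul_sum]
  simp only [Finset.sum_sub_distrib]
  rw [h5]
  ring

theorem sum_wedge_comp {T T' : Type*} [AddCommGroup T] [Module ℝ T] [TopologicalSpace T]
    [AddCommGroup T'] [Module ℝ T'] [TopologicalSpace T'] {ι : Type*} [Fintype ι]
    (a : ι → T [⋀^Fin k]→L[ℝ] ℝ) (b : ι → T [⋀^Fin l]→L[ℝ] ℝ) (A : T' →L[ℝ] T) :
    (∑ i, wedge (a i) (b i)).compContinuousLinearMap A =
      ∑ i, wedge ((a i).compContinuousLinearMap A) ((b i).compContinuousLinearMap A) := by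
  simp_rw [← wedge_comp]
  ext v
  simp only [ContinuousAlternatingMap.compContinuousLinearMap_apply,
    ContinuousAlternatingMap.sum_apply]

/-- The pointwise expansion is explicit in vectors dual to the τ. These are chosen smoothly through
a right inverse of the evaluation map, so the cofactors are smooth too. -/
theorem exists_wedge_expansion {ι : Type*} [Fintype ι] {x : M} {τ : ι → DForm E M 1}
    (hω : ∀ᶠ z in 𝓝 x, ∀ i, SmoothAt (τ i) z) (hli : LinearIndependent ℝ (fun i => τ i x))
    {η : DForm E M 2} (hη : ∀ᶠ z in 𝓝 x, SmoothAt η z ∧ ∀ u v : TangentSpace 𝓘(ℝ, E) z,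
      (∀ i, τ i z ![u] = 0) → (∀ i, τ i z ![v] = 0) → η z ![u, v] = 0) :
    ∃ β : ι → DForm E M 1, ∀ᶠ z in 𝓝 x, (∀ i, SmoothAt (β i) z) ∧
      η z = ∑ i, wedge (τ i z) (β i z) := by
  classical
  have hx := mem_chart_source E x
  set Ω : E → E →L[ℝ] (ι → ℝ) := fun e => ContinuousLinearMap.pi fun i =>
    (ContinuousAlternatingMap.ofSubsingleton ℝ E ℝ (0 : Fin 1)).symm (inChart x (τ i) e)
  have hΩ : ∀ e v i, Ω e v i = inChart x (τ i) e ![v] := by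
    intro e v i
    refine congrArg (inChart x (τ i) e) ?_
    funext j; fin_cases j; rfl
  have hωc : ∀ᶠ e in 𝓝 (chartAt E x x), ∀ i, ContDiffAt ℝ ∞ (inChart x (τ i)) e := by
    filter_upwards [eventually_coord hx hω, eventually_chart_target hx] with e he het i
    have := (smoothAt_iff ((chartAt E x).map_target het)).1 (he i)
    rwa [(chartAt E x).right_inv het] at this
  have hΩs : ∀ᶠ e in 𝓝 (chartAt E x x), ContDiffAt ℝ ∞ Ω e := by
    filter_upwards [hωc] with e he
    refine contDiffAt_clm_of_apply fun v => contDiffAt_pi.2 fun i => ?_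
    simp_rw [hΩ]
    exact contDiffAt_alternating_iff.1 (he i) _
  obtain ⟨S, hS⟩ := exists_smooth_rightInverse hΩs (by
    intro c
    obtain ⟨v, hv⟩ := evalPi_surjective (inChart_linearIndependent hx hli) c
    exact ⟨v, funext fun i => by rw [hΩ, hv]⟩)
  have hvan : ∀ z ∈ (chartAt E x).source, (∀ u v : TangentSpace 𝓘(ℝ, E) z,
      (∀ i, τ i z ![u] = 0) → (∀ i, τ i z ![v] = 0) → η z ![u, v] = 0) → ∀ u v : E,
      (∀ i, inChart x (τ i) (chartAt E x z) ![u] = 0) →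
      (∀ i, inChart x (τ i) (chartAt E x z) ![v] = 0) →
      inChart x η (chartAt E x z) ![u, v] = 0 := by
    intro z hz h u v hu hv
    rw [← (chartAt E x).left_inv hz] at h
    have h1 : ∀ (w : DForm E M 1) (u : E), inChart x w (chartAt E x z) ![u] = 0 →
        w ((chartAt E x).symm (chartAt E x z))
          ![mfderiv 𝓘(ℝ, E) 𝓘(ℝ, E) (chartAt E x).symm (chartAt E x z) u] = 0 := by
      intro w u hw
      refine Eq.trans (congrArg (w _) ?_) hw
      funext i; fin_cases i; rfl
    refine Eq.trans (congrArg (η ((chartAt E x).symm (chartAt E x z))) ?_)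
      (h _ _ (fun i => h1 _ _ (hu i)) (fun i => h1 _ _ (hv i)))
    funext i; fin_cases i <;> rfl
  set ε : ι → E → E := fun i e => S e (Pi.single i 1)
  set b : ι → E → E [⋀^Fin 1]→L[ℝ] ℝ := fun i e => contract (inChart x η e) (ε i e) -
    ∑ l, (2⁻¹ * inChart x η e ![ε i e, ε l e]) • inChart x (τ l) e with hb
  refine ⟨fun i => ofChart x (b i), ?_⟩
  filter_upwards [eventually_of_coord hx hS, eventually_of_coord hx hωc, hη,
    eventually_chart_source hx] with z h1 h2 h3 h4
  have hηc := (smoothAt_iff h4).1 h3.1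
  have hεs : ∀ i, ContDiffAt ℝ ∞ (ε i) (chartAt E x z) := fun i => h1.1.clm_apply contDiffAt_const
  refine ⟨fun i => smoothAt_ofChart h4 ?_, ?_⟩
  · refine contDiffAt_alternating_iff.2 fun v => ?_
    have e1 : ∀ e, b i e v = inChart x η e (fun j => Fin.cases (motive := fun _ => E → E) (ε i)
        (fun _ _ => v 0) j e) - ∑ l, 2⁻¹ * inChart x η e (fun j =>
          Fin.cases (motive := fun _ => E → E) (ε i) (fun _ => ε l) j e) *
            inChart x (τ l) e v := by
      intro e
      simp only [hb]
      rw [ContinuousAlternatingMap.sub_apply, ContinuousAlternatingMap.sum_apply]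
      congr 1
      · refine congrArg (inChart x η e) ?_
        funext j; fin_cases j <;> rfl
      · refine Finset.sum_congr rfl fun l _ => ?_
        rw [ContinuousAlternatingMap.smul_apply, smul_eq_mul]
        congr 2
        refine congrArg (inChart x η e) ?_
        funext j; fin_cases j <;> rfl
    simp_rw [e1]
    refine ContDiffAt.sub (hηc.alternating_apply fun j => ?_) (ContDiffAt.sum fun l _ =>
      (contDiffAt_const.mul (hηc.alternating_apply fun j => ?_)).mul
        (contDiffAt_alternating_iff.1 (h2 l) v))
    · refine Fin.cases ?_ (fun j => ?_) j
      · exact hεs i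
      · exact contDiffAt_const
    · refine Fin.cases ?_ (fun j => ?_) j
      · exact hεs i
      · exact hεs l
  · have h5 := two_form_expansion (fun i => inChart x (τ i) (chartAt E x z))
      (fun i => ε i (chartAt E x z)) (fun i j => by
        rw [← hΩ, h1.2]
        simp [Pi.single_apply]) (inChart x η (chartAt E x z)) (hvan _ h4 h3.2)
    rw [← inChart_comp_chart h4 η, h5]
    refine (sum_wedge_comp _ _ _).trans (Finset.sum_congr rfl fun i _ => ?_)
    exact congrArg (fun w => wedge w (ofChart x (b i) z)) (inChart_comp_chart h4 (τ i))

end Subbundles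

section Lift

variable {E : Type*} [NormedAddCommGroup E] [NormedSpace ℝ E]
  {M : Type*} [TopologicalSpace M] [ChartedSpace E M] [IsManifold 𝓘(ℝ, E) ∞ M]
  {E' : Type*} [NormedAddCommGroup E'] [NormedSpace ℝ E']
  {N : Type*} [TopologicalSpace N] [ChartedSpace E' N] [IsManifold 𝓘(ℝ, E') ∞ N] {k l : ℕ}
  [FiniteDimensional ℝ E] [FiniteDimensional ℝ E']

/-! ### Horizontal lifts -/

theorem bundlePullback_wedge (f : N → M)
    (A : ∀ y, TangentSpace 𝓘(ℝ, E') y →L[ℝ] TangentSpace 𝓘(ℝ, E) (f y)) (α : DForm E M k)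
    (β : DForm E M l) : bundlePullback f A (wedgeForm α β) =
      wedgeForm (bundlePullback f A α) (bundlePullback f A β) :=
  funext fun _ => wedge_comp _ _ _

theorem SmoothAt.bundlePullback {f : N → M}
    {A : ∀ y, TangentSpace 𝓘(ℝ, E') y →L[ℝ] TangentSpace 𝓘(ℝ, E) (f y)} {w : DForm E M k} {y : N}
    {c : N} {c' : M} (hw : SmoothAt w (f y)) (hf : ContMDiffAt 𝓘(ℝ, E') 𝓘(ℝ, E) ∞ f y)
    (hy : y ∈ (chartAt E' c).source) (hy' : f y ∈ (chartAt E c').source)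
    (hA : ContDiffAt ℝ ∞ (bundleRep c c' f A) (chartAt E' c y)) :
    SmoothAt (E := E') (M := N) (DarbouxReduction.bundlePullback f A w) y :=
  (smoothAt_iff hy).2 (contDiffAt_inChart_bundlePullback hy hf hy' hA ((smoothAt_iff hy').1 hw))

theorem isInvertible_mfderiv_chart {c x : M} (hx : x ∈ (chartAt E c).source) :
    (mfderiv 𝓘(ℝ, E) 𝓘(ℝ, E) (chartAt E c) x).IsInvertible :=
  ⟨(mdifferentiable_chart (I := 𝓘(ℝ, E)) c).mfderiv hx, rfl⟩

theorem mfderiv_chart_injective {c x : M} (hx : x ∈ (chartAt E c).source) :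
    Function.Injective (mfderiv 𝓘(ℝ, E) 𝓘(ℝ, E) (chartAt E c) x) :=
  (isInvertible_mfderiv_chart hx).injective

theorem isInvertible_of_injective {V W : Type*} [NormedAddCommGroup V] [NormedSpace ℝ V]
    [NormedAddCommGroup W] [NormedSpace ℝ W] [FiniteDimensional ℝ V] [FiniteDimensional ℝ W]
    {L : V →L[ℝ] W} (hL : ∀ v, L v = 0 → v = 0)
    (hd : Module.finrank ℝ V = Module.finrank ℝ W) : L.IsInvertible := by
  have hinj : Function.Injective L.toLinearMap := (injective_iff_map_eq_zero _).2 hL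
  refine ⟨(LinearMap.linearEquivOfInjective L.toLinearMap hinj hd).toContinuousLinearEquiv, ?_⟩
  ext v
  rfl

theorem mfderiv_congr_point {F : Type*} [NormedAddCommGroup F] [NormedSpace ℝ F] {f : M → F}
    {x x' : M} (h : x' = x) (v : E) :
    (mfderiv 𝓘(ℝ, E) 𝓘(ℝ, F) f x' v : F) = (mfderiv 𝓘(ℝ, E) 𝓘(ℝ, F) f x v : F) := by
  subst h; rfl

/-- Given a local section `ξ` of a submersion `q` and one-forms `σ` restricting to a basis of
one-forms on the fibres, the lift of tangent vectors along `ξ` to the common kernel of the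
forms `σ`. -/
theorem exists_horizontal_lift {ι : Type*} [Fintype ι] {q : M → N} {ξ : N → M} {y₀ : N}
    (hq : ContMDiff 𝓘(ℝ, E) 𝓘(ℝ, E') ∞ q)
    (hξ : ∀ᶠ y in 𝓝 y₀, ContMDiffAt 𝓘(ℝ, E') 𝓘(ℝ, E) ∞ ξ y ∧ q (ξ y) = y)
    {σ : ι → DForm E M 1} (hσ : ∀ᶠ x in 𝓝 (ξ y₀), ∀ i, SmoothAt (σ i) x)
    (hinj : ∀ v : TangentSpace 𝓘(ℝ, E) (ξ y₀), mfderiv 𝓘(ℝ, E) 𝓘(ℝ, E') q (ξ y₀) v = 0 →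
      (∀ i, σ i (ξ y₀) ![v] = 0) → v = 0)
    (hdim : Module.finrank ℝ E = Module.finrank ℝ E' + Fintype.card ι) :
    ∃ R : ∀ y, TangentSpace 𝓘(ℝ, E') y →L[ℝ] TangentSpace 𝓘(ℝ, E) (ξ y),
      ∀ᶠ y in 𝓝 y₀,
        (∀ u : E', (mfderiv 𝓘(ℝ, E) 𝓘(ℝ, E') q (ξ y) (R y u) : E') = u) ∧
        (∀ i, ∀ u : TangentSpace 𝓘(ℝ, E') y, σ i (ξ y) ![R y u] = 0) ∧
        ∀ (k : ℕ) (w : DForm E M k), SmoothAt w (ξ y) →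
          SmoothAt (E := E') (M := N) (bundlePullback ξ R w) y := by
  have hy₀ := mem_chart_source E' y₀
  set ψ := chartAt E' y₀
  have hx₀ := mem_chart_source E (ξ y₀)
  set φ := chartAt E (ξ y₀)
  set X : E' → E := φ ∘ ξ ∘ ψ.symm
  set Q : E → E' := ψ ∘ q ∘ φ.symm
  set Sg : E' → E →L[ℝ] (ι → ℝ) := fun e => ContinuousLinearMap.pi fun i =>
    (ContinuousAlternatingMap.ofSubsingleton ℝ E ℝ (0 : Fin 1)).symm
      (inChart (ξ y₀) (σ i) (X e)) with hSdef
  have hSg : ∀ e v i, Sg e v i = inChart (ξ y₀) (σ i) (X e) ![v] := by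
    intro e v i
    refine congrArg (inChart (ξ y₀) (σ i) (X e)) ?_
    funext j; fin_cases j; rfl
  -- In coordinates, dq together with the σ. The dimension hypothesis makes it a square system, and
  -- the fibre coframe condition makes it injective at the base point, so it stays invertible
  -- nearby; the lift of u solves D = (u, 0).
  set D : E' → E →L[ℝ] (E' × (ι → ℝ)) := fun e => (fderiv ℝ Q (X e)).prod (Sg e)
  have hξc : ContinuousAt ξ y₀ := hξ.self_of_nhds.1.continuousAt
  have hξs : ∀ᶠ y in 𝓝 y₀, ξ y ∈ φ.source := hξc.eventually (eventually_chart_source hx₀)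
  have hξσ : ∀ᶠ y in 𝓝 y₀, ∀ i, SmoothAt (σ i) (ξ y) := hξc.eventually hσ
  have hgood : ∀ᶠ y in 𝓝 y₀, (ContMDiffAt 𝓘(ℝ, E') 𝓘(ℝ, E) ∞ ξ y ∧ q (ξ y) = y) ∧
      ξ y ∈ φ.source ∧ (∀ i, SmoothAt (σ i) (ξ y)) ∧ y ∈ ψ.source := by
    filter_upwards [hξ, hξs, hξσ, eventually_chart_source hy₀] with y h1 h2 h3 h4
      using ⟨h1, h2, h3, h4⟩
  have hXψ : ∀ {y}, y ∈ ψ.source → X (ψ y) = φ (ξ y) := by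
    intro y hy
    simp [X, ψ.left_inv hy]
  have hDs : ∀ᶠ y in 𝓝 y₀, ContDiffAt ℝ ∞ D (ψ y) := by
    filter_upwards [hgood] with y ⟨⟨h1, h2⟩, h3, h4, h5⟩
    have hX : ContDiffAt ℝ ∞ X (ψ y) := contDiffAt_coord h5 h1 h3
    have hQ : ContDiffAt ℝ ∞ Q (X (ψ y)) := by
      rw [hXψ h5]
      exact contDiffAt_coord h3 hq.contMDiffAt (by rw [h2]; exact h5)
    have hQ' : ContDiffAt ℝ ∞ (fun e => fderiv ℝ Q (X e)) (ψ y) :=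
      ContDiffAt.comp (ψ y) (hQ.fderiv_right (m := ∞) (by simp)) hX
    refine contDiffAt_clm_of_apply fun v => ContDiffAt.prodMk (hQ'.clm_apply contDiffAt_const)
      (contDiffAt_pi.2 fun i => ?_)
    have h7 : (fun e => Sg e v i) = fun e => inChart (ξ y₀) (σ i) (X e) ![v] :=
      funext fun e => hSg e v i
    change ContDiffAt ℝ ∞ (fun e => Sg e v i) (ψ y)
    rw [h7]
    have h6 : ContDiffAt ℝ ∞ (inChart (ξ y₀) (σ i)) (X (ψ y)) := by
      rw [hXψ h5]
      exact (smoothAt_iff h3).1 (h4 i)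
    exact contDiffAt_alternating_iff.1 (ContDiffAt.comp (ψ y) h6 hX) _
  have hDv : ∀ᶠ y in 𝓝 y₀, ∀ v : TangentSpace 𝓘(ℝ, E) (ξ y),
      D (ψ y) (mfderiv 𝓘(ℝ, E) 𝓘(ℝ, E) φ (ξ y) v) =
        ((mfderiv 𝓘(ℝ, E') 𝓘(ℝ, E') ψ y (mfderiv 𝓘(ℝ, E) 𝓘(ℝ, E') q (ξ y) v : E') : E'),
          fun i => σ i (ξ y) ![v]) := by
    filter_upwards [hgood] with y ⟨⟨h1, h2⟩, h3, h4, h5⟩ v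
    refine Prod.ext ?_ ?_
    · change fderiv ℝ Q (X (ψ y)) _ = _
      rw [hXψ h5]
      refine (fderiv_coord_comp_mfderiv h3 hq.contMDiffAt (by rw [h2]; exact h5) v).trans ?_
      exact mfderiv_congr_point h2 _
    · funext i
      refine (hSg (ψ y) _ i).trans ?_
      refine (congrArg (fun e => inChart (ξ y₀) (σ i) e ![_]) (hXψ h5)).trans ?_
      refine Eq.trans ?_ (inChart_chart_apply h3 (σ i) ![v]).symm
      refine congrArg (inChart (ξ y₀) (σ i) (φ (ξ y))) ?_
      funext j; fin_cases j; rfl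
  have hD0 : (D (ψ y₀)).IsInvertible := by
    refine isInvertible_of_injective (fun v hv => ?_) (by simp [hdim])
    obtain ⟨w, rfl⟩ := (isInvertible_mfderiv_chart hx₀).surjective v
    have h1 := hDv.self_of_nhds w
    have h2 : D (ψ y₀) (mfderiv 𝓘(ℝ, E) 𝓘(ℝ, E) φ (ξ y₀) w) = 0 := hv
    rw [h2] at h1
    have h3 : w = 0 := by
      refine hinj w ?_ fun i => ?_
      · exact mfderiv_chart_injective hy₀ ((Prod.ext_iff.1 h1).1.symm.trans (map_zero _).symm)
      · exact (congrFun (Prod.ext_iff.1 h1).2 i).symm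
    rw [h3]
    exact map_zero _
  have hDinv : ∀ᶠ y in 𝓝 y₀, (D (ψ y)).IsInvertible :=
    eventually_of_coord hy₀ (eventually_isInvertible hDs.self_of_nhds.continuousAt hD0)
  set R : ∀ y, TangentSpace 𝓘(ℝ, E') y →L[ℝ] TangentSpace 𝓘(ℝ, E) (ξ y) := fun y =>
    (mfderiv 𝓘(ℝ, E) 𝓘(ℝ, E) φ (ξ y)).inverse ∘L
      ((D (ψ y)).inverse ∘L ContinuousLinearMap.inl ℝ E' (ι → ℝ)) ∘L
        mfderiv 𝓘(ℝ, E') 𝓘(ℝ, E') ψ y with hR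
  have hφR : ∀ y, ξ y ∈ φ.source → ∀ u, mfderiv 𝓘(ℝ, E) 𝓘(ℝ, E) φ (ξ y) (R y u) =
      (D (ψ y)).inverse (mfderiv 𝓘(ℝ, E') 𝓘(ℝ, E') ψ y u, 0) := fun y hy u =>
    (isInvertible_mfderiv_chart hy).self_apply_inverse _
  refine ⟨R, ?_⟩
  have hDn : ∀ᶠ y in 𝓝 y₀, ∀ᶠ y' in 𝓝 y, ξ y' ∈ φ.source := eventually_eventually_nhds.2 hξs
  filter_upwards [hgood, hDs, hDv, hDinv, hDn] with y ⟨⟨h1, h2⟩, h3, h4, h5⟩ h6 h7 h8 h9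
  have hDR : ∀ u : TangentSpace 𝓘(ℝ, E') y, ((mfderiv 𝓘(ℝ, E') 𝓘(ℝ, E') ψ y
      (mfderiv 𝓘(ℝ, E) 𝓘(ℝ, E') q (ξ y) (R y u) : E') : E'),
      fun i => σ i (ξ y) ![R y u]) =
      ((mfderiv 𝓘(ℝ, E') 𝓘(ℝ, E') ψ y u, 0) : E' × (ι → ℝ)) := by
    intro u
    rw [← h7 (R y u), hφR y h3 u]
    exact h8.self_apply_inverse _
  refine ⟨fun u => ?_, fun i u => ?_, fun k w hw => ?_⟩
  · exact mfderiv_chart_injective h5 (Prod.ext_iff.1 (hDR u)).1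
  · exact congrFun (Prod.ext_iff.1 (hDR u)).2 i
  · refine hw.bundlePullback h1 h5 h3 ?_
    have h10 : ContDiffAt ℝ ∞ (fun e => (D e).inverse ∘L ContinuousLinearMap.inl ℝ E' (ι → ℝ))
        (ψ y) := by
      have := FiniteDimensional.complete ℝ E
      exact (ContDiffAt.comp (ψ y) (g := ContinuousLinearMap.inverse) h8.contDiffAt_map_inverse
        h6).clm_comp contDiffAt_const
    refine h10.congr_of_eventuallyEq ?_
    filter_upwards [eventually_chart_target h5, eventually_coord h5 h9] with e he1 he2
    ext u
    refine (hφR _ he2 _).trans ?_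
    exact congrArg₂ (fun a b => (D a).inverse (b, (0 : ι → ℝ))) (ψ.right_inv he1)
      (mfderiv_chart_symm he1 u)

end Lift

/-! ### Images of maps of constant rank -/

section ConstantRank

variable {V : Type*} [NormedAddCommGroup V] [NormedSpace ℝ V] [FiniteDimensional ℝ V]
  {K : Type*} [NormedAddCommGroup K] [NormedSpace ℝ K] [FiniteDimensional ℝ K]

/-- The constant rank theorem in the form needed: near g₀ the map factors through a C¹ map defined
on a ball of dimension r, and such a map does not raise Hausdorff dimension. -/
theorem exists_dimH_image_le_of_constant_rank {h : V → K} {g₀ : V} {r : ℕ}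
    (hh : ∀ᶠ g in 𝓝 g₀, ContDiffAt ℝ 1 h g)
    (hr : ∀ᶠ g in 𝓝 g₀, Module.finrank ℝ (LinearMap.range (fderiv ℝ h g).toLinearMap) = r) :
    ∃ N ∈ 𝓝 g₀, dimH (h '' N) ≤ r := by
  have := FiniteDimensional.complete ℝ V
  set A := LinearMap.range (fderiv ℝ h g₀).toLinearMap
  set B := LinearMap.ker (fderiv ℝ h g₀).toLinearMap
  obtain ⟨π', hπ'⟩ := A.subtype.exists_leftInverse_of_injective A.ker_subtype
  obtain ⟨p', hp'⟩ := B.subtype.exists_leftInverse_of_injective B.ker_subtype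
  set π : K →L[ℝ] A := LinearMap.toContinuousLinearMap π'
  set p : V →L[ℝ] B := LinearMap.toContinuousLinearMap p'
  have hπ : ∀ a : A, π a = a := fun a => LinearMap.congr_fun hπ' a
  have hp : ∀ b : B, p b = b := fun b => LinearMap.congr_fun hp' b
  have hA : Module.finrank ℝ A = r := hr.self_of_nhds
  -- Local coordinates adapted to h: the component of h along the range of its differential at g₀,
  -- and a projection to the kernel.
  set F : V → A × B := fun g => (π (h g), p g) with hFdef
  have hF : ∀ᶠ g in 𝓝 g₀, ContDiffAt ℝ 1 F g := by
    filter_upwards [hh] with g hg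
    exact (π.contDiff.contDiffAt.comp g hg).prodMk p.contDiff.contDiffAt
  have hF' : ∀ {g}, ContDiffAt ℝ 1 h g →
      fderiv ℝ F g = (π ∘L fderiv ℝ h g).prod p := by
    intro g hg
    have h1 := hg.differentiableAt one_ne_zero
    exact ((π.hasFDerivAt.comp g h1.hasFDerivAt).prodMk p.hasFDerivAt).fderiv
  have hinv : (fderiv ℝ F g₀).IsInvertible := by
    refine isInvertible_of_injective (fun v hv => ?_) ?_
    · rw [hF' hh.self_of_nhds] at hv
      have h1 : π (fderiv ℝ h g₀ v) = 0 := (Prod.ext_iff.1 hv).1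
      have h2 : p v = 0 := (Prod.ext_iff.1 hv).2
      have h3 : fderiv ℝ h g₀ v = 0 := by
        have := hπ ⟨fderiv ℝ h g₀ v, v, rfl⟩
        rw [h1] at this
        exact (congrArg Subtype.val this).symm
      have h4 := hp ⟨v, h3⟩
      rw [h2] at h4
      exact (congrArg Subtype.val h4).symm
    · rw [Module.finrank_prod]
      exact ((fderiv ℝ h g₀).toLinearMap.finrank_range_add_finrank_ker).symm
  obtain ⟨L, hL⟩ := hinv
  have hstrict : HasStrictFDerivAt F (L : V →L[ℝ] A × B) g₀ := by
    rw [hL]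
    exact hF.self_of_nhds.hasStrictFDerivAt one_ne_zero
  set e := hstrict.toOpenPartialHomeomorph F
  have heF : ∀ g, e g = F g := fun g => rfl
  have hg₀ : g₀ ∈ e.source := hstrict.mem_toOpenPartialHomeomorph_source
  have hsymm₀ : e.symm (F g₀) = g₀ := e.left_inv hg₀
  have htend : Filter.Tendsto e.symm (𝓝 (F g₀)) (𝓝 g₀) := by
    have := e.continuousAt_symm (e.map_source hg₀)
    rw [ContinuousAt, heF, hsymm₀] at this
    exact this
  have hinv' : ∀ᶠ g in 𝓝 g₀, (fderiv ℝ F g).IsInvertible :=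
    eventually_isInvertible
      ((hF.self_of_nhds.fderiv_right (m := 0) (by simp)).continuousAt) ⟨L, hL⟩
  set Ψ : A × B → K := fun z => h (e.symm z)
  have hgood : ∀ᶠ z in 𝓝 (F g₀), z ∈ e.target ∧ ContDiffAt ℝ 1 Ψ z ∧
      ∀ k : B, fderiv ℝ Ψ z (0, k) = 0 := by
    filter_upwards [e.open_target.eventually_mem (e.map_source hg₀), htend.eventually hh,
      htend.eventually hF, htend.eventually hinv', htend.eventually hr] with z hz h1 h2 h3 h4
    obtain ⟨L', hL'⟩ := h3
    have hd : HasFDerivAt F (L' : V →L[ℝ] A × B) (e.symm z) := by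
      rw [hL']
      exact (h2.differentiableAt one_ne_zero).hasFDerivAt
    have hs : ContDiffAt ℝ 1 e.symm z := e.contDiffAt_symm hz hd h2
    have hs' : HasFDerivAt e.symm (L'.symm : A × B →L[ℝ] V) z := e.hasFDerivAt_symm hz hd
    have hΨ : ContDiffAt ℝ 1 Ψ z := h1.comp z hs
    have hΨ' : fderiv ℝ Ψ z = (fderiv ℝ h (e.symm z)) ∘L (L'.symm : A × B →L[ℝ] V) :=
      ((h1.differentiableAt one_ne_zero).hasFDerivAt.comp z hs').fderiv
    refine ⟨hz, hΨ, fun k => ?_⟩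
    have hπL : ∀ x : A × B, π (fderiv ℝ h (e.symm z) (L'.symm x)) = x.1 := by
      intro x
      have := L'.apply_symm_apply x
      have h5 : (L' : V →L[ℝ] A × B) (L'.symm x) = x := this
      rw [hL', hF' h1] at h5
      exact congrArg Prod.fst h5
    -- The rank at the nearby point is still dim A, so π, being onto A, is injective on the range
    -- there. Vectors (0, k) have image in ker π, hence h does not vary in the B-direction.
    set ρ := π.toLinearMap.domRestrict (LinearMap.range (fderiv ℝ h (e.symm z)).toLinearMap)
    have hρs : Function.Surjective ρ := fun a =>
      ⟨⟨_, L'.symm (a, 0), rfl⟩, hπL (a, 0)⟩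
    have hρi : Function.Injective ρ :=
      (LinearMap.injective_iff_surjective_of_finrank_eq_finrank (by rw [h4, hA])).2 hρs
    have h6 : (⟨_, L'.symm (0, k), rfl⟩ :
        LinearMap.range (fderiv ℝ h (e.symm z)).toLinearMap) = 0 :=
      hρi ((hπL (0, k)).trans (map_zero ρ).symm)
    rw [hΨ']
    exact congrArg Subtype.val h6
  obtain ⟨ε, hε, hball⟩ := Metric.eventually_nhds_iff_ball.1 hgood
  have hprod : ∀ {a : A} {b : B}, a ∈ Metric.ball (F g₀).1 ε → b ∈ Metric.ball (F g₀).2 ε →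
      (a, b) ∈ Metric.ball (F g₀) ε := by
    intro a b ha hb
    rw [← Prod.mk.eta (p := F g₀), ← ball_prod_same]
    exact ⟨ha, hb⟩
  have hb₀ : (F g₀).2 ∈ Metric.ball (F g₀).2 ε := Metric.mem_ball_self hε
  have hconst : ∀ {a : A} {b : B}, a ∈ Metric.ball (F g₀).1 ε → b ∈ Metric.ball (F g₀).2 ε →
      Ψ (a, b) = Ψ (a, (F g₀).2) := by
    intro a b ha hb
    have hder : ∀ b ∈ Metric.ball (F g₀).2 ε,
        HasFDerivAt (fun b => Ψ (a, b)) (0 : B →L[ℝ] K) b := by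
      intro b hb
      obtain ⟨-, h1, h2⟩ := hball _ (hprod ha hb)
      have h3 : HasFDerivAt (fun b : B => (a, b)) (ContinuousLinearMap.inr ℝ A B) b :=
        hasFDerivAt_prodMk_right a b
      have h4 := ((h1.differentiableAt one_ne_zero).hasFDerivAt).comp b h3
      have h5 : fderiv ℝ Ψ (a, b) ∘L ContinuousLinearMap.inr ℝ A B = 0 := by
        ext k
        exact h2 k
      rw [h5] at h4
      exact h4
    exact Metric.isOpen_ball.is_const_of_fderiv_eq_zero
      (convex_ball (F g₀).2 ε).isPreconnected
      (fun b hb => (hder b hb).differentiableAt.differentiableWithinAt)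
      (fun b hb => (hder b hb).fderiv) hb hb₀
  refine ⟨e.source ∩ F ⁻¹' Metric.ball (F g₀) ε, Filter.inter_mem (e.open_source.mem_nhds hg₀)
    (hF.self_of_nhds.continuousAt.preimage_mem_nhds (Metric.ball_mem_nhds _ hε)), ?_⟩
  have hsub : h '' (e.source ∩ F ⁻¹' Metric.ball (F g₀) ε) ⊆
      (fun a => Ψ (a, (F g₀).2)) '' Metric.ball (F g₀).1 ε := by
    rintro _ ⟨g, ⟨hg, hgb⟩, rfl⟩
    have hgb' : F g ∈ Metric.ball (F g₀) ε := hgb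
    rw [← Prod.mk.eta (p := F g₀), ← ball_prod_same] at hgb'
    refine ⟨(F g).1, hgb'.1, ?_⟩
    have h1 := hconst hgb'.1 hgb'.2
    refine h1.symm.trans ?_
    exact congrArg h (e.left_inv hg)
  have hcd : ContDiffOn ℝ 1 (fun a => Ψ (a, (F g₀).2)) (Metric.ball (F g₀).1 ε) := by
    intro a ha
    have h1 := (hball _ (hprod ha hb₀)).2.1
    exact (ContDiffAt.comp a (f := fun a : A => (a, (F g₀).2)) h1
      (contDiffAt_id.prodMk contDiffAt_const)).contDiffWithinAt
  calc dimH (h '' (e.source ∩ F ⁻¹' Metric.ball (F g₀) ε))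
      ≤ dimH ((fun a => Ψ (a, (F g₀).2)) '' Metric.ball (F g₀).1 ε) := dimH_mono hsub
    _ ≤ dimH (Metric.ball (F g₀).1 ε) :=
      hcd.dimH_image_le (convex_ball _ _) subset_rfl
    _ ≤ dimH (Set.univ : Set A) := dimH_mono (Set.subset_univ _)
    _ = r := by rw [Real.dimH_univ_eq_finrank, hA]

end ConstantRank

/-! ### Orbits of a regular action -/

theorem finrank_range_le_of_comp {V V' W W' : Type*} [AddCommGroup V] [Module ℝ V]
    [AddCommGroup V'] [Module ℝ V'] [AddCommGroup W] [Module ℝ W] [AddCommGroup W'] [Module ℝ W']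
    [FiniteDimensional ℝ W'] {A : V →ₗ[ℝ] W} {L : V' → V} {B : V' →ₗ[ℝ] W'}
    {C : W' →ₗ[ℝ] W} (hL : Function.Surjective L) (h : ∀ v, A (L v) = C (B v)) :
    Module.finrank ℝ (LinearMap.range A) ≤ Module.finrank ℝ (LinearMap.range B) := by
  have : LinearMap.range A ≤ (LinearMap.range B).map C := by
    rintro _ ⟨v, rfl⟩
    obtain ⟨v, rfl⟩ := hL v
    exact ⟨B v, ⟨v, rfl⟩, (h v).symm⟩
  exact (Submodule.finrank_mono this).trans (Submodule.finrank_map_le C _)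

section Orbit

variable {E : Type*} [NormedAddCommGroup E] [NormedSpace ℝ E] [FiniteDimensional ℝ E]
    {M : Type*} [TopologicalSpace M] [ChartedSpace E M] [IsManifold 𝓘(ℝ, E) ∞ M]
    {E' : Type*} [NormedAddCommGroup E'] [NormedSpace ℝ E'] [FiniteDimensional ℝ E']
    {N : Type*} [TopologicalSpace N] [ChartedSpace E' N] [IsManifold 𝓘(ℝ, E') ∞ N]
    {EG : Type*} [NormedAddCommGroup EG] [NormedSpace ℝ EG] [FiniteDimensional ℝ EG]
    {G : Type*} [TopologicalSpace G] [ChartedSpace EG G] [Group G] [LieGroup 𝓘(ℝ, EG) ∞ G]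
    [MulAction G M]

theorem contMDiff_orbit
    (hs : ContMDiff (𝓘(ℝ, EG).prod 𝓘(ℝ, E)) 𝓘(ℝ, E) ∞ (fun p : G × M => p.1 • p.2)) (x : M) :
    ContMDiff 𝓘(ℝ, EG) 𝓘(ℝ, E) ∞ (fun g : G => g • x) :=
  hs.comp (contMDiff_id.prodMk contMDiff_const)

theorem contMDiff_translation
    (hs : ContMDiff (𝓘(ℝ, EG).prod 𝓘(ℝ, E)) 𝓘(ℝ, E) ∞ (fun p : G × M => p.1 • p.2)) (g : G) :
    ContMDiff 𝓘(ℝ, E) 𝓘(ℝ, E) ∞ (fun x : M => g • x) :=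
  hs.comp (contMDiff_const.prodMk contMDiff_id)

theorem mfderiv_congr_fun {f f' : N → M} (h : f = f') (x : N) (v : TangentSpace 𝓘(ℝ, E') x) :
    (mfderiv 𝓘(ℝ, E') 𝓘(ℝ, E) f x v : E) = (mfderiv 𝓘(ℝ, E') 𝓘(ℝ, E) f' x v : E) := by
  subst h; rfl

theorem mfderiv_congr_of_eq {f : N → M} {x x' : N} (h : x = x') (v : E') :
    (mfderiv 𝓘(ℝ, E') 𝓘(ℝ, E) f x v : E) = (mfderiv 𝓘(ℝ, E') 𝓘(ℝ, E) f x' v : E) := by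
  subst h; rfl

/-- The differential of the orbit map, as a map of model spaces. -/
def orbitDeriv (EG : Type*) [NormedAddCommGroup EG] [NormedSpace ℝ EG] (E : Type*)
    [NormedAddCommGroup E] [NormedSpace ℝ E] {M : Type*} [TopologicalSpace M] [ChartedSpace E M]
    {G : Type*} [TopologicalSpace G] [ChartedSpace EG G] [Group G] [MulAction G M] (x : M) (g : G) :
    EG →ₗ[ℝ] E :=
  (mfderiv 𝓘(ℝ, EG) 𝓘(ℝ, E) (fun g : G => g • x) g : EG →L[ℝ] E).toLinearMap

/-- Differentiate (a h) • x = a • (h • x). Left translation by a has a surjective differential, so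
the rank at a g cannot exceed the rank at g. -/
theorem finrank_range_orbitDeriv_mul_le
    (hs : ContMDiff (𝓘(ℝ, EG).prod 𝓘(ℝ, E)) 𝓘(ℝ, E) ∞ (fun p : G × M => p.1 • p.2))
    (x : M) (a g : G) :
    Module.finrank ℝ (LinearMap.range (orbitDeriv EG E x (a * g))) ≤
      Module.finrank ℝ (LinearMap.range (orbitDeriv EG E x g)) := by
  have hmul : ∀ b : G, MDifferentiable 𝓘(ℝ, EG) 𝓘(ℝ, EG) (fun h : G => b * h) := fun b =>
    (contMDiff_mul_left (I := 𝓘(ℝ, EG)) (n := ∞) (a := b)).mdifferentiable (by simp)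
  have horb : MDifferentiable 𝓘(ℝ, EG) 𝓘(ℝ, E) (fun h : G => h • x) :=
    (contMDiff_orbit hs x).mdifferentiable (by simp)
  have htr : MDifferentiable 𝓘(ℝ, E) 𝓘(ℝ, E) (fun z : M => a • z) :=
    (contMDiff_translation hs a).mdifferentiable (by simp)
  set L : EG →L[ℝ] EG := mfderiv 𝓘(ℝ, EG) 𝓘(ℝ, EG) (fun h : G => a * h) g
  have hL : Function.Surjective L := by
    intro v
    refine ⟨(mfderiv 𝓘(ℝ, EG) 𝓘(ℝ, EG) (fun h : G => a⁻¹ * h) (a * g) : EG →L[ℝ] EG) v, ?_⟩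
    have h1 := mfderiv_comp_of_eq (f := fun h : G => a⁻¹ * h) (g := fun h : G => a * h)
      (x := a * g) (y := g) (hmul a g) (hmul a⁻¹ (a * g)) (by simp)
    have h2 : (fun h : G => a * h) ∘ (fun h : G => a⁻¹ * h) = id := by
      funext h; simp
    have h3 := mfderiv_congr_fun (E := EG) (E' := EG) h2 (a * g) v
    rw [h1, mfderiv_id] at h3
    exact (mfderiv_congr_of_eq (inv_mul_cancel_left a g).symm _).trans h3
  refine finrank_range_le_of_comp (B := orbitDeriv EG E x g)
    (C := (mfderiv 𝓘(ℝ, E) 𝓘(ℝ, E) (fun z : M => a • z) (g • x) : E →L[ℝ] E).toLinearMap) hL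
    fun v => ?_
  have h1 := mfderiv_comp g (f := fun h : G => a * h) (g := fun h : G => h • x)
    (horb (a * g)) (hmul a g)
  have h2 := mfderiv_comp g (f := fun h : G => h • x) (g := fun z : M => a • z)
    (htr (g • x)) (horb g)
  have h3 : (fun h : G => h • x) ∘ (fun h : G => a * h) =
      (fun z : M => a • z) ∘ fun h : G => h • x := by
    funext h; exact mul_smul a h x
  have h4 := mfderiv_congr_fun (E := E) (E' := EG) h3 g v
  rw [h1, h2] at h4
  exact h4

theorem finrank_range_orbitDeriv
    (hs : ContMDiff (𝓘(ℝ, EG).prod 𝓘(ℝ, E)) 𝓘(ℝ, E) ∞ (fun p : G × M => p.1 • p.2))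
    (x : M) (g : G) :
    Module.finrank ℝ (LinearMap.range (orbitDeriv EG E x g)) =
      Module.finrank ℝ (LinearMap.range (orbitDeriv EG E x (1 : G))) := by
  refine le_antisymm ?_ ?_
  · have h := finrank_range_orbitDeriv_mul_le hs x g 1
    rwa [show g * 1 = g from mul_one g] at h
  · have h := finrank_range_orbitDeriv_mul_le hs x g⁻¹ g
    rwa [show g⁻¹ * g = 1 from inv_mul_cancel g] at h

theorem mfderiv_orbitDeriv
    (hs : ContMDiff (𝓘(ℝ, EG).prod 𝓘(ℝ, E)) 𝓘(ℝ, E) ∞ (fun p : G × M => p.1 • p.2))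
    {q : M → N} (hq : IsRegularQuotient (E := E) (E' := E') G q) (x : M) (g : G) (v : EG) :
    (mfderiv 𝓘(ℝ, E) 𝓘(ℝ, E') q (g • x) (orbitDeriv EG E x g v : E) : E') = 0 := by
  have h1 := mfderiv_comp g (f := fun h : G => h • x) (g := q)
    (hq.smooth.mdifferentiable (by simp) (g • x))
    ((contMDiff_orbit hs x).mdifferentiable (by simp) g)
  have h2 : q ∘ (fun h : G => h • x) = fun _ => q x := by
    funext h; exact ((hq.fibre_eq_orbit x (h • x)).2 ⟨h, rfl⟩).symm
  have h3 := mfderiv_congr_fun (E := E') (E' := EG) h2 g v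
  rw [h1, mfderiv_const] at h3
  exact h3

/-- Countably many of the neighbourhoods cover s, and the Hausdorff dimension of a countable union
is the supremum of the dimensions. -/
theorem dimH_image_le_of_forall_nhds {X K : Type*} [TopologicalSpace X] [SecondCountableTopology X]
    [EMetricSpace K] {h : X → K} {s : Set X} {r : ENNReal}
    (H : ∀ x ∈ s, ∃ t ∈ 𝓝 x, dimH (h '' t) ≤ r) : dimH (h '' s) ≤ r := by
  choose! t ht hd using H
  obtain ⟨u, hu, huc, hsu⟩ := TopologicalSpace.countable_cover_nhdsWithin (s := s) (f := t)
    fun x hx => mem_nhdsWithin_of_mem_nhds (ht x hx)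
  refine (dimH_mono (Set.image_mono hsu)).trans ?_
  rw [Set.image_iUnion₂, dimH_bUnion huc]
  exact iSup₂_le fun x hx => hd x (hu hx)

/-- The tangent space of an orbit is the vertical space of the quotient map. -/
theorem ker_mfderiv_le_infGenerators [SecondCountableTopology G]
    (hs : ContMDiff (𝓘(ℝ, EG).prod 𝓘(ℝ, E)) 𝓘(ℝ, E) ∞ (fun p : G × M => p.1 • p.2))
    {q : M → N} (hq : IsRegularQuotient (E := E) (E' := E') G q) (x : M)
    (v : TangentSpace 𝓘(ℝ, E) x) (hv : mfderiv 𝓘(ℝ, E) 𝓘(ℝ, E') q x v = 0) :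
    v ∈ infGenerators (E := E) EG G x := by
  have := FiniteDimensional.complete ℝ E
  set φ := chartAt E x
  set ψ := chartAt E' (q x)
  have hx := mem_chart_source E x
  have hqx := mem_chart_source E' (q x)
  set Q : E → E' := ψ ∘ q ∘ φ.symm with hQdef
  have hQsmooth : ∀ {z}, z ∈ φ.source → q z ∈ ψ.source → ContDiffAt ℝ ∞ Q (φ z) :=
    fun hz hz' => contDiffAt_coord hz hq.smooth.contMDiffAt hz'
  have hQφ : ∀ {z}, z ∈ φ.source → Q (φ z) = ψ (q z) := by
    intro z hz
    simp [Q, φ.left_inv hz]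
  have hdQ : ∀ {z} (_ : z ∈ φ.source) (_ : q z ∈ ψ.source) (u : TangentSpace 𝓘(ℝ, E) z),
      fderiv ℝ Q (φ z) (mfderiv 𝓘(ℝ, E) 𝓘(ℝ, E) φ z u) =
        mfderiv 𝓘(ℝ, E') 𝓘(ℝ, E') ψ (q z) (mfderiv 𝓘(ℝ, E) 𝓘(ℝ, E') q z u) :=
    fun hz hz' u => fderiv_coord_comp_mfderiv hz hq.smooth.contMDiffAt hz' u
  set K := LinearMap.ker (fderiv ℝ Q (φ x)).toLinearMap
  obtain ⟨p', hp'⟩ := K.subtype.exists_leftInverse_of_injective K.ker_subtype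
  set p : E →L[ℝ] K := LinearMap.toContinuousLinearMap p'
  have hp : ∀ b : K, p b = b := fun b => LinearMap.congr_fun hp' b
  have hQsurj : Function.Surjective (fderiv ℝ Q (φ x)) := by
    intro w
    obtain ⟨w', hw'⟩ := (isInvertible_mfderiv_chart hqx).surjective w
    obtain ⟨u, hu⟩ := hq.submersion x w'
    refine ⟨mfderiv 𝓘(ℝ, E) 𝓘(ℝ, E) φ x u, (hdQ hx hqx u).trans ?_⟩
    rw [hu]
    exact hw'
  have hKdim : Module.finrank ℝ E = Module.finrank ℝ E' + Module.finrank ℝ K := by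
    have h1 := (fderiv ℝ Q (φ x)).toLinearMap.finrank_range_add_finrank_ker
    have h2 : LinearMap.range (fderiv ℝ Q (φ x)).toLinearMap = ⊤ := LinearMap.range_eq_top.2 hQsurj
    rw [h2, finrank_top] at h1
    exact h1.symm
  -- Coordinates straightening the fibres of q: Q labels the fibre, and p is the position in it.
  set H : E → E' × K := fun e => (Q e, p e)
  have hH : ∀ {e}, ContDiffAt ℝ ∞ Q e → ContDiffAt ℝ ∞ H e := fun he =>
    he.prodMk p.contDiff.contDiffAt
  have hH' : ∀ {e}, ContDiffAt ℝ ∞ Q e → fderiv ℝ H e = (fderiv ℝ Q e).prod p := fun he =>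
    ((he.differentiableAt (by simp)).hasFDerivAt.prodMk p.hasFDerivAt).fderiv
  have hinv : (fderiv ℝ H (φ x)).IsInvertible := by
    refine isInvertible_of_injective (fun v hv => ?_) (by rw [Module.finrank_prod]; exact hKdim)
    rw [hH' (hQsmooth hx hqx)] at hv
    have h1 : fderiv ℝ Q (φ x) v = 0 := (Prod.ext_iff.1 hv).1
    have h2 : p v = 0 := (Prod.ext_iff.1 hv).2
    have h3 := hp ⟨v, h1⟩
    rw [h2] at h3
    exact (congrArg Subtype.val h3).symm
  have hHx := hH (hQsmooth hx hqx)
  have hev : ∀ᶠ z in 𝓝 x, z ∈ φ.source ∧ q z ∈ ψ.source ∧ (fderiv ℝ H (φ z)).IsInvertible := by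
    filter_upwards [eventually_chart_source hx,
      hq.smooth.continuous.continuousAt.eventually (eventually_chart_source hqx),
      eventually_of_coord hx (eventually_isInvertible
        ((hHx.fderiv_right (m := 0) (by simp)).continuousAt) hinv)] with z h1 h2 h3 using ⟨h1, h2, h3⟩
  obtain ⟨U, hUsub, hUo, hxU⟩ := mem_nhds_iff.1 hev
  set O : Set G := {g | g • x ∈ U}
  set h : G → K := fun g => p (φ (g • x))
  set r := Module.finrank ℝ (LinearMap.range (orbitDeriv EG E x (1 : G)))
  have horb := contMDiff_orbit hs x
  have hOo : IsOpen O := hUo.preimage horb.continuous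
  -- The orbit map followed by p has constant rank r: orbit directions are killed by dQ and `H` has
  -- an invertible differential, so p loses nothing on them. Second countability of G passes from
  -- local images to the whole image.
  have hdim : dimH (h '' O) ≤ r := by
    refine dimH_image_le_of_forall_nhds fun g₀ hg₀ => ?_
    set c := chartAt EG g₀
    have hc := mem_chart_source EG g₀
    set f : EG → E := φ ∘ (fun g : G => g • x) ∘ c.symm
    have hfs : ∀ {g}, g ∈ c.source → g ∈ O → ContDiffAt ℝ ∞ f (c g) := fun hg hgO =>
      contDiffAt_coord hg horb.contMDiffAt (hUsub hgO).1
    have hgood : ∀ᶠ g in 𝓝 g₀, g ∈ c.source ∧ g ∈ O := by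
      filter_upwards [eventually_chart_source hc, hOo.mem_nhds hg₀] with g h1 h2 using ⟨h1, h2⟩
    have key : ∀ᶠ e in 𝓝 (c g₀), ContDiffAt ℝ 1 (p ∘ f) e ∧
        Module.finrank ℝ (LinearMap.range (fderiv ℝ (p ∘ f) e).toLinearMap) = r := by
      filter_upwards [eventually_coord hc hgood, eventually_chart_target hc] with e he het
      obtain ⟨h1, h2⟩ := he
      set g := c.symm e with hg
      have hce : c g = e := c.right_inv het
      have hf : ContDiffAt ℝ ∞ f e := hce ▸ hfs h1 h2
      have hpf : ContDiffAt ℝ 1 (p ∘ f) e :=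
        p.contDiff.contDiffAt.comp e (hf.of_le (by norm_num))
      refine ⟨hpf, ?_⟩
      have hder : fderiv ℝ (p ∘ f) e = p ∘L fderiv ℝ f e :=
        (p.hasFDerivAt.comp e (hf.differentiableAt (by simp)).hasFDerivAt).fderiv
      set Φ : E →L[ℝ] E := mfderiv 𝓘(ℝ, E) 𝓘(ℝ, E) φ (g • x)
      have hfd : ∀ u : EG, fderiv ℝ f e ((mfderiv 𝓘(ℝ, EG) 𝓘(ℝ, EG) c g : EG →L[ℝ] EG) u) =
          Φ (orbitDeriv EG E x g u) := by
        intro u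
        have := fderiv_coord_comp_mfderiv (E := E) (E' := EG) (f := fun g : G => g • x) h1
          horb.contMDiffAt (hUsub h2).1 u
        rw [hce] at this
        exact this
      have hcs : Function.Surjective (mfderiv 𝓘(ℝ, EG) 𝓘(ℝ, EG) c g : EG →L[ℝ] EG) :=
        (isInvertible_mfderiv_chart h1).surjective
      refine Eq.trans ?_ (finrank_range_orbitDeriv hs x g)
      set T := LinearMap.range (orbitDeriv EG E x g)
      have hrange : LinearMap.range (fderiv ℝ (p ∘ f) e).toLinearMap =
          T.map (p ∘L Φ).toLinearMap := by
        refine le_antisymm ?_ ?_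
        · rintro _ ⟨u, rfl⟩
          obtain ⟨u, rfl⟩ := hcs u
          refine ⟨orbitDeriv EG E x g u, ⟨u, rfl⟩, ?_⟩
          rw [hder]
          exact congrArg p (hfd u).symm
        · rintro _ ⟨_, ⟨u, rfl⟩, rfl⟩
          refine ⟨(mfderiv 𝓘(ℝ, EG) 𝓘(ℝ, EG) c g : EG →L[ℝ] EG) u, ?_⟩
          rw [hder]
          exact congrArg p (hfd u)
      rw [hrange, ← LinearMap.range_domRestrict]
      refine LinearMap.finrank_range_of_inj ((injective_iff_map_eq_zero _).2 ?_)
      rintro ⟨_, u, rfl⟩ hu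
      refine Subtype.ext ?_
      set t := orbitDeriv EG E x g u
      have h3 : p (Φ t) = 0 := hu
      have h4 : fderiv ℝ Q (φ (g • x)) (Φ t) = 0 := by
        refine (hdQ (hUsub h2).1 (hUsub h2).2.1 t).trans ?_
        refine (congrArg _ (mfderiv_orbitDeriv hs hq x g u)).trans (map_zero _)
      have h5 : fderiv ℝ H (φ (g • x)) (Φ t) = 0 := by
        rw [hH' (hQsmooth (hUsub h2).1 (hUsub h2).2.1)]
        exact Prod.ext h4 h3
      have h6 : Φ t = 0 := (hUsub h2).2.2.injective (h5.trans (map_zero _).symm)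
      exact mfderiv_chart_injective (hUsub h2).1 (h6.trans (map_zero _).symm)
    obtain ⟨S, hS, hSd⟩ := exists_dimH_image_le_of_constant_rank
      (key.mono fun _ h => h.1) (key.mono fun _ h => h.2)
    refine ⟨c.source ∩ c ⁻¹' S, Filter.inter_mem (c.open_source.mem_nhds hc)
      ((c.continuousAt hc).preimage_mem_nhds hS), (dimH_mono ?_).trans hSd⟩
    rintro _ ⟨g, ⟨hg, hgS⟩, rfl⟩
    refine ⟨c g, hgS, ?_⟩
    change p (φ ((c.symm (c g)) • x)) = _
    rw [c.left_inv hg]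
  -- Near x the whole slice of constant Q lies in one fibre of q, that is, in the orbit of x. So `h`
  -- covers a neighbourhood in K, which forces dim K ≤ r.
  have hnhds : h '' O ∈ 𝓝 (p (φ x)) := by
    obtain ⟨L, hL⟩ := hinv
    have hstrict : HasStrictFDerivAt H (L : E →L[ℝ] E' × K) (φ x) := by
      rw [hL]
      exact hHx.hasStrictFDerivAt (by simp)
    set e := hstrict.toOpenPartialHomeomorph H
    have he₀ : φ x ∈ e.source := hstrict.mem_toOpenPartialHomeomorph_source
    have heH : ∀ y, e y = H y := fun y => rfl
    have hsymm₀ : e.symm (H (φ x)) = φ x := e.left_inv he₀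
    have htend : Filter.Tendsto e.symm (𝓝 (H (φ x))) (𝓝 (φ x)) := by
      have := e.continuousAt_symm (e.map_source he₀)
      rw [ContinuousAt, heH, hsymm₀] at this
      exact this
    have hslice : Filter.Tendsto (fun b : K => (Q (φ x), b)) (𝓝 (p (φ x))) (𝓝 (H (φ x))) :=
      (Continuous.prodMk_right (Q (φ x))).continuousAt
    have h1 := (htend.comp hslice).eventually
      ((eventually_coord hx (hUo.eventually_mem hxU)).and (eventually_chart_target hx))
    have h2 := hslice.eventually (e.open_target.eventually_mem (e.map_source he₀))
    filter_upwards [h1, h2] with b hb hbt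
    set y := e.symm (Q (φ x), b)
    have hy : H y = (Q (φ x), b) := e.right_inv hbt
    obtain ⟨hyU, hyt⟩ := hb
    change φ.symm y ∈ U at hyU
    change y ∈ φ.target at hyt
    obtain ⟨hz1, hz2, -⟩ := hUsub hyU
    have h3 : Q y = Q (φ x) := (Prod.ext_iff.1 hy).1
    have h4 : ψ (q (φ.symm y)) = ψ (q x) := by
      rw [← hQφ hz1, φ.right_inv hyt, h3, hQφ hx]
    have h5 : q x = q (φ.symm y) := (ψ.injOn hz2 hqx h4).symm
    obtain ⟨g, hg⟩ := (hq.fibre_eq_orbit x (φ.symm y)).1 h5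
    refine ⟨g, ?_, ?_⟩
    · change g • x ∈ U
      rwa [hg]
    · change p (φ (g • x)) = b
      rw [hg, φ.right_inv hyt]
      exact (Prod.ext_iff.1 hy).2
  have hKr : Module.finrank ℝ K ≤ r := by
    have := Real.dimH_of_mem_nhds hnhds
    rw [this] at hdim
    exact_mod_cast hdim
  set Γ : Submodule ℝ E := infGenerators (E := E) EG G x
  have hone : (1 : G) • x = x := one_smul G x
  have hΓr : Module.finrank ℝ Γ = r := rfl
  set D : E →ₗ[ℝ] E' := (mfderiv 𝓘(ℝ, E) 𝓘(ℝ, E') q x : E →L[ℝ] E').toLinearMap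
  have hΓle : Γ ≤ LinearMap.ker D := by
    rintro _ ⟨u, rfl⟩
    have h1 := mfderiv_orbitDeriv hs hq x (1 : G) u
    exact (mfderiv_congr_of_eq hone _).symm.trans h1
  have hDdim : Module.finrank ℝ E = Module.finrank ℝ E' + Module.finrank ℝ (LinearMap.ker D) := by
    have h1 := D.finrank_range_add_finrank_ker
    have h2 : LinearMap.range D = ⊤ := LinearMap.range_eq_top.2 (hq.submersion x)
    rw [h2, finrank_top] at h1
    exact h1.symm
  -- The inclusion of the generators in the kernel holds because q is constant on orbits; the bound
  -- dim K ≤ r turns it into equality.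
  have hEq : Γ = LinearMap.ker D :=
    Submodule.eq_of_le_of_finrank_le hΓle (by omega)
  have hvD : v ∈ LinearMap.ker D := hv
  rw [← hEq] at hvD
  exact hvD

end Orbit

/-! ### Finite generation of subbundles -/

section FiniteGeneration

variable {E : Type*} [NormedAddCommGroup E] [NormedSpace ℝ E]
  {M : Type*} [TopologicalSpace M] [ChartedSpace E M] [IsManifold 𝓘(ℝ, E) ∞ M]
  [FiniteDimensional ℝ E] {k : ℕ}

theorem dimH_image_le_finrank {V K : Type*} [NormedAddCommGroup V] [NormedSpace ℝ V]
    [FiniteDimensional ℝ V] [NormedAddCommGroup K] [NormedSpace ℝ K] {f : V → K} {s : Set V}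
    (hs : IsOpen s) (hf : ∀ x ∈ s, ContDiffAt ℝ 1 f x) :
    dimH (f '' s) ≤ Module.finrank ℝ V := by
  refine dimH_image_le_of_forall_nhds fun x hx => ?_
  obtain ⟨ε, hε, hball⟩ := Metric.isOpen_iff.1 hs x hx
  refine ⟨Metric.ball x ε, Metric.ball_mem_nhds x hε, ?_⟩
  have hcd : ContDiffOn ℝ 1 f (Metric.ball x ε) := fun y hy => (hf y (hball hy)).contDiffWithinAt
  calc dimH (f '' Metric.ball x ε) ≤ dimH (Metric.ball x ε) :=
        hcd.dimH_image_le (convex_ball _ _) subset_rfl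
    _ ≤ dimH (Set.univ : Set V) := dimH_mono (Set.subset_univ _)
    _ = Module.finrank ℝ V := Real.dimH_univ_eq_finrank V

/-- The set of all tuples of values of finitely many one-forms on a tangent vector. -/
def valueSet {ι : Type*} (s : ι → DForm E M 1) : Set (ι → ℝ) :=
  {a | ∃ (y : M) (u : TangentSpace 𝓘(ℝ, E) y), ∀ i, a i = s i y ![u]}

/-- The set is a countable union of C¹ images of open subsets of E × E, one for each chart in a
countable cover. -/
theorem dimH_valueSet_le [SecondCountableTopology M] {ι : Type*} [Fintype ι] {s : ι → DForm E M 1}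
    (hs : ∀ i, Smooth (s i)) : dimH (valueSet s) ≤ (2 * Module.finrank ℝ E : ℕ) := by
  obtain ⟨t, htc, ht⟩ := TopologicalSpace.countable_cover_nhds
    (f := fun c : M => (chartAt E c).source)
    fun c => (chartAt E c).open_source.mem_nhds (mem_chart_source E c)
  set F : M → E × E → ι → ℝ := fun c p i => inChart c (s i) p.1 ![p.2]
  have hsub : valueSet s ⊆ ⋃ c ∈ t, F c '' ((chartAt E c).target ×ˢ Set.univ) := by
    rintro a ⟨y, u, ha⟩
    have hy : y ∈ ⋃ c ∈ t, (chartAt E c).source := by rw [ht]; trivial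
    obtain ⟨c, hc, hyc⟩ := Set.mem_iUnion₂.1 hy
    refine Set.mem_iUnion₂.2 ⟨c, hc, (chartAt E c y, mfderiv 𝓘(ℝ, E) 𝓘(ℝ, E) (chartAt E c) y u),
      ⟨(chartAt E c).map_source hyc, trivial⟩, ?_⟩
    funext i
    rw [ha i]
    refine Eq.trans ?_ (inChart_chart_apply hyc (s i) ![u]).symm
    refine congrArg (inChart c (s i) (chartAt E c y)) ?_
    funext j; fin_cases j; rfl
  refine (dimH_mono hsub).trans ?_
  rw [dimH_bUnion htc]
  refine iSup₂_le fun c _ => ?_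
  have h := dimH_image_le_finrank (f := F c) (s := (chartAt E c).target ×ˢ Set.univ)
    ((chartAt E c).open_target.prod isOpen_univ) ?_
  · refine h.trans ?_
    rw [Module.finrank_prod, two_mul]
  · rintro ⟨e, u⟩ ⟨he, -⟩
    refine contDiffAt_pi.2 fun i => ?_
    have h1 := (smoothAt_iff ((chartAt E c).map_target he)).1 (smooth_iff.1 (hs i) _)
    rw [(chartAt E c).right_inv he] at h1
    have h2 : ContDiffAt ℝ 1 (fun p : E × E => inChart c (s i) p.1) (e, u) :=
      ContDiffAt.comp (e, u) (g := inChart c (s i)) (f := Prod.fst) (h1.of_le (by norm_num))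
        contDiffAt_fst
    have h3 := h2.alternating_apply (v := fun (_ : Fin 1) (p : E × E) => p.2) fun _ =>
      contDiffAt_snd
    refine h3.congr_of_eventuallyEq (Filter.Eventually.of_forall fun p => ?_)
    refine congrArg (inChart c (s i) p.1) ?_
    funext j; fin_cases j; rfl

/-- A one-form as an element of the dual space. -/
def toDual {T : Type*} [AddCommGroup T] [Module ℝ T] [TopologicalSpace T] :
    (T [⋀^Fin 1]→L[ℝ] ℝ) →ₗ[ℝ] Module.Dual ℝ T where
  toFun w := ((ContinuousAlternatingMap.ofSubsingleton ℝ T ℝ (0 : Fin 1)).symm w).toLinearMap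
  map_add' _ _ := rfl
  map_smul' _ _ := rfl

theorem toDual_apply {T : Type*} [AddCommGroup T] [Module ℝ T] [TopologicalSpace T]
    (w : T [⋀^Fin 1]→L[ℝ] ℝ) (v : T) : toDual w v = w ![v] := by
  refine congrArg w ?_
  funext j; fin_cases j; rfl

theorem mem_span_of_forall_apply_eq_zero {T : Type*} [AddCommGroup T] [Module ℝ T]
    [TopologicalSpace T] {ι : Type*} [Finite ι] {τ : ι → T [⋀^Fin 1]→L[ℝ] ℝ}
    {w : T [⋀^Fin 1]→L[ℝ] ℝ} (h : ∀ u, (∀ i, τ i ![u] = 0) → w ![u] = 0) :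
    w ∈ Submodule.span ℝ (Set.range τ) := by
  have hinj : Function.Injective (toDual (T := T)) := fun w w' hww =>
    alternating_one_ext fun u => by rw [← toDual_apply, ← toDual_apply, hww]
  have h1 : toDual w ∈ Submodule.span ℝ (Set.range fun i => toDual (τ i)) := by
    refine mem_span_of_iInf_ker_le_ker fun u hu => ?_
    rw [LinearMap.mem_ker, toDual_apply]
    refine h u fun i => ?_
    rw [← toDual_apply]
    exact (Submodule.mem_iInf _).1 hu i
  rw [Set.range_comp' toDual τ, Submodule.span_image] at h1
  obtain ⟨w', hw', hww⟩ := h1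
  rwa [← hinj hww]

theorem add_neg_smul_add_smul {V : Type*} [AddCommGroup V] [Module ℝ V] (x z : V) (b : ℝ) :
    x + (-b) • z + b • z = x := by
  rw [neg_smul, neg_add_cancel_right]

/-- A generic projection, as in Whitney's embedding theorem. The value set has dimension at most 2
dim E < m + 1, so some v with nonzero last entry avoids it. Replace sᵢ by sᵢ − (vᵢ/v_last) s_last.
If a vector u killed all of these but not s_last, the values of the s on u would be proportional to
v, and a multiple of u would realise v. -/
theorem exists_span_eq_of_succ [SecondCountableTopology M] {m : ℕ}
    (hm : 2 * Module.finrank ℝ E ≤ m) {s : Fin (m + 1) → DForm E M 1} (hs : ∀ i, Smooth (s i)) :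
    ∃ s' : Fin m → DForm E M 1, (∀ i, Smooth (s' i)) ∧
      ∀ y, Submodule.span ℝ (Set.range fun i => s' i y) =
        Submodule.span ℝ (Set.range fun i => s i y) := by
  have hd : dimH (valueSet s) < Module.finrank ℝ (Fin (m + 1) → ℝ) := by
    refine (dimH_valueSet_le hs).trans_lt ?_
    rw [Module.finrank_fin_fun]
    exact_mod_cast Nat.lt_succ_of_le hm
  have hopen : IsOpen {v : Fin (m + 1) → ℝ | v (Fin.last m) ≠ 0} :=
    isOpen_ne_fun (continuous_apply _) continuous_const
  obtain ⟨v, hv0, hv⟩ := (dense_compl_of_dimH_lt_finrank hd).inter_open_nonempty _ hopen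
    ⟨fun _ => 1, one_ne_zero⟩
  set b : Fin m → ℝ := fun i => v i.castSucc / v (Fin.last m)
  have hs' : ∀ i : Fin m, ∀ y, SmoothAt (fun y => s i.castSucc y + (-b i) • s (Fin.last m) y) y :=
    fun i y => (smooth_iff.1 (hs _) y).add
      (SmoothAt.smul (f := fun _ => -b i) contMDiffAt_const (smooth_iff.1 (hs _) y))
  refine ⟨fun i y => s i.castSucc y + (-b i) • s (Fin.last m) y, fun i => smooth_iff.2 (hs' i),
    fun y => ?_⟩
  refine le_antisymm (Submodule.span_le.2 ?_) (Submodule.span_le.2 ?_)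
  · rintro _ ⟨i, rfl⟩
    exact Submodule.add_mem _ (Submodule.subset_span ⟨_, rfl⟩)
      (Submodule.smul_mem _ _ (Submodule.subset_span ⟨_, rfl⟩))
  · have hlast : s (Fin.last m) y ∈ Submodule.span ℝ
        (Set.range fun i : Fin m => s i.castSucc y + (-b i) • s (Fin.last m) y) := by
      refine mem_span_of_forall_apply_eq_zero fun u hu => ?_
      by_contra hne
      refine hv ⟨y, (v (Fin.last m) / s (Fin.last m) y ![u]) • u, fun i => ?_⟩
      rw [one_form_smul]
      refine Fin.lastCases ?_ (fun j => ?_) i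
      · field_simp
      · have h1 : s j.castSucc y ![u] + (-b j) * s (Fin.last m) y ![u] = 0 := hu j
        have h2 : s j.castSucc y ![u] = b j * s (Fin.last m) y ![u] := by linarith
        rw [h2]
        have h3 : v (Fin.last m) ≠ 0 := hv0
        simp only [b]
        field_simp
    rintro _ ⟨i, rfl⟩
    refine Fin.lastCases ?_ (fun j => ?_) i
    · exact hlast
    · have h1 := Submodule.add_mem _ (Submodule.subset_span ⟨j, rfl⟩ :
        s j.castSucc y + (-b j) • s (Fin.last m) y ∈ Submodule.span ℝ
        (Set.range fun i : Fin m => s i.castSucc y + (-b i) • s (Fin.last m) y))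
        (Submodule.smul_mem _ (b j) hlast)
      have h2 : s j.castSucc y + (-b j) • s (Fin.last m) y + b j • s (Fin.last m) y =
          s j.castSucc y := add_neg_smul_add_smul _ _ _
      rw [h2] at h1
      exact h1

theorem exists_span_eq_fin [SecondCountableTopology M] {m : ℕ}
    {s : Fin m → DForm E M 1} (hs : ∀ i, Smooth (s i)) :
    ∃ s' : Fin (2 * Module.finrank ℝ E) → DForm E M 1, (∀ i, Smooth (s' i)) ∧
      ∀ y, Submodule.span ℝ (Set.range fun i => s' i y) =
        Submodule.span ℝ (Set.range fun i => s i y) := by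
  have key : ∀ m, 2 * Module.finrank ℝ E ≤ m → ∀ s : Fin m → DForm E M 1, (∀ i, Smooth (s i)) →
      ∃ s' : Fin (2 * Module.finrank ℝ E) → DForm E M 1, (∀ i, Smooth (s' i)) ∧
      ∀ y, Submodule.span ℝ (Set.range fun i => s' i y) =
        Submodule.span ℝ (Set.range fun i => s i y) := by
    intro m hm
    induction m, hm using Nat.le_induction with
    | base => exact fun s hs => ⟨s, hs, fun _ => rfl⟩
    | succ m hm ih =>
      intro s hs
      obtain ⟨s₁, h1, h2⟩ := exists_span_eq_of_succ hm hs
      obtain ⟨s₂, h3, h4⟩ := ih s₁ h1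
      exact ⟨s₂, h3, fun y => (h4 y).trans (h2 y)⟩
  -- Padding with zero forms ensures that there are at least 2 dim E forms before the reduction
  -- starts.
  obtain ⟨s', h1, h2⟩ := key (m + 2 * Module.finrank ℝ E) (by omega)
    (Fin.append s fun _ => 0) (fun i => by
      refine Fin.addCases (fun j => ?_) (fun j => ?_) i
      · rw [Fin.append_left]; exact hs j
      · rw [Fin.append_right]; exact smooth_iff.2 smoothAt_zero)
  refine ⟨s', h1, fun y => (h2 y).trans ?_⟩
  refine le_antisymm (Submodule.span_le.2 ?_) (Submodule.span_le.2 ?_)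
  · rintro _ ⟨i, rfl⟩
    refine Fin.addCases (fun j => ?_) (fun j => ?_) i
    · exact Submodule.subset_span ⟨j, (congrFun (Fin.append_left s _ j) y).symm⟩
    · have : Fin.append s (fun _ : Fin (2 * Module.finrank ℝ E) => (0 : DForm E M 1))
          (Fin.natAdd m j) y = 0 := congrFun (Fin.append_right s _ j) y
      rw [SetLike.mem_coe]
      change Fin.append s _ (Fin.natAdd m j) y ∈ _
      rw [this]
      exact Submodule.zero_mem _
  · rintro _ ⟨j, rfl⟩
    exact Submodule.subset_span ⟨Fin.castAdd _ j, congrFun (Fin.append_left s _ j) y⟩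

/-- A local section of a field of subspaces agrees with a global one near the point. -/
theorem exists_section_extension [T2Space M] {V : CotField E M} {w : DForm E M 1} {x : M}
    (hw : ∀ᶠ z in 𝓝 x, SmoothAt w z ∧ w z ∈ V z) :
    ∃ w' : DForm E M 1, IsSection V w' ∧ ∀ᶠ z in 𝓝 x, w' z = w z := by
  classical
  -- Setting the form to zero wherever it leaves V does not change its germ at x, and afterwards
  -- every pointwise multiple is in V.
  have hcut : ∀ᶠ z in 𝓝 x, (if w z ∈ V z then w z else 0) = w z := by
    filter_upwards [hw] with z hz using if_pos hz.2
  obtain ⟨w', h1, h2, h3⟩ := exists_smooth_extension (w := fun z => if w z ∈ V z then w z else 0)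
    (x := x) (by
      filter_upwards [hw, eventually_eventually_nhds.2 hcut] with z hz hz'
      exact hz.1.congr hz')
  refine ⟨w', ⟨h1, fun z => ?_⟩, ?_⟩
  · obtain ⟨c, hc⟩ := h3 z
    rw [hc]
    refine Submodule.smul_mem _ _ ?_
    split_ifs with h
    · exact h
    · exact Submodule.zero_mem _
  · filter_upwards [h2, hcut] with z h4 h5 using h4.trans h5

theorem exists_finite_sections_of_isCompact [T2Space M] {V : CotField E M} (hV : IsSubbundle V)
    {K : Set M} (hK : IsCompact K) :
    ∃ S : Set (DForm E M 1), S.Finite ∧ (∀ s ∈ S, IsSection V s) ∧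
      ∀ y ∈ K, V y ≤ Submodule.span ℝ ((fun s => s y) '' S) := by
  obtain ⟨r, hr⟩ := isSubbundle_iff.1 hV
  refine hK.induction_on ?_ ?_ ?_ ?_
  · exact ⟨∅, Set.finite_empty, by simp, by simp⟩
  · rintro s t hst ⟨S, h1, h2, h3⟩
    exact ⟨S, h1, h2, fun y hy => h3 y (hst hy)⟩
  · rintro s t ⟨S, h1, h2, h3⟩ ⟨S', h1', h2', h3'⟩
    refine ⟨S ∪ S', h1.union h1', fun s hs => hs.elim (h2 s) (h2' s), fun y hy => ?_⟩
    rcases hy with hy | hy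
    · exact (h3 y hy).trans (Submodule.span_mono (Set.image_mono Set.subset_union_left))
    · exact (h3' y hy).trans (Submodule.span_mono (Set.image_mono Set.subset_union_right))
  · intro x _
    obtain ⟨θ, hθ⟩ := hr x
    have hext := fun i => exists_section_extension (V := V) (w := θ i) (x := x) (by
      filter_upwards [hθ] with z hz
      exact ⟨hz.1 i, hz.2.2 ▸ Submodule.subset_span ⟨i, rfl⟩⟩)
    choose w hw hwθ using hext
    refine ⟨{z | (∀ i, w i z = θ i z) ∧ Submodule.span ℝ (Set.range fun i => θ i z) = V z},
      mem_nhdsWithin_of_mem_nhds ?_, Set.range w, Set.finite_range w, ?_, ?_⟩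
    · filter_upwards [Filter.eventually_all.2 hwθ, hθ] with z h1 h2 using ⟨h1, h2.2.2⟩
    · rintro _ ⟨i, rfl⟩
      exact hw i
    · rintro y ⟨h1, h2⟩
      rw [← h2, ← Set.range_comp]
      refine (congrArg (fun f => Submodule.span ℝ (Set.range f)) (funext fun i => ?_)).le
      exact (h1 i).symm

/-- On every compact set 2 dim E sections suffice, a number independent of the compact set. Exhaust
M by compacts and localise these families to shells; shells whose indices have equal parity are
disjoint, so their sections can be added without interference. Two families, one for each parity,
generate V. -/
theorem exists_finite_generators [T2Space M] [SecondCountableTopology M] [SigmaCompactSpace M]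
    {V : CotField E M} (hV : IsSubbundle V) :
    ∃ (m : ℕ) (θ : Fin m → DForm E M 1), (∀ i, IsSection V (θ i)) ∧
      ∀ y, Submodule.span ℝ (Set.range fun i => θ i y) = V y := by
  have : LocallyCompactSpace M := Manifold.locallyCompact_of_finiteDimensional 𝓘(ℝ, E)
  set n := 2 * Module.finrank ℝ E
  have hcpt : ∀ K : Set M, IsCompact K → ∃ s : Fin n → DForm E M 1, (∀ i, IsSection V (s i)) ∧
      ∀ y ∈ K, V y ≤ Submodule.span ℝ (Set.range fun i => s i y) := by
    intro K hK
    obtain ⟨S, hS, h1, h2⟩ := exists_finite_sections_of_isCompact hV hK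
    obtain ⟨m, s₀, -, hs₀⟩ := Set.Finite.fin_param hS
    have h1' : ∀ i, IsSection V (s₀ i) := fun i => h1 _ (hs₀ ▸ ⟨i, rfl⟩)
    obtain ⟨s, h3, h4⟩ := exists_span_eq_fin fun i => (h1' i).1
    refine ⟨s, fun i => ⟨h3 i, fun y => ?_⟩, fun y hy => ?_⟩
    · have h5 : s i y ∈ Submodule.span ℝ (Set.range fun i => s₀ i y) :=
        h4 y ▸ Submodule.subset_span ⟨i, rfl⟩
      refine Submodule.span_le.2 ?_ h5
      rintro _ ⟨j, rfl⟩
      exact (h1' j).2 y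
    · rw [h4 y]
      have := h2 y hy
      rwa [← hs₀, ← Set.range_comp] at this
  set S := (CompactExhaustion.choice M).shiftr
  choose s hs hspan using fun i => hcpt (S (i + 2)) (S.isCompact (i + 2))
  set O : ℕ → Set M := fun i => interior (S (i + 2)) \ S i
  have hO : ∀ i, IsOpen (O i) := fun i => isOpen_interior.sdiff (S.isCompact i).isClosed
  have hcover : (Set.univ : Set M) ⊆ ⋃ i, O i := by
    intro x _
    have hx := (CompactExhaustion.choice M).mem_sdiff_shiftr_find x
    exact Set.mem_iUnion.2 ⟨_, S.subset_interior_succ _ hx.1, hx.2⟩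
  obtain ⟨f, hf⟩ := SmoothPartitionOfUnity.exists_isSubordinate 𝓘(ℝ, E) isClosed_univ O hO hcover
  have hfO : ∀ i y, f i y ≠ 0 → y ∈ O i := fun i y h => hf i (subset_tsupport _ h)
  -- Distinct indices of equal parity differ by at least 2, so the outer compact of the lower shell
  -- lies inside the part removed from the higher one.
  have hdisj : ∀ {i j y}, i < j → i % 2 = j % 2 → y ∈ O i → y ∈ O j → False := by
    intro i j y hij hmod hi hj
    exact hj.2 (S.subset (by omega) (interior_subset hi.1))
  set t : Fin 2 × Fin n → DForm E M 1 := fun p y =>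
    ∑ᶠ i : ℕ, if i % 2 = p.1 then f i y • s i p.2 y else 0
  have htV : ∀ p y, t p y ∈ V y := by
    intro p y
    refine finsum_induction (· ∈ V y) (Submodule.zero_mem _)
      (fun _ _ => Submodule.add_mem _) fun i => ?_
    split_ifs
    · exact Submodule.smul_mem _ _ ((hs i p.2).2 y)
    · exact Submodule.zero_mem _
  have htsmooth : ∀ p, Smooth (t p) := by
    intro p
    refine smooth_iff.2 fun x => ?_
    obtain ⟨U, hU, hfin⟩ := f.locallyFinite x
    set F := hfin.toFinset
    have h1 : SmoothAt (fun z => ∑ i ∈ F, if i % 2 = p.1 then f i z • s i p.2 z else 0) x := by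
      refine SmoothAt.sum (s := F)
        (w := fun (i : ℕ) z => if i % 2 = p.1 then f i z • s i p.2 z else 0) fun i _ => ?_
      by_cases hi : i % 2 = p.1
      · simp only [hi, if_true]
        exact SmoothAt.smul (f i).contMDiff.contMDiffAt (smooth_iff.1 (hs i p.2).1 x)
      · simp only [hi, if_false]
        exact smoothAt_zero x
    refine h1.congr ?_
    filter_upwards [hU] with z hz
    refine finsum_eq_sum_of_support_subset _ fun i hi => ?_
    rw [Finset.mem_coe, Set.Finite.mem_toFinset]
    refine ⟨z, ?_, hz⟩
    intro h0
    refine hi ?_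
    have h0' : f i z = 0 := h0
    simp only [h0', zero_smul, ite_self]
  have htspan : ∀ y, V y ≤ Submodule.span ℝ (Set.range fun p => t p y) := by
    intro y
    obtain ⟨i, hi⟩ : ∃ i, f i y ≠ 0 := by
      by_contra! h
      have := f.sum_eq_one (Set.mem_univ y)
      simp [h] at this
    have hyO := hfO i y hi
    have ht : ∀ j, t (⟨i % 2, Nat.mod_lt _ two_pos⟩, j) y = f i y • s i j y := by
      intro j
      refine (finsum_eq_single _ i fun i' hne => ?_).trans (if_pos rfl)
      by_cases hmod : i' % 2 = i % 2
      · refine (if_pos hmod).trans ?_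
        have : f i' y = 0 := by
          by_contra h
          rcases lt_or_gt_of_ne hne with hlt | hlt
          · exact hdisj hlt hmod (hfO i' y h) hyO
          · exact hdisj hlt hmod.symm hyO (hfO i' y h)
        rw [this, zero_smul]
      · exact if_neg hmod
    refine (hspan i y (interior_subset hyO.1)).trans (Submodule.span_le.2 ?_)
    rintro _ ⟨j, rfl⟩
    have h1 : t (⟨i % 2, Nat.mod_lt _ two_pos⟩, j) y ∈
        Submodule.span ℝ (Set.range fun p => t p y) := Submodule.subset_span ⟨_, rfl⟩
    rw [ht j] at h1
    exact (Submodule.smul_mem_iff _ hi).1 h1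
  refine ⟨_, fun i => t (Fintype.equivFin _ |>.symm i), fun i => ⟨htsmooth _, htV _⟩, fun y => ?_⟩
  refine le_antisymm (Submodule.span_le.2 ?_) ((htspan y).trans (Submodule.span_mono ?_))
  · rintro _ ⟨i, rfl⟩
    exact htV _ y
  · rintro _ ⟨p, rfl⟩
    exact ⟨Fintype.equivFin _ p, by simp⟩

end FiniteGeneration

/-! ### Pfaffian differential systems are local -/

section CastDegree

variable {T : Type*} [AddCommGroup T] [Module ℝ T] [TopologicalSpace T] {j k l p : ℕ}

/-- Transport of an alternating form along an equality of degrees. -/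
def castDegree (h : j = k) (w : T [⋀^Fin j]→L[ℝ] ℝ) : T [⋀^Fin k]→L[ℝ] ℝ := h ▸ w

theorem castDegree_apply (h : j = k) (w : T [⋀^Fin j]→L[ℝ] ℝ) (v : Fin k → T) :
    castDegree h w v = w (v ∘ Fin.cast h) := by
  subst h; rfl

theorem castDegree_add (h : j = k) (w w' : T [⋀^Fin j]→L[ℝ] ℝ) :
    castDegree h (w + w') = castDegree h w + castDegree h w' := by
  subst h; rfl

theorem castDegree_smul (h : j = k) (c : ℝ) (w : T [⋀^Fin j]→L[ℝ] ℝ) :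
    castDegree h (c • w) = c • castDegree h w := by
  subst h; rfl

theorem wedge_castDegree_left (h : p + j = k) (θ : T [⋀^Fin p]→L[ℝ] ℝ)
    (α : T [⋀^Fin j]→L[ℝ] ℝ) (γ : T [⋀^Fin l]→L[ℝ] ℝ) :
    wedge (castDegree h (wedge θ α)) γ =
      castDegree (by omega) (wedge θ (wedge α γ)) := by
  subst h
  ext v
  rw [castDegree_apply, ← wedge_assoc]
  rfl

theorem castDegree_wedge_castDegree {j' : ℕ} (hj : j = j') (h : p + j' = k)
    (θ : T [⋀^Fin p]→L[ℝ] ℝ) (α : T [⋀^Fin j]→L[ℝ] ℝ) :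
    castDegree h (wedge θ (castDegree hj α)) = castDegree (by omega) (wedge θ α) := by
  subst hj; rfl

/-- The product of a `p`-form and a `(k - p)`-form, as a `k`-form. -/
def wedgeTo (k : ℕ) (θ : T [⋀^Fin p]→L[ℝ] ℝ) :
    (T [⋀^Fin (k - p)]→L[ℝ] ℝ) →ₗ[ℝ] (T [⋀^Fin k]→L[ℝ] ℝ) :=
  -- This tests p ≤ k. For p > k the subtraction truncates to zero, and a generator of degree p must
  -- contribute nothing in degree k.
  if h : p + (k - p) = k then
    { toFun := fun α => castDegree h (wedge θ α)
      map_add' := fun α β => by rw [wedge_add_right, castDegree_add]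
      map_smul' := fun c α => by rw [wedge_smul_right, castDegree_smul]; rfl }
  else 0

theorem wedgeTo_apply (h : p + (k - p) = k) (θ : T [⋀^Fin p]→L[ℝ] ℝ)
    (α : T [⋀^Fin (k - p)]→L[ℝ] ℝ) : wedgeTo k θ α = castDegree h (wedge θ α) := by
  rw [wedgeTo, dif_pos h]; rfl

theorem wedgeTo_of_ne (h : p + (k - p) ≠ k) (θ : T [⋀^Fin p]→L[ℝ] ℝ)
    (α : T [⋀^Fin (k - p)]→L[ℝ] ℝ) : wedgeTo k θ α = 0 := by
  rw [wedgeTo, dif_neg h]; rfl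

theorem zero_wedge (γ : T [⋀^Fin l]→L[ℝ] ℝ) : wedge (0 : T [⋀^Fin k]→L[ℝ] ℝ) γ = 0 := by
  have h := wedge_smul_left 0 (0 : T [⋀^Fin k]→L[ℝ] ℝ) γ
  rwa [zero_smul, zero_smul] at h

theorem sum_wedge {ι : Type*} (s : Finset ι) (w : ι → T [⋀^Fin k]→L[ℝ] ℝ)
    (γ : T [⋀^Fin l]→L[ℝ] ℝ) : wedge (∑ i ∈ s, w i) γ = ∑ i ∈ s, wedge (w i) γ := by
  have h := map_sum ((wedgeBilin T k l).flip γ) w s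
  exact h

end CastDegree

/-! ### Finitely generated ideals of forms, and locality of membership -/

section EDS

variable {E : Type*} [NormedAddCommGroup E] [NormedSpace ℝ E]
  {M : Type*} [TopologicalSpace M] [ChartedSpace E M] [IsManifold 𝓘(ℝ, E) ∞ M]
  [FiniteDimensional ℝ E] {j k l : ℕ}

theorem SmoothAt.castDegree {w : DForm E M j} {x : M} (hw : SmoothAt w x) (h : j = k) :
    SmoothAt (fun z => DarbouxReduction.castDegree h (w z)) x := by
  subst h; exact hw

theorem PfaffianEDS.castDegree {V : CotField E M} {w : DForm E M j} (hw : PfaffianEDS V j w)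
    (h : j = k) : PfaffianEDS V k fun z => DarbouxReduction.castDegree h (w z) := by
  subst h; exact hw

theorem PfaffianEDS.sum {V : CotField E M} {ι : Type*} {s : Finset ι} {w : ι → DForm E M k}
    (hw : ∀ i ∈ s, PfaffianEDS V k (w i)) : PfaffianEDS V k (∑ i ∈ s, w i) := by
  classical
  induction s using Finset.induction_on with
  | empty => exact PfaffianEDS.zero k
  | insert a s ha ih =>
    rw [Finset.sum_insert ha]
    exact PfaffianEDS.add _ _ _ (hw a (Finset.mem_insert_self a s))
      (ih fun i hi => hw i (Finset.mem_insert_of_mem hi))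

/-- The `k`-forms in the ideal generated by the family `τ`. -/
def InIdeal {ι : Type*} [Fintype ι] {p : ι → ℕ} (τ : ∀ i, DForm E M (p i)) (k : ℕ)
    (w : DForm E M k) : Prop :=
  ∃ a : ∀ i, DForm E M (k - p i), (∀ i, Smooth (a i)) ∧
    ∀ z, w z = ∑ i, wedgeTo k (τ i z) (a i z)

variable {ι : Type*} [Fintype ι] {p : ι → ℕ} {τ : ∀ i, DForm E M (p i)}

theorem Smooth.add {w w' : DForm E M k} (hw : Smooth w) (hw' : Smooth w') : Smooth (w + w') :=
  smooth_iff.2 fun x => (smooth_iff.1 hw x).add (smooth_iff.1 hw' x)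

theorem smooth_zero : Smooth (0 : DForm E M k) := smooth_iff.2 smoothAt_zero

theorem InIdeal.zero : InIdeal τ k 0 :=
  ⟨fun _ => 0, fun _ => smooth_zero, fun z =>
    (Finset.sum_eq_zero fun i _ => map_zero (wedgeTo k (τ i z))).symm⟩

theorem InIdeal.add {w w' : DForm E M k} (hw : InIdeal τ k w) (hw' : InIdeal τ k w') :
    InIdeal τ k (w + w') := by
  obtain ⟨a, ha, h⟩ := hw
  obtain ⟨a', ha', h'⟩ := hw'
  refine ⟨fun i => a i + a' i, fun i => (ha i).add (ha' i), fun z => ?_⟩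
  refine (congrArg₂ (· + ·) (h z) (h' z)).trans ?_
  rw [← Finset.sum_add_distrib]
  exact Finset.sum_congr rfl fun i _ => (map_add (wedgeTo k (τ i z)) _ _).symm

theorem InIdeal.sum {κ : Type*} {s : Finset κ} {w : κ → DForm E M k}
    (hw : ∀ i ∈ s, InIdeal τ k (w i)) : InIdeal τ k (∑ i ∈ s, w i) := by
  classical
  induction s using Finset.induction_on with
  | empty => exact InIdeal.zero
  | insert a s ha ih =>
    rw [Finset.sum_insert ha]
    exact (hw a (Finset.mem_insert_self a s)).add
      (ih fun i hi => hw i (Finset.mem_insert_of_mem hi))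

theorem inIdeal_wedge (i : ι) {α : DForm E M l} (hα : Smooth α) :
    InIdeal τ (p i + l) (wedgeForm (τ i) α) := by
  classical
  have hdeg : ∀ {j}, j = i → l = p i + l - p j := by
    rintro _ rfl; omega
  -- The coefficient family is supported at the single index i; the degree of α is transported there
  -- from l to p i + l − p i.
  set a : ∀ j, DForm E M (p i + l - p j) := fun j =>
    if h : j = i then fun z => castDegree (hdeg h) (α z) else 0
  have hi : a i = fun z => castDegree (hdeg rfl) (α z) := dif_pos rfl
  have hne : ∀ {j}, j ≠ i → a j = 0 := fun h => dif_neg h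
  refine ⟨a, fun j => ?_, fun z => ?_⟩
  · rcases eq_or_ne j i with rfl | h
    · rw [hi]
      exact smooth_iff.2 fun x => (smooth_iff.1 hα x).castDegree _
    · rw [hne h]
      exact smooth_zero
  · rw [Finset.sum_eq_single i]
    · rw [hi, wedgeTo_apply (by omega), castDegree_wedge_castDegree]
      rfl
    · intro j _ hj
      rw [hne hj]
      exact map_zero (wedgeTo _ (τ j z))
    · intro h
      exact absurd (Finset.mem_univ i) h

theorem InIdeal.wedge {w : DForm E M k} (hw : InIdeal τ k w) {γ : DForm E M l} (hγ : Smooth γ) :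
    InIdeal τ (k + l) (wedgeForm w γ) := by
  obtain ⟨a, ha, h⟩ := hw
  have hw' : wedgeForm w γ = ∑ i, fun z => DarbouxReduction.wedge (wedgeTo k (τ i z) (a i z)) (γ z) := by
    funext z
    rw [Finset.sum_apply]
    refine Eq.trans ?_ (sum_wedge _ _ _)
    exact congrArg (fun η => DarbouxReduction.wedge η (γ z)) (h z)
  rw [hw']
  refine InIdeal.sum fun i _ => ?_
  by_cases hp : p i + (k - p i) = k
  · have h1 : (fun z => DarbouxReduction.wedge (wedgeTo k (τ i z) (a i z)) (γ z)) = fun z =>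
        castDegree (by omega : p i + (k - p i + l) = k + l)
          (wedgeForm (τ i) (wedgeForm (a i) γ) z) := by
      funext z
      rw [wedgeTo_apply hp]
      exact wedge_castDegree_left hp _ _ _
    rw [h1]
    have h2 : InIdeal τ _ (wedgeForm (τ i) (wedgeForm (a i) γ)) := inIdeal_wedge i
      (smooth_iff.2 fun x => (smooth_iff.1 (ha i) x).wedge (smooth_iff.1 hγ x))
    have h3 : ∀ {m} (hm : p i + (k - p i + l) = m), InIdeal τ m fun z =>
        castDegree hm (wedgeForm (τ i) (wedgeForm (a i) γ) z) := by
      rintro _ rfl; exact h2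
    exact h3 _
  · have h1 : (fun z => DarbouxReduction.wedge (wedgeTo k (τ i z) (a i z)) (γ z)) =
        (0 : DForm E M (k + l)) := by
      funext z
      rw [wedgeTo_of_ne hp]
      exact zero_wedge _
    rw [h1]
    exact InIdeal.zero

theorem InIdeal.pfaffianEDS {V : CotField E M} (hτ : ∀ i, PfaffianEDS V (p i) (τ i))
    {w : DForm E M k} (hw : InIdeal τ k w) : PfaffianEDS V k w := by
  obtain ⟨a, ha, h⟩ := hw
  have h1 : w = ∑ i, fun z => wedgeTo k (τ i z) (a i z) := by
    funext z
    rw [Finset.sum_apply]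
    exact h z
  rw [h1]
  refine PfaffianEDS.sum fun i _ => ?_
  by_cases hp : p i + (k - p i) = k
  · have h2 := (PfaffianEDS.wedge _ _ _ _ (hτ i) (ha i)).castDegree hp
    have h3 : (fun z => wedgeTo k (τ i z) (a i z)) =
        fun z => castDegree hp (wedgeForm (τ i) (a i) z) := funext fun z => wedgeTo_apply hp _ _
    rw [h3]
    exact h2
  · have h3 : (fun z => wedgeTo k (τ i z) (a i z)) = (0 : DForm E M k) :=
      funext fun z => wedgeTo_of_ne hp _ _
    rw [h3]
    exact PfaffianEDS.zero k

/-- With the generators fixed, the admissible coefficients at a point form an affine space, so local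
coefficients can be averaged by a partition of unity. -/
theorem inIdeal_of_local [T2Space M] [SigmaCompactSpace M] {w : DForm E M k}
    (hw : ∀ y, ∃ w', InIdeal τ k w' ∧ ∀ᶠ z in 𝓝 y, w' z = w z) : InIdeal τ k w := by
  set L : ∀ z : M, (∀ i, TangentSpace 𝓘(ℝ, E) z [⋀^Fin (k - p i)]→L[ℝ] ℝ) →ₗ[ℝ]
      (TangentSpace 𝓘(ℝ, E) z [⋀^Fin k]→L[ℝ] ℝ) := fun z =>
    ∑ i, (wedgeTo k (τ i z)).comp (LinearMap.proj i)
  have hL : ∀ z a, L z a = ∑ i, wedgeTo k (τ i z) (a i) := by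
    intro z a
    rw [LinearMap.sum_apply]
    rfl
  obtain ⟨a, h1, h2⟩ := exists_smooth_glue (E := E) (M := M) (fun i => k - p i)
    (fun z => L z ⁻¹' {w z}) (fun z => (convex_singleton (w z)).linear_preimage (L z)) (by
      intro y
      obtain ⟨w', ⟨a, ha, h⟩, hw'⟩ := hw y
      refine ⟨a, ?_⟩
      filter_upwards [hw'] with z hz
      exact ⟨fun i => smooth_iff.1 (ha i) z, (hL z _).trans ((h z).symm.trans hz)⟩)
  exact ⟨a, h1, fun z => (Eq.trans (hL z _).symm (h2 z)).symm⟩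

/-- A function, as a form of degree zero. -/
def zeroForm (f : M → ℝ) : DForm E M 0 := fun x =>
  ContinuousAlternatingMap.constOfIsEmpty ℝ (TangentSpace 𝓘(ℝ, E) x) (Fin 0) (f x)

theorem SmoothAt.zeroForm {f : M → ℝ} {x : M} (hf : ContMDiffAt 𝓘(ℝ, E) 𝓘(ℝ, ℝ) ∞ f x) :
    SmoothAt (E := E) (DarbouxReduction.zeroForm f) x :=
  smoothAt_iff_apply.2 fun _ => contDiffAt_coord_fun (mem_chart_source E x) hf

theorem SmoothAt.contMDiffAt_apply {a : DForm E M 0} {x : M} (ha : SmoothAt a x) :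
    ContMDiffAt 𝓘(ℝ, E) 𝓘(ℝ, ℝ) ∞ (fun z => a z ![]) x := by
  have hx := mem_chart_source E x
  have h1 := contMDiffAt_of_coord_fun hx (smoothAt_iff_apply.1 ha ![])
  refine h1.congr_of_eventuallyEq ?_
  filter_upwards [eventually_chart_source hx] with z hz
  refine (inChart_chart_apply hz a ![]).trans ?_
  refine congrArg (inChart x a (chartAt E x z)) ?_
  funext i; exact i.elim0

/-- The θ span but need not be independent. Locally, expand in a subframe and give the remaining
forms coefficient zero, then glue. Coefficients are treated as forms of degree zero so that the
gluing of forms applies. -/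
theorem exists_global_coeff [T2Space M] [SigmaCompactSpace M] {V : CotField E M}
    (hV : IsSubbundle V) {m : ℕ} {θ : Fin m → DForm E M 1} (hθ : ∀ i, Smooth (θ i))
    (hsp : ∀ y, Submodule.span ℝ (Set.range fun i => θ i y) = V y) {s : DForm E M 1}
    (hs : IsSection V s) :
    ∃ f : Fin m → M → ℝ, (∀ i, ContMDiff 𝓘(ℝ, E) 𝓘(ℝ, ℝ) ∞ (f i)) ∧
      ∀ z, s z = ∑ i, f i z • θ i z := by
  classical
  obtain ⟨r, hr⟩ := hV.finrank_eq
  set L : ∀ z : M, (∀ _ : Fin m, TangentSpace 𝓘(ℝ, E) z [⋀^Fin 0]→L[ℝ] ℝ) →ₗ[ℝ]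
      (TangentSpace 𝓘(ℝ, E) z [⋀^Fin 1]→L[ℝ] ℝ) := fun z =>
    ∑ i, (wedgeBilin (TangentSpace 𝓘(ℝ, E) z) 1 0 (θ i z)).comp (LinearMap.proj i)
  have hL : ∀ z a, L z a = ∑ i, a i ![] • θ i z := by
    intro z a
    rw [LinearMap.sum_apply]
    exact Finset.sum_congr rfl fun i _ => wedge_zero_form _ _
  obtain ⟨a, h1, h2⟩ := exists_smooth_glue (E := E) (M := M) (fun _ : Fin m => 0)
    (fun z => L z ⁻¹' {s z}) (fun z => (convex_singleton (s z)).linear_preimage (L z)) (by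
      intro y
      obtain ⟨b, hb⟩ := exists_local_subframe hr (θ := θ) (x := y)
        (Filter.Eventually.of_forall fun z => ⟨fun i => smooth_iff.1 (hθ i) z, hsp z⟩)
      obtain ⟨c, hc⟩ := exists_coeff_of_linearIndependent (η := s) (hb.mono fun _ h => h.1)
        hb.self_of_nhds.2.1 (by
          filter_upwards [hb] with z hz
          exact ⟨smooth_iff.1 hs.1 z, hz.2.2 ▸ hs.2 z⟩)
      refine ⟨fun i => zeroForm fun z => ∑ j, if b j = i then c j z else 0, ?_⟩
      filter_upwards [hc] with z hz
      refine ⟨fun i => SmoothAt.zeroForm ?_, (hL z _).trans ?_⟩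
      · refine ContMDiffAt.sum fun j _ => ?_
        by_cases h : b j = i
        · simpa only [h, if_true] using hz.1 j
        · simpa only [h, if_false] using contMDiffAt_const
      · change ∑ i, (∑ j, if b j = i then c j z else 0) • θ i z = s z
        rw [hz.2]
        simp_rw [Finset.sum_smul]
        rw [Finset.sum_comm]
        refine Finset.sum_congr rfl fun j _ => ?_
        rw [Finset.sum_eq_single (b j)]
        · rw [if_pos rfl]
        · intro i _ hi
          rw [if_neg hi.symm]
          exact zero_smul ℝ (θ i z)
        · intro h
          exact absurd (Finset.mem_univ _) h)
  refine ⟨fun i z => a i z ![], fun i x => (smooth_iff.1 (h1 i) x).contMDiffAt_apply, fun z => ?_⟩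
  exact (Eq.trans (hL z _).symm (h2 z)).symm

theorem Smooth.wedge {α : DForm E M k} {β : DForm E M l} (hα : Smooth α) (hβ : Smooth β) :
    Smooth (wedgeForm α β) :=
  smooth_iff.2 fun x => (smooth_iff.1 hα x).wedge (smooth_iff.1 hβ x)

theorem PfaffianEDS.smooth {V : CotField E M} {w : DForm E M k} (hw : PfaffianEDS V k w) :
    Smooth w := by
  induction hw with
  | gen θ h => exact h.1
  | extD θ h => exact h.1.extD
  | zero k => exact smooth_zero
  | add k w η _ _ h1 h2 => exact h1.add h2
  | wedge k l w α _ hα h => exact h.wedge hα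

/-- The differential system generated by a subbundle is a finitely generated ideal. -/
theorem exists_inIdeal [T2Space M] [SecondCountableTopology M] [SigmaCompactSpace M]
    {V : CotField E M} (hV : IsSubbundle V) :
    ∃ (m : ℕ) (p : Fin m ⊕ Fin m → ℕ) (τ : ∀ i, DForm E M (p i)),
      ∀ {k : ℕ} {w : DForm E M k}, PfaffianEDS V k w ↔ InIdeal τ k w := by
  obtain ⟨m, θ, hθ, hsp⟩ := exists_finite_generators hV
  set p : Fin m ⊕ Fin m → ℕ := Sum.elim (fun _ => 1) (fun _ => 2)
  set τ : ∀ i, DForm E M (p i) := fun i => match i with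
    | Sum.inl i => θ i
    | Sum.inr i => extD (θ i)
  refine ⟨m, p, τ, fun {k w} => ⟨fun h => ?_, fun h => h.pfaffianEDS ?_⟩⟩
  · induction h with
    | gen s hs =>
      obtain ⟨f, hf, h⟩ := exists_global_coeff hV (fun i => (hθ i).1) hsp hs
      have h1 : s = ∑ i, wedgeForm (θ i) (zeroForm (f i)) := by
        funext z
        rw [h z, Finset.sum_apply]
        exact Finset.sum_congr rfl fun i _ => (wedge_zero_form (θ i z) (zeroForm (f i) z)).symm
      rw [h1]
      refine InIdeal.sum fun i _ => inIdeal_wedge (τ := τ) (l := 0) (α := zeroForm (f i)) (Sum.inl i)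
        (smooth_iff.2 fun x => ?_)
      exact SmoothAt.zeroForm (hf i x)
    | extD s hs =>
      obtain ⟨f, hf, h⟩ := exists_global_coeff hV (fun i => (hθ i).1) hsp hs
      have h0 : ∀ i z, SmoothAt (θ i) z := fun i => smooth_iff.1 (hθ i).1
      -- By Leibniz, d(fθ) = df ∧ θ + f dθ. The generator must stand on the left, whence the sign
      -- −1.
      have h1 : DarbouxReduction.extD s = ∑ i, wedgeForm (θ i) (fun z => (-1 : ℝ) • dFun (f i) z) +
          ∑ i, wedgeForm (DarbouxReduction.extD (θ i)) (zeroForm (f i)) := by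
        funext x
        have h2 : DarbouxReduction.extD s x =
            ∑ i, DarbouxReduction.extD (fun z => f i z • θ i z) x := by
          refine Eq.trans ?_ (extD_sum (s := Finset.univ) (w := fun i z => f i z • θ i z)
            fun i _ => SmoothAt.smul (hf i x) (h0 i x))
          exact extD_congr (Filter.Eventually.of_forall fun z => h z)
        rw [h2, Pi.add_apply, Finset.sum_apply, Finset.sum_apply]
        refine Eq.trans ?_ Finset.sum_add_distrib
        refine Finset.sum_congr rfl fun i _ => ?_
        refine (extD_smul (hf i x) (h0 i x)).trans ?_
        refine congrArg₂ (· + ·) ?_ (wedge_zero_form (DarbouxReduction.extD (θ i) x) (zeroForm (f i) x)).symm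
        refine (wedge_one_one_comm _ _).trans ?_
        refine Eq.trans ?_ (wedge_smul_right (-1) (θ i x) (dFun (f i) x)).symm
        exact (neg_one_smul ℝ (wedge (θ i x) (dFun (f i) x))).symm
      rw [h1]
      refine InIdeal.add ?_ ?_
      · refine InIdeal.sum fun i _ => inIdeal_wedge (τ := τ) (l := 1)
          (α := fun z => (-1 : ℝ) • dFun (f i) z) (Sum.inl i) (smooth_iff.2 fun x => ?_)
        exact SmoothAt.smul (f := fun _ => -1) contMDiffAt_const (SmoothAt.dFun (hf i x))
      · refine InIdeal.sum fun i _ => inIdeal_wedge (τ := τ) (l := 0) (α := zeroForm (f i)) (Sum.inr i)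
          (smooth_iff.2 fun x => ?_)
        exact SmoothAt.zeroForm (hf i x)
    | zero k => exact InIdeal.zero
    | add k w η _ _ h1 h2 => exact h1.add h2
    | wedge k l w α _ hα h => exact h.wedge hα
  · rintro (i | i)
    · exact PfaffianEDS.gen _ (hθ i)
    · exact PfaffianEDS.extD _ (hθ i)

/-- Membership in the differential system generated by a subbundle is a local condition. -/
theorem pfaffianEDS_of_local [T2Space M] [SecondCountableTopology M] [SigmaCompactSpace M]
    {V : CotField E M} (hV : IsSubbundle V) {w : DForm E M k}
    (hw : ∀ y, ∃ w', PfaffianEDS V k w' ∧ ∀ᶠ z in 𝓝 y, w' z = w z) : PfaffianEDS V k w := by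
  obtain ⟨m, p, τ, h⟩ := exists_inIdeal hV
  refine h.2 (inIdeal_of_local fun y => ?_)
  obtain ⟨w', h1, h2⟩ := hw y
  exact ⟨w', h.1 h1, h2⟩

end EDS

/-! ### Pullbacks of integrable subbundles -/

section PullField

variable {E : Type*} [NormedAddCommGroup E] [NormedSpace ℝ E]
  {M : Type*} [TopologicalSpace M] [ChartedSpace E M] [IsManifold 𝓘(ℝ, E) ∞ M]
  {E' : Type*} [NormedAddCommGroup E'] [NormedSpace ℝ E']
  {N : Type*} [TopologicalSpace N] [ChartedSpace E' N] [IsManifold 𝓘(ℝ, E') ∞ N]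
  [FiniteDimensional ℝ E] [FiniteDimensional ℝ E']

theorem comp_injective {T T' : Type*} [AddCommGroup T] [Module ℝ T] [TopologicalSpace T]
    [AddCommGroup T'] [Module ℝ T'] [TopologicalSpace T'] {k : ℕ} {A : T →L[ℝ] T'}
    (hA : Function.Surjective A) : Function.Injective
      fun w : T' [⋀^Fin k]→L[ℝ] ℝ => w.compContinuousLinearMap A := by
  intro w w' h
  ext v
  choose u hu using fun i => hA (v i)
  have h1 := congrArg (fun η => η u) h
  have h2 : v = A ∘ u := funext fun i => (hu i).symm
  rw [h2]
  exact h1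

theorem comp_one_apply {T T' : Type*} [AddCommGroup T] [Module ℝ T] [TopologicalSpace T]
    [AddCommGroup T'] [Module ℝ T'] [TopologicalSpace T'] (w : T' [⋀^Fin 1]→L[ℝ] ℝ)
    (A : T →L[ℝ] T') (u : T) : w.compContinuousLinearMap A ![u] = w ![A u] := by
  refine congrArg w ?_
  funext i; fin_cases i; rfl

theorem comp_two_apply {T T' : Type*} [AddCommGroup T] [Module ℝ T] [TopologicalSpace T]
    [AddCommGroup T'] [Module ℝ T'] [TopologicalSpace T'] (w : T' [⋀^Fin 2]→L[ℝ] ℝ)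
    (A : T →L[ℝ] T') (u v : T) : w.compContinuousLinearMap A ![u, v] = w ![A u, A v] := by
  refine congrArg w ?_
  funext i; fin_cases i <;> rfl

/-- The pullback of a field of subspaces of the cotangent spaces. -/
def pullField (f : M → N) (F : CotField E' N) : CotField E M := fun x =>
  (F (f x)).map (ContinuousAlternatingMap.compContinuousLinearMapₗ
    (mfderiv 𝓘(ℝ, E) 𝓘(ℝ, E') f x))

/-- The Leibniz terms daᵢ ∧ τᵢ vanish on vectors in the common kernel of the τ. -/
theorem extD_apply_eq_sum {ι : Type*} [Fintype ι] {θ : DForm E M 1} {τ : ι → DForm E M 1}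
    {a : ι → M → ℝ} {x : M} (hτ : ∀ i, SmoothAt (τ i) x)
    (ha : ∀ i, ContMDiffAt 𝓘(ℝ, E) 𝓘(ℝ, ℝ) ∞ (a i) x)
    (h : ∀ᶠ z in 𝓝 x, θ z = ∑ i, a i z • τ i z) {u v : TangentSpace 𝓘(ℝ, E) x}
    (hu : ∀ i, τ i x ![u] = 0) (hv : ∀ i, τ i x ![v] = 0) :
    extD θ x ![u, v] = ∑ i, a i x * extD (τ i) x ![u, v] := by
  have h1 : extD θ x = ∑ i, extD (fun z => a i z • τ i z) x :=
    (extD_congr h).trans (extD_sum (s := Finset.univ) (w := fun i z => a i z • τ i z)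
      fun i _ => SmoothAt.smul (ha i) (hτ i))
  rw [h1]
  refine (ContinuousAlternatingMap.sum_apply _ _).trans (Finset.sum_congr rfl fun i _ => ?_)
  refine (congrArg (fun η => η ![u, v]) (extD_smul (ha i) (hτ i))).trans ?_
  refine (congrArg (· + a i x * extD (τ i) x ![u, v])
    ((wedge_one_one (dFun (a i) x) (τ i x) u v).trans ?_)).trans (zero_add _)
  rw [hu i, hv i, mul_zero, mul_zero, sub_zero]

theorem smoothAt_pullback_near {f : M → N} (hf : ContMDiff 𝓘(ℝ, E) 𝓘(ℝ, E') ∞ f) {x : M} {k : ℕ}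
    {w : DForm E' N k} (hw : SmoothAt w (f x)) : SmoothAt (pullback (E := E) f w) x :=
  hw.pullback hf.contMDiffAt

theorem linearIndependent_pullback {f : M → N}
    (hsub : ∀ x, Function.Surjective (mfderiv 𝓘(ℝ, E) 𝓘(ℝ, E') f x)) {x : M} {ι : Type*} {k : ℕ}
    {θ : ι → DForm E' N k} (hθ : LinearIndependent ℝ fun i => θ i (f x)) :
    LinearIndependent ℝ fun i => pullback (E := E) f (θ i) x :=
  hθ.map' (ContinuousAlternatingMap.compContinuousLinearMapₗ (mfderiv 𝓘(ℝ, E) 𝓘(ℝ, E') f x))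
    (LinearMap.ker_eq_bot.2 (comp_injective (hsub x)))

theorem span_pullback {f : M → N} {x : M} {ι : Type*} {θ : ι → DForm E' N 1} {F : CotField E' N}
    (hθ : Submodule.span ℝ (Set.range fun i => θ i (f x)) = F (f x)) :
    Submodule.span ℝ (Set.range fun i => pullback (E := E) f (θ i) x) = pullField f F x := by
  rw [pullField, ← hθ, Submodule.map_span, ← Set.range_comp]
  rfl

theorem isSubbundle_pullField {f : M → N} (hf : ContMDiff 𝓘(ℝ, E) 𝓘(ℝ, E') ∞ f)
    (hsub : ∀ x, Function.Surjective (mfderiv 𝓘(ℝ, E) 𝓘(ℝ, E') f x)) {F : CotField E' N}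
    (hF : IsSubbundle F) : IsSubbundle (pullField (E := E) f F) := by
  obtain ⟨r, hr⟩ := isSubbundle_iff.1 hF
  refine isSubbundle_iff.2 ⟨r, fun x => ?_⟩
  obtain ⟨θ, hθ⟩ := hr (f x)
  refine ⟨fun i => pullback f (θ i), ?_⟩
  filter_upwards [hf.continuous.continuousAt.eventually hθ] with z hz
  exact ⟨fun i => smoothAt_pullback_near hf (hz.1 i), linearIndependent_pullback hsub hz.2.1,
    span_pullback hz.2.2⟩

/-- A section of the pullback is locally a combination of pulled-back sections f^*wᵢ. The
differential of f maps the annihilator of f^*F into that of F, where the dwᵢ vanish. The local frame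
is first replaced by global sections because integrability is a statement about those. -/
theorem isIntegrable_pullField [T2Space N] {f : M → N} (hf : ContMDiff 𝓘(ℝ, E) 𝓘(ℝ, E') ∞ f)
    (hsub : ∀ x, Function.Surjective (mfderiv 𝓘(ℝ, E) 𝓘(ℝ, E') f x)) {F : CotField E' N}
    (hF : IsIntegrable F) : IsIntegrable (pullField (E := E) f F) := by
  refine ⟨isSubbundle_pullField hf hsub hF.1, fun θ hθ x u hu v hv => ?_⟩
  obtain ⟨r, hr⟩ := isSubbundle_iff.1 hF.1
  obtain ⟨η, hη⟩ := hr (f x)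
  have hext := fun i => exists_section_extension (V := F) (w := η i) (x := f x) (by
    filter_upwards [hη] with z hz
    exact ⟨hz.1 i, hz.2.2 ▸ Submodule.subset_span ⟨i, rfl⟩⟩)
  choose w hw hwη using hext
  have hw' : ∀ᶠ y in 𝓝 (f x), LinearIndependent ℝ (fun i => w i y) ∧
      Submodule.span ℝ (Set.range fun i => w i y) = F y := by
    filter_upwards [Filter.eventually_all.2 hwη, hη] with y h1 h2
    have : (fun i => w i y) = fun i => η i y := funext h1
    rw [this]
    exact h2.2
  have hev := hf.continuous.continuousAt.eventually hw'
  have hsm : ∀ i z, SmoothAt (pullback (E := E) f (w i)) z := fun i z =>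
    smoothAt_pullback_near hf (smooth_iff.1 (hw i).1 _)
  obtain ⟨a, ha⟩ := exists_coeff_of_linearIndependent (θ := fun i => pullback (E := E) f (w i))
    (η := θ) (x := x) (Filter.Eventually.of_forall fun z i => hsm i z)
    (linearIndependent_pullback hsub hev.self_of_nhds.1) (by
      filter_upwards [hev] with z hz
      refine ⟨smooth_iff.1 hθ.1 z, ?_⟩
      have h1 := span_pullback (E := E) (f := f) (θ := w) (F := F) hz.2
      exact h1.symm.le (hθ.2 z))
  have hmem : ∀ i, pullback (E := E) f (w i) x ∈ pullField (E := E) f F x := fun i =>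
    ⟨w i (f x), (hw i).2 (f x), rfl⟩
  have hann : ∀ u ∈ annihilator (pullField (E := E) f F x),
      (mfderiv 𝓘(ℝ, E) 𝓘(ℝ, E') f x u) ∈ annihilator (F (f x)) := by
    intro u hu w hw
    rw [← comp_one_apply]
    exact hu _ ⟨w, hw, rfl⟩
  rw [extD_apply_eq_sum (fun i => hsm i x) ha.self_of_nhds.1 (ha.mono fun _ h => h.2)
    (fun i => hu _ (hmem i)) (fun i => hv _ (hmem i))]
  refine Finset.sum_eq_zero fun i _ => ?_
  rw [extD_pullback (smooth_iff.1 (hw i).1 _) hf.contMDiffAt]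
  refine mul_eq_zero_of_right _ ?_
  refine (comp_two_apply _ _ _ _).trans ?_
  exact hF.2 _ (hw i) _ _ (hann u hu) _ (hann v hv)

theorem le_infDerived {W F : CotField E M} (hF : IsIntegrable F) (hle : ∀ x, F x ≤ W x) (x : M) :
    F x ≤ infDerived W x :=
  le_iSup₂_of_le F ⟨hF, hle⟩ le_rfl

theorem infDerived_le (W : CotField E M) (x : M) : infDerived W x ≤ W x :=
  iSup₂_le fun _ hF => hF.2 x

/-- The pullback of W^(∞) by a translation is again integrable and, W being invariant, contained in
W; maximality places it in W^(∞). -/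
theorem infDerived_invariant [T2Space M] {EG : Type*} [NormedAddCommGroup EG] [NormedSpace ℝ EG]
    {G : Type*} [TopologicalSpace G] [ChartedSpace EG G] [Group G] [MulAction G M]
    (hs : ContMDiff (𝓘(ℝ, EG).prod 𝓘(ℝ, E)) 𝓘(ℝ, E) ∞ (fun p : G × M => p.1 • p.2))
    {W : CotField E M} (hW : IsIntegrable (infDerived W)) (hinv : IsInvariant G W) :
    IsInvariant G (infDerived W) := by
  intro g x w hw
  have hsm : ∀ g : G, ContMDiff 𝓘(ℝ, E) 𝓘(ℝ, E) ∞ (fun z : M => g • z) := fun g =>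
    hs.comp (contMDiff_const.prodMk contMDiff_id)
  have htr : ∀ g : G, MDifferentiable 𝓘(ℝ, E) 𝓘(ℝ, E) (fun z : M => g • z) := fun g =>
    (hsm g).mdifferentiable (by simp)
  have hsurj : ∀ x : M, Function.Surjective (mfderiv 𝓘(ℝ, E) 𝓘(ℝ, E) (fun z : M => g • z) x) := by
    intro x v
    refine ⟨(mfderiv 𝓘(ℝ, E) 𝓘(ℝ, E) (fun z : M => g⁻¹ • z) (g • x) : E →L[ℝ] E) v, ?_⟩
    have h1 := mfderiv_comp_of_eq (f := fun z : M => g⁻¹ • z) (g := fun z : M => g • z)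
      (x := g • x) (y := x) (htr g x) (htr g⁻¹ (g • x)) (inv_smul_smul g x)
    have h2 : (fun z : M => g • z) ∘ (fun z : M => g⁻¹ • z) = id := by
      funext z; exact smul_inv_smul g z
    have h3 := mfderiv_congr_fun (E := E) (E' := E) h2 (g • x) v
    rw [h1, mfderiv_id] at h3
    exact (mfderiv_congr_of_eq (inv_smul_smul g x).symm _).trans h3
  refine le_infDerived (isIntegrable_pullField (hsm g) hsurj hW)
    (fun z => ?_) x ⟨w, hw, rfl⟩
  rintro _ ⟨w, hw, rfl⟩
  exact hinv g z w (infDerived_le W _ hw)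

end PullField

/-! ### Lifts adapted to a transverse field of covectors -/

/-- Since S separates the vectors of K, restriction maps S onto the dual of K; the family consists
of preimages of a dual basis. -/
theorem exists_family_separating {T : Type*} [AddCommGroup T] [Module ℝ T] [TopologicalSpace T]
    (K : Submodule ℝ T) [FiniteDimensional ℝ K] (S : Submodule ℝ (T [⋀^Fin 1]→L[ℝ] ℝ))
    (h : ∀ v ∈ K, (∀ w ∈ S, w ![v] = 0) → v = 0) :
    ∃ s : Fin (Module.finrank ℝ K) → T [⋀^Fin 1]→L[ℝ] ℝ, (∀ i, s i ∈ S) ∧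
      LinearIndependent ℝ s ∧ ∀ v ∈ K, (∀ i, s i ![v] = 0) → v = 0 := by
  set ρ : (T [⋀^Fin 1]→L[ℝ] ℝ) →ₗ[ℝ] Module.Dual ℝ K := K.subtype.dualMap.comp toDual
  have hρ : ∀ w (v : K), ρ w v = w ![(v : T)] := fun w v => toDual_apply w v
  have htop : S.map ρ = ⊤ := by
    have h1 : (S.map ρ).dualCoannihilator = ⊥ := by
      refine (Submodule.eq_bot_iff _).2 fun v hv => Subtype.ext (h v v.2 fun w hw => ?_)
      rw [← hρ]
      exact (Submodule.mem_dualCoannihilator v).1 hv _ ⟨w, hw, rfl⟩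
    have h2 := Subspace.finrank_add_finrank_dualCoannihilator_eq (S.map ρ)
    rw [h1, finrank_bot, add_zero] at h2
    exact Submodule.eq_top_of_finrank_eq (h2.trans Subspace.dual_finrank_eq.symm)
  have hex : ∀ i, ∃ s ∈ S, ρ s = (Module.finBasis ℝ K).coord i := fun i => by
    have : (Module.finBasis ℝ K).coord i ∈ S.map ρ := htop ▸ Submodule.mem_top
    exact this
  choose s hsS hs using hex
  refine ⟨s, hsS, ?_, fun v hv hsv => ?_⟩
  · refine LinearIndependent.of_comp ρ ?_
    have h1 : ρ ∘ s = (Module.finBasis ℝ K).dualBasis := by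
      funext i
      rw [Function.comp_apply, hs, Module.Basis.coe_dualBasis]
    rw [h1]
    exact Module.Basis.linearIndependent _
  · have h1 : (⟨v, hv⟩ : K) = 0 := by
      refine (Module.finBasis ℝ K).ext_elem fun i => ?_
      have h2 := LinearMap.congr_fun (hs i) ⟨v, hv⟩
      rw [hρ, hsv i, Module.Basis.coord_apply] at h2
      rw [← h2, map_zero]
      rfl
    exact congrArg Subtype.val h1

section Adapted

variable {E : Type*} [NormedAddCommGroup E] [NormedSpace ℝ E]
  {M : Type*} [TopologicalSpace M] [ChartedSpace E M] [IsManifold 𝓘(ℝ, E) ∞ M]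
  {E' : Type*} [NormedAddCommGroup E'] [NormedSpace ℝ E']
  {N : Type*} [TopologicalSpace N] [ChartedSpace E' N] [IsManifold 𝓘(ℝ, E') ∞ N]
  [FiniteDimensional ℝ E] [FiniteDimensional ℝ E']

/-- The differential of `q` at `x`, regarded as a map to the tangent space at `y = q x`. -/
def diffTo (q : M → N) (x : M) (y : N) :
    TangentSpace 𝓘(ℝ, E) x →L[ℝ] TangentSpace 𝓘(ℝ, E') y :=
  (mfderiv 𝓘(ℝ, E) 𝓘(ℝ, E') q x : TangentSpace 𝓘(ℝ, E) x →L[ℝ] TangentSpace 𝓘(ℝ, E') y)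

/-- Local lifts along a section of `q` of tangent vectors to the kernel of forms `σ`, which are
sections of `S` restricting to a coframe on the fibres of `q`. -/
structure AdaptedLift (q : M → N) (S : CotField E M) (y₀ : N) where
  d : ℕ
  ξ : N → M
  σ : Fin d → DForm E M 1
  R : ∀ y, TangentSpace 𝓘(ℝ, E') y →L[ℝ] TangentSpace 𝓘(ℝ, E) (ξ y)
  finrank_eq : Module.finrank ℝ E = Module.finrank ℝ E' + d
  coframe : ∀ᶠ x in 𝓝 (ξ y₀), ∀ i, SmoothAt (σ i) x ∧ σ i x ∈ S x
  good : ∀ᶠ y in 𝓝 y₀, ContMDiffAt 𝓘(ℝ, E') 𝓘(ℝ, E) ∞ ξ y ∧ q (ξ y) = y ∧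
    (∀ u, diffTo q (ξ y) y (R y u) = u) ∧ (∀ i u, σ i (ξ y) ![R y u] = 0) ∧
    LinearIndependent ℝ (fun i => σ i (ξ y)) ∧
    (∀ w : TangentSpace 𝓘(ℝ, E) (ξ y) [⋀^Fin 1]→L[ℝ] ℝ,
      w - (w.compContinuousLinearMap (R y)).compContinuousLinearMap (diffTo q (ξ y) y) ∈
        Submodule.span ℝ (Set.range fun i => σ i (ξ y)))
  smoothAt_pullback : ∀ᶠ y in 𝓝 y₀, ∀ (k : ℕ) (w : DForm E M k), SmoothAt w (ξ y) →
    SmoothAt (E := E') (M := N) (bundlePullback ξ R w) y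

/-- Linear algebra of a lift: a covector is the sum of a semibasic one and a combination of the
forms whose kernel is the image of the lift. -/
theorem sub_comp_comp_mem_span {T T' : Type*} [AddCommGroup T] [Module ℝ T] [TopologicalSpace T]
    [AddCommGroup T'] [Module ℝ T'] [TopologicalSpace T'] [FiniteDimensional ℝ T]
    [FiniteDimensional ℝ T'] {d : ℕ} {τ : Fin d → T [⋀^Fin 1]→L[ℝ] ℝ}
    (hτ : LinearIndependent ℝ τ) {D : T →L[ℝ] T'} {R : T' →L[ℝ] T} (hDR : ∀ u, D (R u) = u)
    (hR : ∀ i u, τ i ![R u] = 0) (hd : Module.finrank ℝ T = Module.finrank ℝ T' + d)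
    (w : T [⋀^Fin 1]→L[ℝ] ℝ) :
    w - (w.compContinuousLinearMap R).compContinuousLinearMap D ∈
      Submodule.span ℝ (Set.range τ) := by
  refine mem_span_of_forall_apply_eq_zero fun v hv => ?_
  set L : T →ₗ[ℝ] (Fin d → ℝ) := LinearMap.pi fun i => toDual (τ i)
  have hL : ∀ v i, L v i = τ i ![v] := fun v i => toDual_apply _ _
  have hLsurj : LinearMap.range L = ⊤ := LinearMap.range_eq_top.2 fun c => by
    obtain ⟨v, hv⟩ := evalPi_surjective hτ c
    exact ⟨v, funext fun i => (hL v i).trans (hv i)⟩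
  have hker := L.finrank_range_add_finrank_ker
  rw [hLsurj, finrank_top, Module.finrank_fin_fun] at hker
  have hRinj : Function.Injective R.toLinearMap := Function.LeftInverse.injective hDR
  have hle : LinearMap.range R.toLinearMap ≤ LinearMap.ker L := by
    rintro _ ⟨u, rfl⟩
    exact funext fun i => (hL _ i).trans (hR i u)
  -- The image of the lift is the whole common kernel of the τ, by dimension. On it R ∘ D is the
  -- identity, so the difference of covectors vanishes there and is a combination of the τ.
  have heq : LinearMap.range R.toLinearMap = LinearMap.ker L :=
    Submodule.eq_of_le_of_finrank_eq hle (by rw [LinearMap.finrank_range_of_inj hRinj]; omega)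
  have hvL : v ∈ LinearMap.ker L := funext fun i => (hL _ i).trans (hv i)
  rw [← heq] at hvL
  obtain ⟨u, rfl⟩ := hvL
  rw [ContinuousAlternatingMap.sub_apply, comp_one_apply, comp_one_apply]
  refine sub_eq_zero.2 ?_
  exact congrArg (fun z => w ![R z]) (hDR u).symm

/-- At ξ(y₀), choose elements of F ⊓ C restricting to a basis of covectors on the vertical space,
extend them to local sections of F ⊓ C, which F + C = ⊤ permits, and lift to their common kernel. -/
theorem nonempty_adaptedLift {G : Type*} [Group G] [MulAction G M] {q : M → N}
    (hq : IsRegularQuotient (E := E) (E' := E') G q) {F C : CotField E M} (hF : IsSubbundle F)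
    (hC : IsSubbundle C) (hFC : ∀ x, F x ⊔ C x = ⊤)
    (htr : ∀ x (v : TangentSpace 𝓘(ℝ, E) x), mfderiv 𝓘(ℝ, E) 𝓘(ℝ, E') q x v = 0 →
      (∀ w ∈ F x ⊓ C x, w ![v] = 0) → v = 0) (y₀ : N) :
    Nonempty (AdaptedLift (E' := E') q (fun x => F x ⊓ C x) y₀) := by
  obtain ⟨U, hU, hyU, ξ, hξ, hqξ⟩ := hq.section_exists y₀
  set x₀ := ξ y₀
  set D : TangentSpace 𝓘(ℝ, E) x₀ →L[ℝ] TangentSpace 𝓘(ℝ, E') y₀ := diffTo q x₀ y₀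
  set K := LinearMap.ker D.toLinearMap
  obtain ⟨s, hs, hsli, hsK⟩ := exists_family_separating K (F x₀ ⊓ C x₀) fun v hv h => htr x₀ v hv h
  have hex := fun i => exists_local_section_inf hF hC (hFC x₀) (hs i)
  choose σ hσ hσx using hex
  have hdim : Module.finrank ℝ E = Module.finrank ℝ E' + Module.finrank ℝ K := by
    have h1 := D.toLinearMap.finrank_range_add_finrank_ker
    have h2 : LinearMap.range D.toLinearMap = ⊤ := LinearMap.range_eq_top.2 (hq.submersion x₀)
    rw [h2, finrank_top] at h1
    exact h1.symm
  have hσs : ∀ᶠ x in 𝓝 x₀, ∀ i, SmoothAt (σ i) x := by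
    filter_upwards [Filter.eventually_all.2 hσ] with x hx i using (hx i).1
  have hξ' : ∀ᶠ y in 𝓝 y₀, ContMDiffAt 𝓘(ℝ, E') 𝓘(ℝ, E) ∞ ξ y ∧ q (ξ y) = y := by
    filter_upwards [hU.eventually_mem hyU] with y hy
    exact ⟨hξ.contMDiffAt (hU.mem_nhds hy), hqξ y hy⟩
  obtain ⟨R, hR⟩ := exists_horizontal_lift (σ := σ) hq.smooth hξ' hσs
    (fun v hv h => hsK v hv fun i => by rw [← hσx i]; exact h i) (by simpa using hdim)
  have hli : ∀ᶠ y in 𝓝 y₀, LinearIndependent ℝ (fun i => σ i (ξ y)) := by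
    refine hξ'.self_of_nhds.1.continuousAt.eventually (eventually_linearIndependent hσs ?_)
    have : (fun i => σ i x₀) = s := funext hσx
    rw [this]
    exact hsli
  refine ⟨⟨Module.finrank ℝ K, ξ, σ, R, hdim, Filter.eventually_all.2 hσ, ?_,
    hR.mono fun _ h => h.2.2⟩⟩
  filter_upwards [hξ', hR, hli] with y h1 h2 h3
  exact ⟨h1.1, h1.2, h2.1, h2.2.1, h3, fun w => sub_comp_comp_mem_span
    (T := TangentSpace 𝓘(ℝ, E) (ξ y)) (T' := TangentSpace 𝓘(ℝ, E') y) (D := diffTo q (ξ y) y)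
    h3 h2.1 h2.2.1 hdim w⟩

/-- One point of the fibre suffices: the fibre is an orbit, W is invariant, and q ∘ g = q. -/
theorem mem_quotientBundle_iff {G : Type*} [Group G] [MulAction G M]
    (hs : ∀ g : G, ContMDiff 𝓘(ℝ, E) 𝓘(ℝ, E) ∞ (fun x : M => g • x)) {q : M → N}
    (hq : IsRegularQuotient (E := E) (E' := E') G q) {W : CotField E M} (hW : IsInvariant G W)
    {x : M} {y : N} (hxy : q x = y) {α : TangentSpace 𝓘(ℝ, E') y [⋀^Fin 1]→L[ℝ] ℝ} :
    α ∈ quotientBundle (E' := E') q W y ↔ α.compContinuousLinearMap (diffTo q x y) ∈ W x := by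
  refine ⟨fun h => (Submodule.mem_iInf _).1 h ⟨x, hxy⟩, fun h => (Submodule.mem_iInf _).2 ?_⟩
  rintro ⟨x', hx'⟩
  change α.compContinuousLinearMap (diffTo q x' y) ∈ W x'
  obtain ⟨g, rfl⟩ := (hq.fibre_eq_orbit x' x).1 (hx'.trans hxy.symm)
  have h1 := hW g x' _ h
  have h2 : (α.compContinuousLinearMap (diffTo q (g • x') y)).compContinuousLinearMap
      (mfderiv 𝓘(ℝ, E) 𝓘(ℝ, E) (fun z : M => g • z) x') =
      α.compContinuousLinearMap (diffTo q x' y) := by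
    refine alternating_one_ext fun u => ?_
    rw [comp_one_apply, comp_one_apply, comp_one_apply]
    have h3 := mfderiv_comp x' (f := fun z : M => g • z) (g := q)
      (hq.smooth.mdifferentiable (by simp) (g • x')) ((hs g).mdifferentiable (by simp) x')
    have h4 : q ∘ (fun z : M => g • z) = q := by
      funext z; exact ((hq.fibre_eq_orbit z (g • z)).2 ⟨g, rfl⟩).symm
    have h5 := mfderiv_congr_fun (E := E') (E' := E) h4 x' u
    rw [h3] at h5
    exact congrArg (fun z => α ![z]) h5
  rwa [h2] at h1

end Adapted

/-! ### Linear algebra of reduction -/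

section LinearReduction

variable {T T' : Type*} [AddCommGroup T] [Module ℝ T] [TopologicalSpace T]
  [AddCommGroup T'] [Module ℝ T'] [TopologicalSpace T']
  {D : T →L[ℝ] T'} {R : T' →L[ℝ] T} {d : ℕ} {τ : Fin d → T [⋀^Fin 1]→L[ℝ] ℝ}
  {W : Submodule ℝ (T [⋀^Fin 1]→L[ℝ] ℝ)} {W' : Submodule ℝ (T' [⋀^Fin 1]→L[ℝ] ℝ)}

theorem comp_comp_of_leftInverse (hDR : ∀ u, D (R u) = u) {k : ℕ} (α : T' [⋀^Fin k]→L[ℝ] ℝ) :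
    (α.compContinuousLinearMap D).compContinuousLinearMap R = α := by
  ext v
  exact congrArg α (funext fun i => hDR (v i))

theorem comp_eq_zero_of_mem_span (hR : ∀ i u, τ i ![R u] = 0) {w : T [⋀^Fin 1]→L[ℝ] ℝ}
    (hw : w ∈ Submodule.span ℝ (Set.range τ)) : w.compContinuousLinearMap R = 0 := by
  have h : Submodule.span ℝ (Set.range τ) ≤
      LinearMap.ker (ContinuousAlternatingMap.compContinuousLinearMapₗ (ι := Fin 1) (N := ℝ) R) := by
    refine Submodule.span_le.2 ?_
    rintro _ ⟨i, rfl⟩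
    exact alternating_one_ext fun u => (comp_one_apply _ _ _).trans (hR i u)
  exact h hw

theorem disjoint_range_span (hDR : ∀ u, D (R u) = u) (hR : ∀ i u, τ i ![R u] = 0) :
    Disjoint (LinearMap.range (ContinuousAlternatingMap.compContinuousLinearMapₗ (ι := Fin 1)
      (N := ℝ) D)) (Submodule.span ℝ (Set.range τ)) := by
  refine Submodule.disjoint_def.2 ?_
  rintro _ ⟨α, rfl⟩ h
  have h1 := comp_eq_zero_of_mem_span hR h
  have h2 : α = 0 := (comp_comp_of_leftInverse hDR α).symm.trans h1
  rw [h2, map_zero]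

/-- D^*R^*w differs from w by a combination of the τ, which lie in W. -/
theorem comp_lift_mem (hτW : ∀ i, τ i ∈ W)
    (hW' : ∀ α, α ∈ W' ↔ α.compContinuousLinearMap D ∈ W)
    (hdec : ∀ w : T [⋀^Fin 1]→L[ℝ] ℝ,
      w - (w.compContinuousLinearMap R).compContinuousLinearMap D ∈
        Submodule.span ℝ (Set.range τ)) {w : T [⋀^Fin 1]→L[ℝ] ℝ} (hw : w ∈ W) :
    w.compContinuousLinearMap R ∈ W' := by
  have hle : Submodule.span ℝ (Set.range τ) ≤ W := Submodule.span_le.2 (by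
    rintro _ ⟨i, rfl⟩; exact hτW i)
  have h := Submodule.sub_mem _ hw (hle (hdec w))
  rw [sub_sub_cancel] at h
  exact (hW' _).2 h

/-- W is the direct sum of D^*W' and the span of the τ. The sum is direct because R^* kills the τ
and is a left inverse of D^*. -/
theorem finrank_reduction [FiniteDimensional ℝ (T [⋀^Fin 1]→L[ℝ] ℝ)] (hDR : ∀ u, D (R u) = u)
    (hR : ∀ i u, τ i ![R u] = 0) (hτ : LinearIndependent ℝ τ) (hτW : ∀ i, τ i ∈ W)
    (hW' : ∀ α, α ∈ W' ↔ α.compContinuousLinearMap D ∈ W)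
    (hdec : ∀ w : T [⋀^Fin 1]→L[ℝ] ℝ,
      w - (w.compContinuousLinearMap R).compContinuousLinearMap D ∈
        Submodule.span ℝ (Set.range τ)) :
    Module.finrank ℝ W' + d = Module.finrank ℝ W := by
  set P : (T' [⋀^Fin 1]→L[ℝ] ℝ) →ₗ[ℝ] (T [⋀^Fin 1]→L[ℝ] ℝ) :=
    ContinuousAlternatingMap.compContinuousLinearMapₗ D
  have hP : Function.Injective P := comp_injective fun u => ⟨R u, hDR u⟩
  have h1 : Module.finrank ℝ (W'.map P) = Module.finrank ℝ W' :=
    (Submodule.equivMapOfInjective P hP W').finrank_eq.symm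
  have h2 : Module.finrank ℝ (Submodule.span ℝ (Set.range τ)) = d := by
    rw [finrank_span_eq_card hτ, Fintype.card_fin]
  have hinf : W'.map P ⊓ Submodule.span ℝ (Set.range τ) = ⊥ :=
    ((disjoint_range_span hDR hR).mono_left LinearMap.map_le_range).eq_bot
  have hsup : W'.map P ⊔ Submodule.span ℝ (Set.range τ) = W := by
    refine le_antisymm (sup_le ?_ (Submodule.span_le.2 ?_)) fun w hw => ?_
    · rintro _ ⟨α, hα, rfl⟩
      exact (hW' α).1 hα
    · rintro _ ⟨i, rfl⟩
      exact hτW i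
    · exact Submodule.mem_sup.2 ⟨_, ⟨_, comp_lift_mem hτW hW' hdec hw, rfl⟩, _, hdec w,
        add_sub_cancel _ _⟩
  have h3 := Submodule.finrank_sup_add_finrank_inf_eq (W'.map P) (Submodule.span ℝ (Set.range τ))
  rw [hinf, hsup, finrank_bot, h1, h2] at h3
  omega

theorem span_comp_lift (hDR : ∀ u, D (R u) = u) (hτW : ∀ i, τ i ∈ W)
    (hW' : ∀ α, α ∈ W' ↔ α.compContinuousLinearMap D ∈ W)
    (hdec : ∀ w : T [⋀^Fin 1]→L[ℝ] ℝ,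
      w - (w.compContinuousLinearMap R).compContinuousLinearMap D ∈
        Submodule.span ℝ (Set.range τ)) {ι : Type*} {θ : ι → T [⋀^Fin 1]→L[ℝ] ℝ}
    (hθ : Submodule.span ℝ (Set.range θ) = W) :
    Submodule.span ℝ (Set.range fun i => (θ i).compContinuousLinearMap R) = W' := by
  have h1 : Submodule.span ℝ (Set.range fun i => (θ i).compContinuousLinearMap R) =
      W.map (ContinuousAlternatingMap.compContinuousLinearMapₗ R) := by
    rw [← hθ, Submodule.map_span, ← Set.range_comp]
    rfl
  rw [h1]
  refine le_antisymm ?_ fun α hα => ?_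
  · rintro _ ⟨w, hw, rfl⟩
    exact comp_lift_mem hτW hW' hdec hw
  · exact ⟨_, (hW' α).1 hα, comp_comp_of_leftInverse hDR α⟩

theorem linearIndependent_sum_elim (hDR : ∀ u, D (R u) = u) (hR : ∀ i u, τ i ![R u] = 0)
    (hτ : LinearIndependent ℝ τ) {ι : Type*} {α : ι → T' [⋀^Fin 1]→L[ℝ] ℝ}
    (hα : LinearIndependent ℝ α) :
    LinearIndependent ℝ (Sum.elim (fun i => (α i).compContinuousLinearMap D) τ) := by
  refine LinearIndependent.sum_type ?_ hτ ((disjoint_range_span hDR hR).mono_left ?_)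
  · exact hα.map' (ContinuousAlternatingMap.compContinuousLinearMapₗ D)
      (LinearMap.ker_eq_bot.2 (comp_injective fun u => ⟨R u, hDR u⟩))
  · refine Submodule.span_le.2 ?_
    rintro _ ⟨i, rfl⟩
    exact ⟨α i, rfl⟩

theorem lift_mem_annihilator (hW : ∀ w ∈ W, w.compContinuousLinearMap R ∈ W') {u : T'}
    (hu : u ∈ annihilator W') : R u ∈ annihilator W := fun w hw => by
  rw [← comp_one_apply]
  exact hu _ (hW w hw)

theorem comp_mem_exteriorSquare (hW : ∀ w ∈ W, w.compContinuousLinearMap R ∈ W')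
    {η : T [⋀^Fin 2]→L[ℝ] ℝ} (hη : η ∈ exteriorSquare W) :
    η.compContinuousLinearMap R ∈ exteriorSquare W' := by
  have h : exteriorSquare W ≤ (exteriorSquare W').comap
      (ContinuousAlternatingMap.compContinuousLinearMapₗ R) := by
    refine Submodule.span_le.2 ?_
    rintro _ ⟨α, hα, β, hβ, rfl⟩
    exact Submodule.subset_span ⟨_, hW α hα, _, hW β hβ, wedge_comp α β R⟩
  exact h hη

end LinearReduction

/-! ### Reduction of subbundles -/

section Reduction

variable {E : Type*} [NormedAddCommGroup E] [NormedSpace ℝ E]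
  {M : Type*} [TopologicalSpace M] [ChartedSpace E M] [IsManifold 𝓘(ℝ, E) ∞ M]
  {E' : Type*} [NormedAddCommGroup E'] [NormedSpace ℝ E']
  {N : Type*} [TopologicalSpace N] [ChartedSpace E' N] [IsManifold 𝓘(ℝ, E') ∞ N]
  [FiniteDimensional ℝ E] [FiniteDimensional ℝ E']
  {G : Type*} [Group G] [MulAction G M] {q : M → N} {S W : CotField E M}

theorem AdaptedLift.continuousAt {y₀ : N} (L : AdaptedLift (E' := E') q S y₀) : ContinuousAt L.ξ y₀ :=
  L.good.self_of_nhds.1.continuousAt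

theorem AdaptedLift.eventually_mem {y₀ : N} (L : AdaptedLift (E' := E') q S y₀) (hSW : ∀ x, S x ≤ W x) :
    ∀ᶠ y in 𝓝 y₀, ∀ i, L.σ i (L.ξ y) ∈ W (L.ξ y) := by
  filter_upwards [L.continuousAt.eventually L.coframe] with y hy i
  exact hSW _ (hy i).2

theorem AdaptedLift.eventually_comp_mem
    (hs : ∀ g : G, ContMDiff 𝓘(ℝ, E) 𝓘(ℝ, E) ∞ (fun x : M => g • x))
    (hq : IsRegularQuotient (E := E) (E' := E') G q) {y₀ : N} (L : AdaptedLift (E' := E') q S y₀)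
    (hSW : ∀ x, S x ≤ W x) (hinv : IsInvariant G W) :
    ∀ᶠ y in 𝓝 y₀, ∀ w ∈ W (L.ξ y), w.compContinuousLinearMap (L.R y) ∈
      quotientBundle (E' := E') q W y := by
  filter_upwards [L.good, L.eventually_mem hSW] with y hy hσ w hw
  exact comp_lift_mem hσ (fun α => mem_quotientBundle_iff hs hq hinv hy.2.1) hy.2.2.2.2.2 hw

theorem AdaptedLift.finrank_add
    (hs : ∀ g : G, ContMDiff 𝓘(ℝ, E) 𝓘(ℝ, E) ∞ (fun x : M => g • x))
    (hq : IsRegularQuotient (E := E) (E' := E') G q) {y₀ : N} (L : AdaptedLift (E' := E') q S y₀)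
    (hSW : ∀ x, S x ≤ W x) (hinv : IsInvariant G W) :
    Module.finrank ℝ (quotientBundle (E' := E') q W y₀) + L.d =
      Module.finrank ℝ (W (L.ξ y₀)) := by
  obtain ⟨-, h2, h3, h4, h5, h6⟩ := L.good.self_of_nhds
  exact finrank_reduction (T := TangentSpace 𝓘(ℝ, E) (L.ξ y₀)) (T' := TangentSpace 𝓘(ℝ, E') y₀)
    h3 h4 h5 (L.eventually_mem hSW).self_of_nhds
    (fun α => mem_quotientBundle_iff hs hq hinv h2) h6

theorem isSubbundle_quotientBundle
    (hs : ∀ g : G, ContMDiff 𝓘(ℝ, E) 𝓘(ℝ, E) ∞ (fun x : M => g • x))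
    (hq : IsRegularQuotient (E := E) (E' := E') G q)
    (hlift : ∀ y, Nonempty (AdaptedLift (E' := E') q S y)) (hSW : ∀ x, S x ≤ W x)
    (hinv : IsInvariant G W) (hW : IsSubbundle W) :
    IsSubbundle (quotientBundle (E' := E') q W) := by
  obtain ⟨r, hr⟩ := isSubbundle_iff.1 hW
  have hrank : ∀ x, Module.finrank ℝ (W x) = r := by
    intro x
    obtain ⟨θ, hθ⟩ := hr x
    have := hθ.self_of_nhds
    rw [← this.2.2, finrank_span_eq_card this.2.1, Fintype.card_fin]
  -- The rank is r − d with d = dim E − dim E'. The truncated subtraction is exact, since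
  -- `AdaptedLift.finrank_add` gives d ≤ r.
  refine isSubbundle_of_span (r + Module.finrank ℝ E' - Module.finrank ℝ E) (fun y => ?_)
    fun y => ?_
  · obtain ⟨L⟩ := hlift y
    have h1 := L.finrank_add hs hq hSW hinv
    have h2 := L.finrank_eq
    rw [hrank] at h1
    omega
  · obtain ⟨L⟩ := hlift y
    obtain ⟨θ, hθ⟩ := hr (L.ξ y)
    refine ⟨r, fun i => bundlePullback L.ξ L.R (θ i), ?_⟩
    filter_upwards [L.continuousAt.eventually hθ, L.good, L.eventually_mem hSW,
      L.smoothAt_pullback] with z h1 h2 h3 h4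
    exact ⟨fun i => h4 _ _ (h1.1 i), span_comp_lift h2.2.2.1 h3
      (fun α => mem_quotientBundle_iff hs hq hinv h2.2.1) h2.2.2.2.2.2 h1.2.2⟩

theorem isSection_pullback {η : DForm E' N 1} (hq : ContMDiff 𝓘(ℝ, E) 𝓘(ℝ, E') ∞ q)
    (hη : IsSection (quotientBundle (E' := E') q W) η) :
    IsSection W (DarbouxReduction.pullback (E := E) q η) :=
  ⟨smooth_iff.2 fun x => (smooth_iff.1 hη.1 (q x)).pullback hq.contMDiffAt,
    fun x => (Submodule.mem_iInf _).1 (hη.2 (q x)) ⟨x, rfl⟩⟩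

theorem pullback_apply_lift {k : ℕ} (w : DForm E' N k) {x : M} {y : N} (hxy : q x = y) :
    pullback (E := E) q w x = (w y).compContinuousLinearMap (diffTo q x y) := by
  subst hxy; rfl

theorem AdaptedLift.bundlePullback_pullback {y₀ : N} (L : AdaptedLift (E' := E') q S y₀) {k : ℕ}
    (w : DForm E' N k) :
    ∀ᶠ y in 𝓝 y₀, bundlePullback L.ξ L.R (pullback (E := E) q w) y = w y := by
  filter_upwards [L.good] with y hy
  refine (congrArg (fun η => η.compContinuousLinearMap (L.R y))
    (pullback_apply_lift w hy.2.1)).trans ?_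
  exact comp_comp_of_leftInverse hy.2.2.1 (w y)

/-- For a section θ of W/G, q^*θ is a section of W, so q^*dθ vanishes on the annihilator of W. R
maps the annihilator of W/G into that one, and R^*q^*dθ = dθ. -/
theorem isIntegrable_quotientBundle
    (hs : ∀ g : G, ContMDiff 𝓘(ℝ, E) 𝓘(ℝ, E) ∞ (fun x : M => g • x))
    (hq : IsRegularQuotient (E := E) (E' := E') G q)
    (hlift : ∀ y, Nonempty (AdaptedLift (E' := E') q S y)) (hSW : ∀ x, S x ≤ W x)
    (hinv : IsInvariant G W) (hW : IsIntegrable W) :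
    IsIntegrable (quotientBundle (E' := E') q W) := by
  refine ⟨isSubbundle_quotientBundle hs hq hlift hSW hinv hW.1, fun θ hθ y u hu v hv => ?_⟩
  obtain ⟨L⟩ := hlift y
  have hmem := (L.eventually_comp_mem hs hq hSW hinv).self_of_nhds
  have h1 := hW.2 _ (isSection_pullback hq.smooth hθ) (L.ξ y) _ (lift_mem_annihilator hmem hu) _
    (lift_mem_annihilator hmem hv)
  have h2 := extD_pullback (w := θ) (f := q) (y := L.ξ y) (smooth_iff.1 hθ.1 _)
    hq.smooth.contMDiffAt
  rw [h2] at h1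
  have h3 := (L.bundlePullback_pullback (extD θ)).self_of_nhds
  rw [← h3]
  refine (comp_two_apply _ _ _ _).trans h1

theorem quotientBundle_mono {W W' : CotField E M} (h : ∀ x, W x ≤ W' x) (y : N) :
    quotientBundle (E' := E') q W y ≤ quotientBundle (E' := E') q W' y :=
  iInf_mono fun x => Submodule.comap_mono (h x.1)

/-- An integrable F inside W/G pulls back to an integrable subbundle of W, hence into W^(∞), so F
lies in W^(∞)/G. Conversely W^(∞)/G is integrable; this is where S must lie in W^(∞). -/
theorem infDerived_quotientBundle [T2Space N]
    (hs : ∀ g : G, ContMDiff 𝓘(ℝ, E) 𝓘(ℝ, E) ∞ (fun x : M => g • x))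
    (hq : IsRegularQuotient (E := E) (E' := E') G q)
    (hlift : ∀ y, Nonempty (AdaptedLift (E' := E') q S y)) (hSW : ∀ x, S x ≤ infDerived W x)
    (hinv : IsInvariant G (infDerived W)) (hW : IsIntegrable (infDerived W)) :
    infDerived (quotientBundle (E' := E') q W) = quotientBundle (E' := E') q (infDerived W) := by
  funext y
  refine le_antisymm (iSup₂_le fun F hF => ?_) ?_
  · refine le_iInf fun ⟨x, hx⟩ => ?_
    subst hx
    intro α hα
    refine le_infDerived (isIntegrable_pullField hq.smooth hq.submersion hF.1) (fun z => ?_) x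
      ⟨α, hα, rfl⟩
    rintro _ ⟨β, hβ, rfl⟩
    exact (Submodule.mem_iInf _).1 (hF.2 (q z) hβ) ⟨z, rfl⟩
  · exact le_infDerived (isIntegrable_quotientBundle hs hq hlift hSW hinv hW)
      (quotientBundle_mono (infDerived_le W)) y

/-! ### Reduction of differential systems -/

theorem pullback_wedgeForm {k l : ℕ} (w : DForm E' N k) (α : DForm E' N l) :
    pullback (E := E) q (wedgeForm w α) = wedgeForm (pullback q w) (pullback q α) :=
  funext fun _ => wedge_comp _ _ _

theorem PfaffianEDS.pullback (hq : ContMDiff 𝓘(ℝ, E) 𝓘(ℝ, E') ∞ q) {k : ℕ} {w : DForm E' N k}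
    (hw : PfaffianEDS (quotientBundle (E' := E') q W) k w) :
    PfaffianEDS W k (DarbouxReduction.pullback q w) := by
  induction hw with
  | gen θ h => exact PfaffianEDS.gen _ (isSection_pullback hq h)
  | extD θ h =>
    have h1 : DarbouxReduction.pullback q (DarbouxReduction.extD θ) =
        DarbouxReduction.extD (DarbouxReduction.pullback (E := E) q θ) :=
      funext fun x => (extD_pullback (smooth_iff.1 h.1 _) hq.contMDiffAt).symm
    rw [h1]
    exact PfaffianEDS.extD _ (isSection_pullback hq h)
  | zero k => exact PfaffianEDS.zero k
  | add k w η _ _ h1 h2 => exact PfaffianEDS.add _ _ _ h1 h2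
  | wedge k l w α _ hα h =>
    rw [pullback_wedgeForm]
    exact PfaffianEDS.wedge _ _ _ _ h
      (smooth_iff.2 fun x => (smooth_iff.1 hα (q x)).pullback hq.contMDiffAt)

end Reduction

/-! ### Differential systems and structure equations along a lift -/

section ReductionEDS

variable {E : Type*} [NormedAddCommGroup E] [NormedSpace ℝ E]
  {M : Type*} [TopologicalSpace M] [ChartedSpace E M] [IsManifold 𝓘(ℝ, E) ∞ M]
  {E' : Type*} [NormedAddCommGroup E'] [NormedSpace ℝ E']
  {N : Type*} [TopologicalSpace N] [ChartedSpace E' N] [IsManifold 𝓘(ℝ, E') ∞ N]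
  [FiniteDimensional ℝ E] [FiniteDimensional ℝ E']
  {G : Type*} [Group G] [MulAction G M] {q : M → N} {S W : CotField E M}

theorem exists_global_sections_frame [T2Space M] {V : CotField E M} {r : ℕ} {x : M}
    {θ : Fin r → DForm E M 1} (hθ : ∀ᶠ z in 𝓝 x, (∀ i, SmoothAt (θ i) z) ∧
      LinearIndependent ℝ (fun i => θ i z) ∧
        Submodule.span ℝ (Set.range fun i => θ i z) = V z) :
    ∃ w : Fin r → DForm E M 1, (∀ i, IsSection V (w i)) ∧ ∀ᶠ z in 𝓝 x,
      LinearIndependent ℝ (fun i => w i z) ∧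
        Submodule.span ℝ (Set.range fun i => w i z) = V z := by
  have hext := fun i => exists_section_extension (V := V) (w := θ i) (x := x) (by
    filter_upwards [hθ] with z hz
    exact ⟨hz.1 i, hz.2.2 ▸ Submodule.subset_span ⟨i, rfl⟩⟩)
  choose w hw hwθ using hext
  refine ⟨w, hw, ?_⟩
  filter_upwards [Filter.eventually_all.2 hwθ, hθ] with y h1 h2
  have : (fun i => w i y) = fun i => θ i y := funext h1
  rw [this]
  exact h2.2

theorem mem_annihilator_of_span {T : Type*} [AddCommGroup T] [Module ℝ T] [TopologicalSpace T]
    {ι : Type*} {τ : ι → T [⋀^Fin 1]→L[ℝ] ℝ} {V : Submodule ℝ (T [⋀^Fin 1]→L[ℝ] ℝ)}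
    (hV : Submodule.span ℝ (Set.range τ) = V) {u : T} (hu : ∀ i, τ i ![u] = 0) :
    u ∈ annihilator V := by
  intro w hw
  have h : Submodule.span ℝ (Set.range τ) ≤ LinearMap.ker ((LinearMap.applyₗ u).comp toDual) := by
    refine Submodule.span_le.2 ?_
    rintro _ ⟨i, rfl⟩
    exact (toDual_apply _ _).trans (hu i)
  rw [hV] at h
  exact (toDual_apply _ _).symm.trans (h hw)

theorem annihilator_anti {T : Type*} [AddCommGroup T] [Module ℝ T] [TopologicalSpace T]
    {V V' : Submodule ℝ (T [⋀^Fin 1]→L[ℝ] ℝ)} (h : V ≤ V') : annihilator V' ≤ annihilator V :=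
  fun _ hu w hw => hu w (h hw)

theorem add_sum_neg_smul_apply {T : Type*} [AddCommGroup T] [Module ℝ T] [TopologicalSpace T]
    {ι : Type*} [Fintype ι] {η : T [⋀^Fin 2]→L[ℝ] ℝ} {a : ι → ℝ} {γ : ι → T [⋀^Fin 2]→L[ℝ] ℝ}
    {u v : T} (h : η ![u, v] = ∑ i, a i * γ i ![u, v]) :
    (η + ∑ i, (-a i) • γ i) ![u, v] = 0 := by
  rw [ContinuousAlternatingMap.add_apply, ContinuousAlternatingMap.sum_apply, h,
    ← Finset.sum_add_distrib]
  refine Finset.sum_eq_zero fun i _ => ?_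
  rw [ContinuousAlternatingMap.smul_apply, smul_eq_mul]
  ring

theorem sum_wedge_add_sum_wedge {T : Type*} [AddCommGroup T] [Module ℝ T] [TopologicalSpace T]
    {ι : Type*} [Fintype ι] {η : T [⋀^Fin 2]→L[ℝ] ℝ} {a : ι → ℝ} {γ : ι → T [⋀^Fin 2]→L[ℝ] ℝ}
    {τ β : ι → T [⋀^Fin 1]→L[ℝ] ℝ} {c : ι → T [⋀^Fin 0]→L[ℝ] ℝ}
    (h : η + ∑ i, (-a i) • γ i = ∑ i, wedge (τ i) (β i)) (hc : ∀ i, c i ![] = a i) :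
    ∑ i, wedge (τ i) (β i) + ∑ i, wedge (γ i) (c i) = η := by
  have h1 : ∑ i, wedge (γ i) (c i) = ∑ i, a i • γ i :=
    Finset.sum_congr rfl fun i _ => (wedge_zero_form _ _).trans (by rw [hc])
  have h2 : ∑ i, (-a i) • γ i + ∑ i, a i • γ i = 0 := by
    rw [← Finset.sum_add_distrib]
    exact Finset.sum_eq_zero fun i _ => by rw [← add_smul, neg_add_cancel, zero_smul]
  rw [← h]
  refine (congrArg _ h1).trans ?_
  rw [add_assoc, h2, add_zero]

theorem smul_add_smul_add_eq {V : Type*} [AddCommGroup V] [Module ℝ V] {a a' b b' w : V} {s t : ℝ}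
    (h : a + a' = w) (h' : b + b' = w) (hst : s + t = 1) :
    (s • a + t • b) + (s • a' + t • b') = w := by
  rw [add_add_add_comm, ← smul_add, ← smul_add, h, h', ← add_smul, hst, one_smul]

/-- Along a lift whose coframe consists of sections of the integrable part of `W`, the derivative
of a section of `W` can be expressed, on vectors annihilated by `W`, through the derivatives of a
coframe of the reduced bundle. -/
theorem AdaptedLift.exists_extD_coeff [T2Space M]
    (hs : ∀ g : G, ContMDiff 𝓘(ℝ, E) 𝓘(ℝ, E) ∞ (fun x : M => g • x))
    (hq : IsRegularQuotient (E := E) (E' := E') G q) {y₀ : N}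
    (L : AdaptedLift (E' := E') q S y₀) (hSI : ∀ x, S x ≤ infDerived W x)
    (hI : IsIntegrable (infDerived W)) (hinv : IsInvariant G W) (hW : IsSubbundle W) {r : ℕ}
    {ν : Fin r → DForm E' N 1} (hν : ∀ i, IsSection (quotientBundle (E' := E') q W) (ν i))
    (hνf : LinearIndependent ℝ (fun i => ν i y₀) ∧
      Submodule.span ℝ (Set.range fun i => ν i y₀) = quotientBundle (E' := E') q W y₀)
    {θ : DForm E M 1} (hθ : IsSection W θ) :
    ∃ a : Fin r → N → ℝ, ∀ᶠ y in 𝓝 y₀, (∀ i, ContMDiffAt 𝓘(ℝ, E') 𝓘(ℝ, ℝ) ∞ (a i) y) ∧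
      ∀ u ∈ annihilator (quotientBundle (E' := E') q W y),
        ∀ v ∈ annihilator (quotientBundle (E' := E') q W y),
        bundlePullback L.ξ L.R (extD θ) y ![u, v] = ∑ i, a i y * extD (ν i) y ![u, v] := by
  have hSW : ∀ x, S x ≤ W x := fun x => (hSI x).trans (infDerived_le W x)
  obtain ⟨-, hq₀, hD₀, hσ₀, hli₀, -⟩ := L.good.self_of_nhds
  obtain ⟨rW, hrW⟩ := hW.finrank_eq
  -- The pulled-back frame of W/G together with the σ is a frame of W near ξ(y₀), by the rank count.
  set κ : Fin r ⊕ Fin L.d → DForm E M 1 := Sum.elim (fun i => pullback (E := E) q (ν i)) L.σ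
  have hκs : ∀ᶠ z in 𝓝 (L.ξ y₀), ∀ i, SmoothAt (κ i) z := by
    filter_upwards [L.coframe] with z hz i
    rcases i with i | i
    · exact smooth_iff.1 (isSection_pullback hq.smooth (hν i)).1 z
    · exact (hz i).1
  have hκli : LinearIndependent ℝ (fun i => κ i (L.ξ y₀)) := by
    have h1 := linearIndependent_sum_elim (T := TangentSpace 𝓘(ℝ, E) (L.ξ y₀))
      (T' := TangentSpace 𝓘(ℝ, E') y₀) hD₀ hσ₀ hli₀ hνf.1
    have h2 : (fun i => κ i (L.ξ y₀)) = Sum.elim (fun i =>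
        (ν i y₀).compContinuousLinearMap (diffTo q (L.ξ y₀) y₀)) fun i => L.σ i (L.ξ y₀) := by
      funext i
      rcases i with i | i
      · exact pullback_apply_lift (ν i) hq₀
      · rfl
    rw [h2]
    exact h1
  have hcard : Fintype.card (Fin r ⊕ Fin L.d) = rW := by
    have h1 := L.finrank_add hs hq hSW hinv
    rw [← hνf.2, finrank_span_eq_card hνf.1, hrW] at h1
    simpa using h1
  have hκspan : ∀ᶠ z in 𝓝 (L.ξ y₀), SmoothAt θ z ∧
      θ z ∈ Submodule.span ℝ (Set.range fun i => κ i z) := by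
    filter_upwards [eventually_linearIndependent hκs hκli, L.coframe] with z h1 h2
    have h3 : Submodule.span ℝ (Set.range fun i => κ i z) = W z := by
      refine Submodule.eq_of_le_of_finrank_eq (Submodule.span_le.2 ?_) ?_
      · rintro _ ⟨i | i, rfl⟩
        · exact (isSection_pullback hq.smooth (hν i)).2 z
        · exact hSW _ (h2 i).2
      · rw [finrank_span_eq_card h1, hcard, hrW]
    rw [h3]
    exact ⟨smooth_iff.1 hθ.1 z, hθ.2 z⟩
  obtain ⟨a, ha⟩ := exists_coeff_of_linearIndependent hκs hκli hκspan
  -- Integrability of W^(∞) speaks of global sections, whereas the σ are only local. Global sections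
  -- with the same germs have the same exterior derivatives near ξ(y₀).
  have hσext := fun i => exists_section_extension (V := infDerived W) (w := L.σ i) (x := L.ξ y₀) (by
    filter_upwards [L.coframe] with z hz
    exact ⟨(hz i).1, hSI _ (hz i).2⟩)
  choose σ' hσ' hσσ' using hσext
  have hdσ : ∀ᶠ z in 𝓝 (L.ξ y₀), ∀ i, extD (L.σ i) z = extD (σ' i) z :=
    Filter.eventually_all.2 fun i => by
      filter_upwards [extD_congr_eventually (hσσ' i)] with z hz using hz.symm
  refine ⟨fun i y => a (Sum.inl i) (L.ξ y), ?_⟩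
  filter_upwards [L.good, L.continuousAt.eventually hκs,
    L.continuousAt.eventually (eventually_eventually_nhds.2 ha), L.continuousAt.eventually hdσ,
    L.eventually_comp_mem hs hq hSW hinv, L.continuousAt.eventually L.coframe]
    with y hy h1 h2 h3 h4 h5
  refine ⟨fun i => ContMDiffAt.comp y (h2.self_of_nhds.1 (Sum.inl i)) hy.1, fun u hu v hv => ?_⟩
  have hRu := lift_mem_annihilator h4 hu
  have hRv := lift_mem_annihilator h4 hv
  have hκ0 : ∀ {p}, p ∈ annihilator (W (L.ξ y)) → ∀ i, κ i (L.ξ y) ![p] = 0 := by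
    intro p hp i
    rcases i with i | i
    · exact hp _ ((isSection_pullback hq.smooth (hν i)).2 _)
    · exact hp _ (hSW _ (h5 i).2)
  refine (comp_two_apply _ _ _ _).trans ?_
  refine (extD_apply_eq_sum h1 h2.self_of_nhds.1 (h2.mono fun _ h => h.2) (hκ0 hRu)
    (hκ0 hRv)).trans ?_
  rw [Fintype.sum_sum_type]
  refine (congrArg₂ (· + ·) (Finset.sum_congr rfl fun i _ => ?_)
    (Finset.sum_eq_zero fun i _ => ?_)).trans (add_zero _)
  · refine congrArg (a (Sum.inl i) (L.ξ y) * ·) ?_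
    have h6 : extD (κ (Sum.inl i)) (L.ξ y) = pullback q (extD (ν i)) (L.ξ y) :=
      extD_pullback (smooth_iff.1 (hν i).1 _) hq.smooth.contMDiffAt
    rw [h6, pullback_apply_lift _ hy.2.1]
    refine (comp_two_apply _ _ _ _).trans ?_
    exact congrArg₂ (fun p r => extD (ν i) y ![p, r]) (hy.2.2.1 u) (hy.2.2.1 v)
  · refine mul_eq_zero_of_right _ ?_
    have h6 : extD (κ (Sum.inr i)) (L.ξ y) = extD (σ' i) (L.ξ y) := h3 i
    rw [h6]
    exact hI.2 _ (hσ' i) _ _ (annihilator_anti (infDerived_le W _) hRu) _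
      (annihilator_anti (infDerived_le W _) hRv)

/-- R^*dθ − Σ aᵢ dνᵢ vanishes on the annihilator of W/G, so it equals Σ νᵢ ∧ βᵢ. Hence R^*dθ is
locally in the ideal generated by the νᵢ and dνᵢ; cutting off βᵢ and aᵢ makes the expression global
without changing the germ. -/
theorem AdaptedLift.exists_pfaffianEDS_extD [T2Space M] [T2Space N]
    (hs : ∀ g : G, ContMDiff 𝓘(ℝ, E) 𝓘(ℝ, E) ∞ (fun x : M => g • x))
    (hq : IsRegularQuotient (E := E) (E' := E') G q) {y₀ : N}
    (L : AdaptedLift (E' := E') q S y₀) (hSI : ∀ x, S x ≤ infDerived W x)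
    (hI : IsIntegrable (infDerived W)) (hinv : IsInvariant G W) (hW : IsSubbundle W)
    (hW' : IsSubbundle (quotientBundle (E' := E') q W)) {θ : DForm E M 1} (hθ : IsSection W θ) :
    ∃ w, PfaffianEDS (quotientBundle (E' := E') q W) 2 w ∧
      ∀ᶠ y in 𝓝 y₀, w y = bundlePullback L.ξ L.R (extD θ) y := by
  obtain ⟨r, hr⟩ := isSubbundle_iff.1 hW'
  obtain ⟨ν₀, hν₀⟩ := hr y₀
  obtain ⟨ν, hν, hνf⟩ := exists_global_sections_frame hν₀
  obtain ⟨a, ha⟩ := L.exists_extD_coeff hs hq hSI hI hinv hW hν hνf.self_of_nhds hθ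
  have hνs : ∀ i y, SmoothAt (ν i) y := fun i => smooth_iff.1 (hν i).1
  have hdνs : ∀ i y, SmoothAt (extD (ν i)) y := fun i => smooth_iff.1 (hν i).1.extD
  set η : DForm E' N 2 := bundlePullback L.ξ L.R (extD θ) +
    fun y => ∑ i, (-a i y) • extD (ν i) y with hη
  obtain ⟨β, hβ⟩ := exists_wedge_expansion (τ := ν) (η := η) (x := y₀)
    (Filter.Eventually.of_forall fun y i => hνs i y) hνf.self_of_nhds.1 (by
      filter_upwards [ha, hνf, L.smoothAt_pullback] with y h1 h2 h3
      refine ⟨(h3 2 (extD θ) (smooth_iff.1 hθ.1.extD _)).add (SmoothAt.sum fun i _ =>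
        SmoothAt.smul (h1.1 i).neg (hdνs i y)), fun u v hu hv => ?_⟩
      have h4 := h1.2 u (mem_annihilator_of_span h2.2 hu) v (mem_annihilator_of_span h2.2 hv)
      exact add_sum_neg_smul_apply h4)
  have hβext := fun i => exists_smooth_extension (w := β i) (x := y₀) (hβ.mono fun _ h => h.1 i)
  choose β' hβ's hβ' hβ'c using hβext
  have hcext := fun i => exists_smooth_extension (w := zeroForm (E := E') (a i)) (x := y₀)
    (ha.mono fun _ h => SmoothAt.zeroForm (h.1 i))
  choose c hcs hc hcc using hcext
  refine ⟨∑ i, wedgeForm (ν i) (β' i) + ∑ i, wedgeForm (extD (ν i)) (c i),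
    PfaffianEDS.add _ _ _ (PfaffianEDS.sum fun i _ => PfaffianEDS.wedge _ _ _ _
      (PfaffianEDS.gen _ (hν i)) (hβ's i)) (PfaffianEDS.sum fun i _ => PfaffianEDS.wedge _ _ _ _
      (PfaffianEDS.extD _ (hν i)) (hcs i)), ?_⟩
  filter_upwards [hβ, Filter.eventually_all.2 hβ', Filter.eventually_all.2 hc] with y h1 h2 h3
  rw [Pi.add_apply, Finset.sum_apply, Finset.sum_apply]
  have h4 : ∀ i, c i y ![] = a i y := fun i => by
    rw [h3 i]; rfl
  refine Eq.trans ?_ (sum_wedge_add_sum_wedge h1.2 h4)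
  refine congrArg (· + ∑ i, wedgeForm (extD (ν i)) (c i) y) (Finset.sum_congr rfl fun i _ => ?_)
  exact congrArg (wedge (ν i y)) (h2 i)

/-- R^* respects sums and products and sends sections of W to local sections of W/G. Only the
generators dθ need a separate argument, because R^* does not commute with d. -/
theorem AdaptedLift.exists_pfaffianEDS [T2Space M] [T2Space N]
    (hs : ∀ g : G, ContMDiff 𝓘(ℝ, E) 𝓘(ℝ, E) ∞ (fun x : M => g • x))
    (hq : IsRegularQuotient (E := E) (E' := E') G q) {y₀ : N}
    (L : AdaptedLift (E' := E') q S y₀) (hSI : ∀ x, S x ≤ infDerived W x)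
    (hI : IsIntegrable (infDerived W)) (hinv : IsInvariant G W) (hW : IsSubbundle W)
    (hW' : IsSubbundle (quotientBundle (E' := E') q W)) {k : ℕ} {η : DForm E M k}
    (hη : PfaffianEDS W k η) :
    ∃ w, PfaffianEDS (quotientBundle (E' := E') q W) k w ∧
      ∀ᶠ y in 𝓝 y₀, w y = bundlePullback L.ξ L.R η y := by
  have hSW : ∀ x, S x ≤ W x := fun x => (hSI x).trans (infDerived_le W x)
  induction hη with
  | gen θ h =>
    obtain ⟨w, hw, hwe⟩ := exists_section_extension (V := quotientBundle (E' := E') q W)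
      (w := bundlePullback L.ξ L.R θ) (x := y₀) (by
        filter_upwards [L.smoothAt_pullback, L.eventually_comp_mem hs hq hSW hinv] with y h1 h2
        exact ⟨h1 1 θ (smooth_iff.1 h.1 _), h2 _ (h.2 _)⟩)
    exact ⟨w, PfaffianEDS.gen _ hw, hwe⟩
  | extD θ h => exact L.exists_pfaffianEDS_extD hs hq hSI hI hinv hW hW' h
  | zero k => exact ⟨0, PfaffianEDS.zero k, Filter.Eventually.of_forall fun y => rfl⟩
  | add k w η _ _ h1 h2 =>
    obtain ⟨w₁, hw₁, he₁⟩ := h1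
    obtain ⟨w₂, hw₂, he₂⟩ := h2
    refine ⟨w₁ + w₂, PfaffianEDS.add _ _ _ hw₁ hw₂, ?_⟩
    filter_upwards [he₁, he₂] with y h3 h4
    exact congrArg₂ (· + ·) h3 h4
  | wedge k l w α _ hα h =>
    obtain ⟨w', hw', he⟩ := h
    obtain ⟨α', hα', hαe, -⟩ := exists_smooth_extension (w := bundlePullback L.ξ L.R α) (x := y₀) (by
      filter_upwards [L.smoothAt_pullback] with y h1 using h1 l α (smooth_iff.1 hα _))
    refine ⟨_, PfaffianEDS.wedge _ _ _ _ hw' hα', ?_⟩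
    filter_upwards [he, hαe] with y h1 h2
    rw [bundlePullback_wedge]
    exact congrArg₂ wedge h1 h2

theorem pfaffianEDS_of_pullback [T2Space M] [T2Space N] [SecondCountableTopology N]
    [SigmaCompactSpace N]
    (hs : ∀ g : G, ContMDiff 𝓘(ℝ, E) 𝓘(ℝ, E) ∞ (fun x : M => g • x))
    (hq : IsRegularQuotient (E := E) (E' := E') G q)
    (hlift : ∀ y, Nonempty (AdaptedLift (E' := E') q S y)) (hSI : ∀ x, S x ≤ infDerived W x)
    (hI : IsIntegrable (infDerived W)) (hinv : IsInvariant G W) (hW : IsSubbundle W) {k : ℕ}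
    {w : DForm E' N k} (hw : PfaffianEDS W k (pullback q w)) :
    PfaffianEDS (quotientBundle (E' := E') q W) k w := by
  have hW' := isSubbundle_quotientBundle hs hq hlift
    (fun x => (hSI x).trans (infDerived_le W x)) hinv hW
  refine pfaffianEDS_of_local hW' fun y => ?_
  obtain ⟨L⟩ := hlift y
  obtain ⟨w', hw', he⟩ := L.exists_pfaffianEDS hs hq hSI hI hinv hW hW' hw
  refine ⟨w', hw', ?_⟩
  filter_upwards [he, L.bundlePullback_pullback w] with z h1 h2 using h1.trans h2

theorem quotientEDS_iff [T2Space M] [T2Space N] [SecondCountableTopology N]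
    [SigmaCompactSpace N]
    (hs : ∀ g : G, ContMDiff 𝓘(ℝ, E) 𝓘(ℝ, E) ∞ (fun x : M => g • x))
    (hq : IsRegularQuotient (E := E) (E' := E') G q)
    (hlift : ∀ y, Nonempty (AdaptedLift (E' := E') q S y)) (hSI : ∀ x, S x ≤ infDerived W x)
    (hI : IsIntegrable (infDerived W)) (hinv : IsInvariant G W) (hW : IsSubbundle W) (k : ℕ)
    (w : DForm E' N k) : QuotientEDS q (PfaffianEDS W) k w ↔
      PfaffianEDS (quotientBundle (E' := E') q W) k w :=
  ⟨fun h => pfaffianEDS_of_pullback hs hq hlift hSI hI hinv hW h.2,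
    fun h => ⟨h.smooth, h.pullback hq.smooth⟩⟩

/-- Split d(q^*w) = α + β upstairs and apply R^*, which maps Λ²(Wᵢ) to Λ²(Wᵢ/G) and d(q^*w) = q^*dw
to dw. The splittings of dw form a convex set at each point, so the local ones glue. -/
theorem exists_structureEq_quotient [T2Space N] [SigmaCompactSpace N] {W₁ W₂ : CotField E M}
    (hs : ∀ g : G, ContMDiff 𝓘(ℝ, E) 𝓘(ℝ, E) ∞ (fun x : M => g • x))
    (hq : IsRegularQuotient (E := E) (E' := E') G q)
    (hlift : ∀ y, Nonempty (AdaptedLift (E' := E') q S y)) (hS₁ : ∀ x, S x ≤ W₁ x)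
    (hS₂ : ∀ x, S x ≤ W₂ x) (inv₁ : IsInvariant G W₁) (inv₂ : IsInvariant G W₂)
    (hstr : ∀ w : DForm E M 1, IsSection (fun x => W₁ x ⊓ W₂ x) w →
      ∃ α β : DForm E M 2, IsSection₂ W₁ α ∧ IsSection₂ W₂ β ∧ extD w = α + β)
    (w : DForm E' N 1) (hw : IsSection (fun y => quotientBundle (E' := E') q W₁ y ⊓
      quotientBundle (E' := E') q W₂ y) w) :
    ∃ α β : DForm E' N 2, IsSection₂ (quotientBundle (E' := E') q W₁) α ∧
      IsSection₂ (quotientBundle (E' := E') q W₂) β ∧ extD w = α + β := by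
  obtain ⟨α, β, hα, hβ, hαβ⟩ := hstr (pullback (E := E) q w)
    ⟨(isSection_pullback hq.smooth (W := W₁) ⟨hw.1, fun y => (hw.2 y).1⟩).1, fun x =>
      ⟨(isSection_pullback hq.smooth (W := W₁) ⟨hw.1, fun y => (hw.2 y).1⟩).2 x,
        (isSection_pullback hq.smooth (W := W₂) ⟨hw.1, fun y => (hw.2 y).2⟩).2 x⟩⟩
  set P : ∀ z : N, Set (∀ _ : Bool, TangentSpace 𝓘(ℝ, E') z [⋀^Fin 2]→L[ℝ] ℝ) := fun z =>
    {a | a true ∈ exteriorSquare (quotientBundle (E' := E') q W₁ z) ∧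
      a false ∈ exteriorSquare (quotientBundle (E' := E') q W₂ z) ∧ a true + a false = extD w z}
  obtain ⟨a, has, ha⟩ := exists_smooth_glue (E := E') (M := N) (fun _ : Bool => 2) P
    (fun z a ha b hb s t hs ht hst => ⟨Submodule.add_mem _ (Submodule.smul_mem _ s ha.1)
        (Submodule.smul_mem _ t hb.1), Submodule.add_mem _ (Submodule.smul_mem _ s ha.2.1)
        (Submodule.smul_mem _ t hb.2.1),
        smul_add_smul_add_eq ha.2.2 hb.2.2 hst⟩)
    (fun y => by
      obtain ⟨L⟩ := hlift y
      refine ⟨fun b => bundlePullback L.ξ L.R (cond b α β), ?_⟩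
      filter_upwards [L.smoothAt_pullback, L.eventually_comp_mem hs hq hS₁ inv₁,
        L.eventually_comp_mem hs hq hS₂ inv₂, L.bundlePullback_pullback (extD w)] with z h1 h2 h3 h4
      refine ⟨fun b => h1 2 _ ?_, comp_mem_exteriorSquare h2 (hα.2 _),
        comp_mem_exteriorSquare h3 (hβ.2 _), ?_⟩
      · cases b
        · exact smooth_iff.1 hβ.1 _
        · exact smooth_iff.1 hα.1 _
      · refine Eq.trans ?_ h4
        have h5 : extD (pullback (E := E) q w) = pullback q (extD w) := funext fun x =>
          extD_pullback (smooth_iff.1 hw.1 _) hq.smooth.contMDiffAt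
        rw [← h5, hαβ]
        rfl)
  exact ⟨a true, a false, ⟨has true, fun z => (ha z).1⟩, ⟨has false, fun z => (ha z).2.1⟩,
    funext fun z => (ha z).2.2.symm⟩

end ReductionEDS

/-! ### Spanning and disjointness of reduced bundles -/

section DarbouxPair

variable {E : Type*} [NormedAddCommGroup E] [NormedSpace ℝ E]
  {M : Type*} [TopologicalSpace M] [ChartedSpace E M] [IsManifold 𝓘(ℝ, E) ∞ M]
  {E' : Type*} [NormedAddCommGroup E'] [NormedSpace ℝ E']
  {N : Type*} [TopologicalSpace N] [ChartedSpace E' N] [IsManifold 𝓘(ℝ, E') ∞ N]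
  [FiniteDimensional ℝ E] [FiniteDimensional ℝ E']
  {G : Type*} [Group G] [MulAction G M] {q : M → N} {S A B : CotField E M}

/-- Decompose q^*α = a + b and apply R^*; since R^*q^* is the identity, α = R^*a + R^*b. -/
theorem quotientBundle_sup_eq_top
    (hs : ∀ g : G, ContMDiff 𝓘(ℝ, E) 𝓘(ℝ, E) ∞ (fun x : M => g • x))
    (hq : IsRegularQuotient (E := E) (E' := E') G q)
    (hlift : ∀ y, Nonempty (AdaptedLift (E' := E') q S y)) (hSA : ∀ x, S x ≤ A x)
    (hSB : ∀ x, S x ≤ B x) (hA : IsInvariant G A) (hB : IsInvariant G B)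
    (hAB : ∀ x, A x ⊔ B x = ⊤) (y : N) :
    quotientBundle (E' := E') q A y ⊔ quotientBundle (E' := E') q B y = ⊤ := by
  refine eq_top_iff.2 fun α _ => ?_
  obtain ⟨L⟩ := hlift y
  have hmem : α.compContinuousLinearMap (diffTo q (L.ξ y) y) ∈ A (L.ξ y) ⊔ B (L.ξ y) :=
    hAB (L.ξ y) ▸ Submodule.mem_top
  obtain ⟨a, ha, b, hb, hab⟩ := Submodule.mem_sup.1 hmem
  have h1 := comp_comp_of_leftInverse L.good.self_of_nhds.2.2.1 α
  refine Submodule.mem_sup.2 ⟨_, (L.eventually_comp_mem hs hq hSA hA).self_of_nhds a ha, _,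
    (L.eventually_comp_mem hs hq hSB hB).self_of_nhds b hb, ?_⟩
  refine Eq.trans ?_ h1
  rw [← hab]
  rfl

theorem quotientBundle_inf_eq_bot (hq : IsRegularQuotient (E := E) (E' := E') G q)
    (hAB : ∀ x, A x ⊓ B x = ⊥) (y : N) :
    quotientBundle (E' := E') q A y ⊓ quotientBundle (E' := E') q B y = ⊥ := by
  refine (Submodule.eq_bot_iff _).2 fun α hα => ?_
  obtain ⟨x, rfl⟩ := hq.surjective y
  have h1 : α.compContinuousLinearMap (mfderiv 𝓘(ℝ, E) 𝓘(ℝ, E') q x) ∈ A x ⊓ B x :=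
    ⟨(Submodule.mem_iInf _).1 hα.1 ⟨x, rfl⟩, (Submodule.mem_iInf _).1 hα.2 ⟨x, rfl⟩⟩
  rw [hAB x, Submodule.mem_bot] at h1
  exact comp_injective (hq.submersion x) h1

end DarbouxPair

end

end DarbouxReduction

/-! ### Assembly of the theorem -/

open DarbouxReduction in
theorem theorem3p2
    {E : Type*} [NormedAddCommGroup E] [NormedSpace ℝ E] [FiniteDimensional ℝ E]
    {M : Type*} [TopologicalSpace M] [ChartedSpace E M] [IsManifold 𝓘(ℝ, E) ∞ M]
    [T2Space M] [SecondCountableTopology M]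
    {E' : Type*} [NormedAddCommGroup E'] [NormedSpace ℝ E'] [FiniteDimensional ℝ E']
    {Mbar : Type*} [TopologicalSpace Mbar] [ChartedSpace E' Mbar] [IsManifold 𝓘(ℝ, E') ∞ Mbar]
    [T2Space Mbar] [SecondCountableTopology Mbar]
    {EG : Type*} [NormedAddCommGroup EG] [NormedSpace ℝ EG] [FiniteDimensional ℝ EG]
    {G : Type*} [TopologicalSpace G] [ChartedSpace EG G] [Group G] [LieGroup 𝓘(ℝ, EG) ∞ G]
    [T2Space G] [SecondCountableTopology G]
    [MulAction G M]
    (smooth_action : ContMDiff (𝓘(ℝ, EG).prod 𝓘(ℝ, E)) 𝓘(ℝ, E) ∞ (fun p : G × M => p.1 • p.2))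
    (q : M → Mbar) (hq : IsRegularQuotient (E := E) (E' := E') G q)
    (W₁ W₂ : CotField E M) (hW : IsDarbouxPair W₁ W₂)
    (inv₁ : IsInvariant G W₁) (inv₂ : IsInvariant G W₂)
    (trans₁ : IsTransverse EG G (fun x => W₁ x ⊓ infDerived W₂ x))
    (trans₂ : IsTransverse EG G (fun x => infDerived W₁ x ⊓ W₂ x)) :
    IsSubbundle (quotientBundle (E' := E') q W₁) ∧
    IsSubbundle (quotientBundle (E' := E') q W₂) ∧
    (∀ (k : ℕ) (w : DForm E' Mbar k),
      QuotientEDS q (PfaffianEDS W₁) k w ↔ PfaffianEDS (quotientBundle (E' := E') q W₁) k w) ∧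
    (∀ (k : ℕ) (w : DForm E' Mbar k),
      QuotientEDS q (PfaffianEDS W₂) k w ↔ PfaffianEDS (quotientBundle (E' := E') q W₂) k w) ∧
    IsDarbouxPair (quotientBundle (E' := E') q W₁) (quotientBundle (E' := E') q W₂) := by
  have : LocallyCompactSpace Mbar := Manifold.locallyCompact_of_finiteDimensional 𝓘(ℝ, E')
  have : SigmaCompactSpace Mbar := inferInstance
  have hs : ∀ g : G, ContMDiff 𝓘(ℝ, E) 𝓘(ℝ, E) ∞ (fun x : M => g • x) :=
    contMDiff_translation smooth_action
  -- Transversality passes from infinitesimal generators to all vertical vectors, which is the form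
  -- the lifts require.
  have hvert : ∀ {S : CotField E M}, IsTransverse EG G S →
      ∀ x (v : TangentSpace 𝓘(ℝ, E) x), mfderiv 𝓘(ℝ, E) 𝓘(ℝ, E') q x v = 0 →
      (∀ w ∈ S x, w ![v] = 0) → v = 0 := fun hS x v hv h =>
    (Submodule.eq_bot_iff _).1 (hS x) v
      ⟨ker_mfderiv_le_infGenerators smooth_action hq x v hv, h⟩
  have invI₁ := infDerived_invariant smooth_action hW.integrable₁ inv₁
  have invI₂ := infDerived_invariant smooth_action hW.integrable₂ inv₂
  -- The two transversality hypotheses yield two kinds of lift: here the coframe lies in W₁ ⊓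
  -- W₂^(∞), and for `lift₂` in W₁^(∞) ⊓ W₂. Both coframes lie in W₁ and in W₂, but only the first
  -- lies in W₂^(∞) and only the second in W₁^(∞).
  have lift₁ := nonempty_adaptedLift hq hW.subbundle₁ hW.integrable₂.1 hW.sum₁ (hvert trans₁)
  have lift₂ := nonempty_adaptedLift hq hW.integrable₁.1 hW.subbundle₂
    (fun x => sup_comm (W₂ x) (infDerived W₁ x) ▸ hW.sum₂ x) (hvert trans₂)
  have hinf₁ := infDerived_quotientBundle hs hq lift₂ (fun _ => inf_le_left) invI₁ hW.integrable₁
  have hinf₂ := infDerived_quotientBundle hs hq lift₁ (fun _ => inf_le_right) invI₂ hW.integrable₂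
  have sub₁ := isSubbundle_quotientBundle hs hq lift₁ (fun _ => inf_le_left) inv₁ hW.subbundle₁
  have sub₂ := isSubbundle_quotientBundle hs hq lift₂ (fun _ => inf_le_right) inv₂ hW.subbundle₂
  -- The indices cross: reducing the differential system of W₁ needs a coframe inside W₁^(∞), hence
  -- `lift₂`, and that of W₂ needs `lift₁`.
  refine ⟨sub₁, sub₂, quotientEDS_iff hs hq lift₂ (fun _ => inf_le_left) hW.integrable₁ inv₁
    hW.subbundle₁, quotientEDS_iff hs hq lift₁ (fun _ => inf_le_right) hW.integrable₂ inv₂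
    hW.subbundle₂, sub₁, sub₂, ?_, ?_, fun y => ?_, fun y => ?_, fun y => ?_, ?_⟩
  · rw [hinf₁]
    exact isIntegrable_quotientBundle hs hq lift₂ (fun _ => inf_le_left) invI₁ hW.integrable₁
  · rw [hinf₂]
    exact isIntegrable_quotientBundle hs hq lift₁ (fun _ => inf_le_right) invI₂ hW.integrable₂
  · rw [hinf₂]
    exact quotientBundle_sup_eq_top hs hq lift₁ (fun _ => inf_le_left) (fun _ => inf_le_right)
      inv₁ invI₂ hW.sum₁ y
  · rw [hinf₁]
    exact quotientBundle_sup_eq_top hs hq lift₂ (fun _ => inf_le_right) (fun _ => inf_le_left)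
      inv₂ invI₁ hW.sum₂ y
  · rw [hinf₁, hinf₂]
    exact quotientBundle_inf_eq_bot hq hW.inter y
  · exact exists_structureEq_quotient hs hq lift₁ (fun _ => inf_le_left)
      (fun x => inf_le_right.trans (infDerived_le W₂ x)) inv₁ inv₂ hW.structureEq
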